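/- Let $\Bbbk$ be a field. All dg categories are small, over $\Bbbk$, with cohomological grading; $d$ has degree $+1$ and $d(fg)=(df)g+(-1)^{|f|}f\,dg$. Chains $d_0\xrightarrow{g_1}d_1\to\dots\xrightarrow{g_N}d_N$ of composable homogeneous morphisms are written in the order of composition. **The dg category $\mathrm{Coh}_{dg}(C,D)$.** Its objects are the dg functors $C\to D$. A morphism $\Psi\colon F\Rightarrow G$ of degree $p$ is a reduced Hochschild cochain: a family, indexed by all $n\ge 0$ and all $x_0,\dots,x_n\in C$, of $\Bbbk$-multilinear maps $(f_n,\dots,f_1)\mapsto\Psi(f_n,\dots,f_1)\in D(F x_0,Gx_n)$, defined for chains $x_0\xrightarrow{f_1}\cdots\xrightarrow{f_n}x_n$, of degree $p+\sum_i(|f_i|-1)$, vanishing if some $f_i$ is an identity. Composition is $$(\Psi_2\circ\Psi_1)(f_N,\dots,f_1)=\sum_{m=0}^N(-1)^{|\Psi_1|\sum_{i>m}(|f_i|-1)}\Psi_2(f_N,\dots,f_{m+1})\circ\Psi_1(f_m,\dots,f_1),$$ the identity of $F$ is $\mathrm{id}_{Fx}$ on the empty chain at $x$ and $0$ on the nonempty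 chains, and the differential is $$\begin{aligned}(\delta\Psi)(f_n,\dots,f_1)=\ &d(\Psi(f_n,\dots,f_1))+\sum_{i=1}^n(-1)^{|\Psi|+\sum_{j>i}(|f_j|-1)}\Psi(f_n,\dots,df_i,\dots,f_1)\\&+(-1)^{|\Psi||f_n|+|\Psi|}G(f_n)\circ\Psi(f_{n-1},\dots,f_1)+\sum_{i=1}^{n-1}(-1)^{|\Psi|+\sum_{j\ge i+1}(|f_j|-1)}\Psi(f_n,\dots,f_{i+1}f_i,\dots,f_1)\\&+(-1)^{|\Psi|+1+\sum_{j\ge2}(|f_j|-1)}\Psi(f_n,\dots,f_2)\circ F(f_1),\end{aligned}$$ where for $n=0$ only $d(\Psi(\,))$ occurs. **The twisted tensor product $C\tilde\otimes D$.** It is the dg category with set of objects $\mathrm{Ob}\,C\times\mathrm{Ob}\,D$ presented by the generators $\mathrm{id}_c\otimes g\colon(c,d)\to(c,d')$, of degree $|g|$ (for $c\in C$, $g\in D(d,d')$), and $\varepsilon(f;g_1,\dots,g_N)\colon(c,d_0)\to(c',d_N)$, of degree $|f|+\sum_i(|g_i|-1)$ (for $f\in C(c,c')$ and chains $d_0\xrightarrow{g_1}\cdots\xrightarrow{g_N}d_N$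 in $D$, $N\ge0$), where for $N=0$ one writes $\varepsilon(f;\,)=f\otimes\mathrm{id}_{d_0}$, subject to the relations: $g\mapsto\mathrm{id}_c\otimes g$ is a dg functor; $\varepsilon(f;g_1,\dots,g_N)$ is linear in each argument, and is $0$ if some $g_i$ is an identity; $\mathrm{id}_c\otimes\mathrm{id}_d$ is the identity and $\varepsilon(\mathrm{id}_c;g_1,\dots,g_N)=0$ for $N\ge1$; $$\varepsilon(f_2f_1;g_1,\dots,g_N)=\sum_{m=0}^N(-1)^{|f_1|\sum_{j>m}(|g_j|-1)}\varepsilon(f_2;g_{m+1},\dots,g_N)\,\varepsilon(f_1;g_1,\dots,g_m);$$ $$\begin{aligned}\varepsilon(df;g_1,\dots,g_N)=\ &d\,\varepsilon(f;g_1,\dots,g_N)+\sum_{i}(-1)^{|f|+\sum_{j>i}(|g_j|-1)}\varepsilon(f;g_1,\dots,dg_i,\dots,g_N)\\&+(-1)^{|f||g_N|+|f|}(\mathrm{id}\otimes g_N)\,\varepsilon(f;g_1,\dots,g_{N-1})+\sum_{i=1}^{N-1}(-1)^{|f|+\sum_{j\ge i+1}(|g_j|-1)}\varepsilon(f;g_1,\dots,g_{i+1}g_i,\dots,g_N)\\&+(-1)^{|f|+1+\sum_{j\ge2}(|g_j|-1)}\varepsilon(f;g_2,\dots,g_N)(\mathrm{id}\otimes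 g_1),\end{aligned}$$ where for $N=0$ only $d\,\varepsilon(f;\,)$ occurs. Dg functors $F,G$ induce $F\tilde\otimes G$ by $\mathrm{id}_c\otimes g\mapsto\mathrm{id}_{Fc}\otimes Gg$ and $\varepsilon(f;g_1,\dots,g_N)\mapsto\varepsilon(Ff;Gg_1,\dots,Gg_N)$. **Interleavings.** Given chains $g_1,\dots,g_M$ and $h_1,\dots,h_N$, an interleaving is obtained from $h_N,\dots,h_1$ by choosing disjoint, possibly empty blocks of consecutive $h_j$, one for each $g_i$, placed in the order $g_M,\dots,g_1$ from left to right, replacing the block of $g_i$ by the one entry $(g_i;\text{block})$, and keeping the remaining $h_j$. Its sign is $(-1)^{\sum_i(|g_i|-1)\sum_j(|h_j|-1)}$, where for each $i$ the inner sum is over all $h_j$ to the left of (that is, applied after) the block of $g_i$. **Theorem.** (1) For all dg categories $C,D,E$ there is a unique dg functor $\alpha\colon(C\tilde\otimes D)\tilde\otimes E\to C\tilde\otimes(D\tilde\otimes E)$, given on objects by $((c,d),e)\mapsto(c,(d,e))$, such that $$\alpha(\mathrm{id}_{(c,d)}\otimes h)=\mathrm{id}_c\otimes(\mathrm{id}_d\otimes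 h),\qquad \alpha(\varepsilon(\mathrm{id}_c\otimes g;h_1,\dots,h_N))=\mathrm{id}_c\otimes\varepsilon(g;h_1,\dots,h_N),$$ and $\alpha(\varepsilon(\varepsilon(f;g_1,\dots,g_M);h_1,\dots,h_N))$ is the sum over all interleavings of $g_1,\dots,g_M$ with $h_1,\dots,h_N$, with their signs, of $\varepsilon(f;\text{interleaving})$, where an entry $(g_i;\text{block})$ is read as $\varepsilon(g_i;\text{block})$ and a remaining $h_j$ as $\mathrm{id}\otimes h_j$. This is the one-sided associator. (2) There are dg functors (the twisted compositions) $$\tilde m=\tilde m_{A,B,C}\colon\mathrm{Coh}_{dg}(B,C)\,\tilde\otimes\,\mathrm{Coh}_{dg}(A,B)\to\mathrm{Coh}_{dg}(A,C),$$ one for each triple of dg categories $A,B,C$, given on objects by $(G,F)\mapsto G\circ F$ and such that $\tilde m(\mathrm{id}_G\otimes\Psi)(f_n,\dots,f_1)=G(\Psi(f_n,\dots,f_1))$ and $\tilde m(\varepsilon(\Theta;\Psi_1,\dots,\Psi_M))$ is the brace operation: its value on $(f_n,\dots,f_1)$ is the sum over all interleavings of $\Psi_1,\dots,\Psi_M$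 with $f_1,\dots,f_n$, with their signs, of $\Theta(\text{interleaving})$, where an entry $(\Psi_i;\text{block})$, with $\Psi_i\colon F_{i-1}\Rightarrow F_i$, is read as $\Psi_i(\text{block})$, and a remaining $f_j$ lying between the blocks of $\Psi_{i+1}$ and $\Psi_i$ as $F_i(f_j)$ (so, in particular, $\tilde m(\Theta\otimes\mathrm{id}_F)(f_n,\dots,f_1)=\Theta(Ff_n,\dots,Ff_1)$); and such that for all dg categories $A,B,C,D$ the two dg functors $$\tilde m_{A,B,D}\circ(\tilde m_{B,C,D}\,\tilde\otimes\,\mathrm{id}),\quad \tilde m_{A,C,D}\circ(\mathrm{id}\,\tilde\otimes\,\tilde m_{A,B,C})\circ\alpha\ \colon\ (\mathrm{Coh}_{dg}(C,D)\tilde\otimes\mathrm{Coh}_{dg}(B,C))\tilde\otimes\mathrm{Coh}_{dg}(A,B)\to\mathrm{Coh}_{dg}(A,D)$$ are equal. -/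

import Mathlib

set_option linter.unusedSectionVars false

universe u

namespace Twisted

/-- The sign `(-1)^n` as a scalar. -/
def sgn (k : Type u) [Field k] (n : ℤ) : k := ((n.negOnePow : ℤˣ) : ℤ)

theorem sgn_add (k : Type u) [Field k] (m n : ℤ) : sgn k (m + n) = sgn k m * sgn k n := by
  simp [sgn, Int.negOnePow_add]

theorem sgn_zero (k : Type u) [Field k] : sgn k 0 = 1 := by simp [sgn]

theorem sgn_one (k : Type u) [Field k] : sgn k 1 = -1 := by simp [sgn]

theorem sgn_eq (k : Type u) [Field k] {m n : ℤ} (h : Even (m - n)) : sgn k m = sgn k n := by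
  rw [sgn, sgn, (Int.negOnePow_eq_iff m n).2 h]

theorem sgn_eq_neg (k : Type u) [Field k] {m n : ℤ} (h : Even (m - n - 1)) :
    sgn k m = -sgn k n := by
  rw [sgn_eq k (n := n + 1) (by convert h using 1; ring), sgn_add, sgn_one]; ring

/-- A (small) differential graded category over `k`, with cohomological grading. Composition and
differential carry a proof of the degree equation. -/
structure DGCat (k : Type u) [Field k] where
  Obj : Type u
  Hom : Obj → Obj → ℤ → Type u
  [addCommGroup : ∀ x y n, AddCommGroup (Hom x y n)]
  [module : ∀ x y n, Module k (Hom x y n)]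
  id : ∀ x, Hom x x 0
  comp : ∀ {x y z : Obj} {p q n : ℤ}, p + q = n → (Hom y z p →ₗ[k] Hom x y q →ₗ[k] Hom x z n)
  d : ∀ {x y : Obj} {n m : ℤ}, n + 1 = m → (Hom x y n →ₗ[k] Hom x y m)
  id_comp : ∀ {x y : Obj} {n : ℤ} (h : 0 + n = n) (f : Hom x y n), comp h (id y) f = f
  comp_id : ∀ {x y : Obj} {n : ℤ} (h : n + 0 = n) (f : Hom x y n), comp h f (id x) = f
  assoc : ∀ {w x y z : Obj} {p q r s t n : ℤ} (hs : p + q = s) (hsr : s + r = n) (ht : q + r = t)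
    (hpt : p + t = n) (f : Hom y z p) (g : Hom x y q) (e : Hom w x r),
    comp hsr (comp hs f g) e = comp hpt f (comp ht g e)
  d_d : ∀ {x y : Obj} {n m l : ℤ} (h : n + 1 = m) (h' : m + 1 = l) (f : Hom x y n),
    d h' (d h f) = 0
  d_comp : ∀ {x y z : Obj} {p q n p' q' m : ℤ} (h : p + q = n) (hm : n + 1 = m) (hp : p + 1 = p')
    (hq : q + 1 = q') (hl : p' + q = m) (hr : p + q' = m) (f : Hom y z p) (g : Hom x y q),
    d hm (comp h f g) = comp hl (d hp f) g + sgn k p • comp hr f (d hq g)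

attribute [instance] DGCat.addCommGroup DGCat.module

variable {k : Type u} [Field k]

namespace DGCat

variable (X : DGCat k) {x y z w : X.Obj}

/-- Reindexing along an equality of degrees (and `0` if the degrees differ). -/
def castTo {m : ℤ} (n : ℤ) : X.Hom x y m →ₗ[k] X.Hom x y n :=
  if h : m = n then h ▸ LinearMap.id else 0

/-- Composition with prescribed target degree (and `0` if the degrees do not match). -/
def compTo {p q : ℤ} (n : ℤ) : X.Hom y z p →ₗ[k] X.Hom x y q →ₗ[k] X.Hom x z n :=
  if h : p + q = n then X.comp h else 0

/-- Differential with prescribed target degree (and `0` if the degrees do not match). -/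
def dTo {m : ℤ} (n : ℤ) : X.Hom x y m →ₗ[k] X.Hom x y n :=
  if h : m + 1 = n then X.d h else 0

@[simp] theorem castTo_self {m : ℤ} (f : X.Hom x y m) : X.castTo m f = f := by simp [castTo]

theorem castTo_of_ne {m n : ℤ} (h : m ≠ n) (f : X.Hom x y m) : X.castTo n f = 0 := by
  simp [castTo, h]

theorem compTo_eq {p q n : ℤ} (h : p + q = n) (f : X.Hom y z p) (g : X.Hom x y q) :
    X.compTo n f g = X.comp h f g := by simp [compTo, h]

theorem compTo_of_ne {p q n : ℤ} (h : p + q ≠ n) (f : X.Hom y z p) (g : X.Hom x y q) :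
    X.compTo n f g = 0 := by simp [compTo, h]

theorem dTo_eq {m n : ℤ} (h : m + 1 = n) (f : X.Hom x y m) : X.dTo n f = X.d h f := by
  simp [dTo, h]

theorem dTo_of_ne {m n : ℤ} (h : m + 1 ≠ n) (f : X.Hom x y m) : X.dTo n f = 0 := by
  simp [dTo, h]

theorem castTo_castTo {m l : ℤ} (n : ℤ) (h : m = l) (f : X.Hom x y m) :
    X.castTo n (X.castTo l f) = X.castTo n f := by subst h; simp

theorem castTo_compTo {p q m : ℤ} (n : ℤ) (h : p + q = m) (f : X.Hom y z p) (g : X.Hom x y q) :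
    X.castTo n (X.compTo m f g) = X.compTo n f g := by
  by_cases hn : m = n
  · subst hn; simp
  · rw [castTo_of_ne _ hn, compTo_of_ne _ (by omega)]

theorem castTo_dTo {p m : ℤ} (n : ℤ) (h : p + 1 = m) (f : X.Hom x y p) :
    X.castTo n (X.dTo m f) = X.dTo n f := by
  by_cases hn : m = n
  · subst hn; simp
  · rw [castTo_of_ne _ hn, dTo_of_ne _ (by omega)]

theorem compTo_castTo_left {p p' q : ℤ} (n : ℤ) (h : p = p') (f : X.Hom y z p) (g : X.Hom x y q) :
    X.compTo n (X.castTo p' f) g = X.compTo n f g := by subst h; simp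

theorem compTo_castTo_right {p q q' : ℤ} (n : ℤ) (h : q = q') (f : X.Hom y z p) (g : X.Hom x y q) :
    X.compTo n f (X.castTo q' g) = X.compTo n f g := by subst h; simp

theorem dTo_castTo {p p' : ℤ} (n : ℤ) (h : p = p') (f : X.Hom x y p) :
    X.dTo n (X.castTo p' f) = X.dTo n f := by subst h; simp

theorem compTo_assoc {p q r s t : ℤ} (n : ℤ) (hs : p + q = s) (ht : q + r = t)
    (f : X.Hom y z p) (g : X.Hom x y q) (e : X.Hom w x r) :
    X.compTo n (X.compTo s f g) e = X.compTo n f (X.compTo t g e) := by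
  by_cases hn : s + r = n
  · rw [compTo_eq _ hs, compTo_eq _ hn, compTo_eq _ ht, compTo_eq _ (show p + t = n by omega),
      X.assoc]
  · rw [compTo_of_ne _ hn, compTo_of_ne _ (by omega)]

theorem dTo_dTo {p m : ℤ} (n : ℤ) (f : X.Hom x y p) : X.dTo n (X.dTo m f) = 0 := by
  by_cases h : p + 1 = m
  · by_cases h' : m + 1 = n
    · rw [dTo_eq _ h, dTo_eq _ h', X.d_d]
    · rw [dTo_of_ne _ h']
  · rw [dTo_of_ne _ h, map_zero]

theorem dTo_compTo {p q m p' q' : ℤ} (n : ℤ) (h : p + q = m) (hp : p + 1 = p') (hq : q + 1 = q')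
    (f : X.Hom y z p) (g : X.Hom x y q) :
    X.dTo n (X.compTo m f g)
      = X.compTo n (X.dTo p' f) g + sgn k p • X.compTo n f (X.dTo q' g) := by
  by_cases hn : m + 1 = n
  · rw [compTo_eq _ h, dTo_eq _ hn, dTo_eq _ hp, dTo_eq _ hq,
      compTo_eq _ (show p' + q = n by omega), compTo_eq _ (show p + q' = n by omega)]
    exact X.d_comp ..
  · rw [dTo_of_ne _ hn, compTo_of_ne _ (by omega), compTo_of_ne _ (by omega)]; simp

theorem id_compTo {p : ℤ} (n : ℤ) (f : X.Hom x y p) : X.compTo n (X.id y) f = X.castTo n f := by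
  by_cases hn : p = n
  · subst hn; rw [compTo_eq _ (zero_add p), X.id_comp, castTo_self]
  · rw [compTo_of_ne _ (by omega), castTo_of_ne _ hn]

theorem compTo_id {p : ℤ} (n : ℤ) (f : X.Hom x y p) : X.compTo n f (X.id x) = X.castTo n f := by
  by_cases hn : p = n
  · subst hn; rw [compTo_eq _ (add_zero p), X.comp_id, castTo_self]
  · rw [compTo_of_ne _ (by omega), castTo_of_ne _ hn]

theorem dTo_id (n : ℤ) (x : X.Obj) : X.dTo n (X.id x) = 0 := by
  by_cases hn : (0 : ℤ) + 1 = n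
  · subst hn
    have h := X.dTo_compTo (0 + 1) (show (0 : ℤ) + 0 = 0 by simp) rfl rfl (X.id x) (X.id x)
    rw [id_compTo, compTo_id, id_compTo, sgn_zero, one_smul] at h
    simpa using h
  · rw [dTo_of_ne _ hn]

end DGCat

/-- A dg functor with prescribed action `obj` on objects. -/
structure DGMap (X Y : DGCat k) (obj : X.Obj → Y.Obj) where
  map : ∀ {x y : X.Obj} {n : ℤ}, X.Hom x y n →ₗ[k] Y.Hom (obj x) (obj y) n
  map_id : ∀ x, map (X.id x) = Y.id (obj x)
  map_comp : ∀ {x y z : X.Obj} {p q n : ℤ} (h : p + q = n) (f : X.Hom y z p) (g : X.Hom x y q),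
    map (X.comp h f g) = Y.comp h (map f) (map g)
  map_d : ∀ {x y : X.Obj} {n m : ℤ} (h : n + 1 = m) (f : X.Hom x y n),
    map (X.d h f) = Y.d h (map f)

/-- A dg functor. -/
structure DGFunctor (X Y : DGCat k) where
  obj : X.Obj → Y.Obj
  toMap : DGMap X Y obj

/-- The dg functor underlying a dg functor with prescribed action on objects. -/
def DGMap.functor {X Y : DGCat k} {obj : X.Obj → Y.Obj} (F : DGMap X Y obj) : DGFunctor X Y :=
  ⟨obj, F⟩

namespace DGFunctor

variable {X Y Z : DGCat k}

/-- The action of a dg functor on morphisms. -/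
def map (F : DGFunctor X Y) {x y : X.Obj} {n : ℤ} : X.Hom x y n →ₗ[k] Y.Hom (F.obj x) (F.obj y) n :=
  F.toMap.map

/-- The identity dg functor. -/
def id (X : DGCat k) : DGFunctor X X where
  obj x := x
  toMap :=
    { map := LinearMap.id
      map_id := fun _ => rfl
      map_comp := fun _ _ _ => rfl
      map_d := fun _ _ => rfl }

/-- `F.comp G` is "first `F`, then `G`". -/
def comp (F : DGFunctor X Y) (G : DGFunctor Y Z) : DGFunctor X Z where
  obj x := G.obj (F.obj x)
  toMap :=
    { map := G.map ∘ₗ F.map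
      map_id := fun x => by simp [map, F.toMap.map_id, G.toMap.map_id]
      map_comp := fun h f g => by simp [map, F.toMap.map_comp, G.toMap.map_comp]
      map_d := fun h f => by simp [map, F.toMap.map_d, G.toMap.map_d] }

theorem map_id (F : DGFunctor X Y) (x : X.Obj) : F.map (X.id x) = Y.id (F.obj x) :=
  F.toMap.map_id x

theorem map_castTo (F : DGFunctor X Y) {x y : X.Obj} {m : ℤ} (n : ℤ) (f : X.Hom x y m) :
    F.map (X.castTo n f) = Y.castTo n (F.map f) := by
  by_cases h : m = n
  · subst h; simp
  · rw [X.castTo_of_ne h, Y.castTo_of_ne h, map_zero]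

theorem map_compTo (F : DGFunctor X Y) {x y z : X.Obj} {p q : ℤ} (n : ℤ) (f : X.Hom y z p)
    (g : X.Hom x y q) : F.map (X.compTo n f g) = Y.compTo n (F.map f) (F.map g) := by
  by_cases h : p + q = n
  · rw [X.compTo_eq h, Y.compTo_eq h]; exact F.toMap.map_comp h f g
  · rw [X.compTo_of_ne h, Y.compTo_of_ne h, map_zero]

theorem map_dTo (F : DGFunctor X Y) {x y : X.Obj} {m : ℤ} (n : ℤ) (f : X.Hom x y m) :
    F.map (X.dTo n f) = Y.dTo n (F.map f) := by
  by_cases h : m + 1 = n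
  · rw [X.dTo_eq h, Y.dTo_eq h]; exact F.toMap.map_d h f
  · rw [X.dTo_of_ne h, Y.dTo_of_ne h, map_zero]

end DGFunctor

/-! ### Chains of composable morphisms -/

/-- A chain `x ⟶ ⋯ ⟶ y` of composable homogeneous morphisms, written as the list
`f_N, …, f_1` with the last applied morphism `f_N` at the head. -/
inductive Chain (C : DGCat k) (x : C.Obj) : C.Obj → Type u
  | nil : Chain C x x
  | cons {y z : C.Obj} {n : ℤ} (f : C.Hom y z n) (c : Chain C x y) : Chain C x z

namespace Chain

variable {C D : DGCat k}

/-- The degree in the bar construction: `∑ (|f_i| - 1)`. -/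
def deg {x : C.Obj} : {y : C.Obj} → Chain C x y → ℤ
  | _, nil => 0
  | _, cons (n := n) _ c => n - 1 + deg c

/-- Concatenation. -/
def append {x y : C.Obj} : {z : C.Obj} → Chain C y z → Chain C x y → Chain C x z
  | _, nil, r => r
  | _, cons f l, r => cons f (append l r)

/-- The image of a chain under an assignment on homogeneous morphisms. -/
def map (o : C.Obj → D.Obj) (φ : ∀ {x y : C.Obj} {n : ℤ}, C.Hom x y n → D.Hom (o x) (o y) n)
    {x : C.Obj} : {y : C.Obj} → Chain C x y → Chain D (o x) (o y)
  | _, nil => nil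
  | _, cons f c => cons (φ f) (map o φ c)

@[simp] theorem deg_nil {x : C.Obj} : (nil : Chain C x x).deg = 0 := rfl

@[simp] theorem deg_cons {x y z : C.Obj} {n : ℤ} (f : C.Hom y z n) (c : Chain C x y) :
    (cons f c).deg = n - 1 + c.deg := rfl

@[simp] theorem nil_append {x y : C.Obj} (r : Chain C x y) : nil.append r = r := rfl

@[simp] theorem cons_append {w x y z : C.Obj} {n : ℤ} (f : C.Hom y z n) (l : Chain C x y)
    (r : Chain C w x) : (cons f l).append r = cons f (l.append r) := rfl

@[simp] theorem deg_append {x y z : C.Obj} (l : Chain C y z) (r : Chain C x y) :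
    (l.append r).deg = l.deg + r.deg := by
  induction l with
  | nil => simp
  | cons f l ih => simp [ih]; ring

@[simp] theorem deg_map (o : C.Obj → D.Obj)
    (φ : ∀ {x y : C.Obj} {n : ℤ}, C.Hom x y n → D.Hom (o x) (o y) n) {x y : C.Obj}
    (c : Chain C x y) : (c.map o φ).deg = c.deg := by
  induction c with
  | nil => rfl
  | cons f c ih => simp [map, ih]

/-- A chain cut into two consecutive pieces. -/
structure Cut (C : DGCat k) (x z : C.Obj) where
  mid : C.Obj
  left : Chain C mid z
  right : Chain C x mid

/-- All the `N + 1` ways of writing a chain of length `N` as `left.append right`. -/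
def cuts {x : C.Obj} : {z : C.Obj} → Chain C x z → List (Cut C x z)
  | _, nil => [⟨x, nil, nil⟩]
  | z, cons f c => ⟨z, nil, cons f c⟩ :: (cuts c).map fun s => ⟨s.mid, cons f s.left, s.right⟩

/-- The chain `f_N f_{N-1}, f_{N-2}, …, f_1` (for `N ≥ 2`) with the sign exponent `|f_N|`. -/
def mulHead {x y z : C.Obj} {n : ℤ} (f : C.Hom y z n) : Chain C x y → List (ℤ × Chain C x z)
  | nil => []
  | cons (n := m) g c => [(n, cons (C.comp (rfl : n + m = n + m) f g) c)]

/-- The bar differential of a chain `f_N, …, f_1` as a formal sum, each summand being recorded with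
the exponent of its sign:
`-∑ i, (-1)^(∑ j > i, (|f_j| - 1)) [f_N, …, d f_i, …, f_1]`
`+ ∑ i, (-1)^(∑ j > i + 1, (|f_j| - 1) + |f_{i+1}|) [f_N, …, f_{i+1} f_i, …, f_1]`. -/
def bar {x : C.Obj} : {y : C.Obj} → Chain C x y → List (ℤ × Chain C x y)
  | _, nil => []
  | _, cons (n := n) f c =>
      ((1, cons (C.d (rfl : n + 1 = n + 1) f) c) ::
        (bar c).map fun t => (n - 1 + t.1, cons f t.2)) ++ mulHead f c

end Chain

/-! ### Hochschild cochains -/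

section Cochains

variable (C D : DGCat k)

/-- Families of maps of total degree `p` from chains `x ⟶ ⋯ ⟶ y` in `C` to `D(F x, G y)`; no
linearity is imposed yet. -/
abbrev PreCochain (F G : C.Obj → D.Obj) (p : ℤ) : Type u :=
  ∀ (x y : C.Obj) (c : Chain C x y), D.Hom (F x) (G y) (p + c.deg)

variable {C D}

namespace PreCochain

variable {F G H K : C.Obj → D.Obj} {p q r n m : ℤ}

/-- The vertical composition
`(Ψ₂ ∘ Ψ₁)(f_N, …, f_1) =`
`∑ m, (-1)^(|Ψ₁| ∑ i > m, (|f_i| - 1)) Ψ₂(f_N, …, f_{m+1}) ∘ Ψ₁(f_m, …, f_1)`, where `n` is the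
sum of the degrees of `Ψ₂` and `Ψ₁`. -/
def conv (n : ℤ) (Ψ₂ : PreCochain C D G H p) (Ψ₁ : PreCochain C D F G q) :
    PreCochain C D F H n := fun x z c =>
  (c.cuts.map fun s => sgn k (q * s.left.deg) •
    D.compTo (n + c.deg) (Ψ₂ s.mid z s.left) (Ψ₁ x s.mid s.right)).sum

/-- `(∂Ψ)(c) = d(Ψ(c)) - (-1)^|Ψ| Ψ(b c)` with `b` the bar differential, where `m = p + 1`. -/
def bdry (m : ℤ) (Ψ : PreCochain C D F G p) : PreCochain C D F G m := fun x y c =>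
  D.dTo (m + c.deg) (Ψ x y c) -
    sgn k p • (c.bar.map fun t => sgn k t.1 • D.castTo (m + c.deg) (Ψ x y t.2)).sum

/-- The identity: the unit on empty chains and `0` on the others. -/
def one (F : C.Obj → D.Obj) : PreCochain C D F F 0 := fun _ _ c =>
  match c with
  | .nil => D.castTo _ (D.id _)
  | .cons _ _ => 0

/-- An assignment on morphisms as a cochain of degree `1` supported on chains of length `1`. -/
def tau (F : C.Obj → D.Obj) (φ : ∀ {x y : C.Obj} {n : ℤ}, C.Hom x y n → D.Hom (F x) (F y) n) :
    PreCochain C D F F 1 := fun _ _ c =>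
  match c with
  | .nil => 0
  | .cons f .nil => D.castTo _ (φ f)
  | .cons _ (.cons _ _) => 0

/-- The differential of Hochschild cochains with coefficients twisted by `φ` on the left and by `ψ`
on the right:
`(δΨ)(f_N, …, f_1) = d(Ψ(f_N, …, f_1))`
`+ ∑ i, (-1)^(|Ψ| + ∑ j > i, (|f_j| - 1)) Ψ(f_N, …, d f_i, …, f_1)`
`+ (-1)^(|Ψ| |f_N| + |Ψ|) φ(f_N) ∘ Ψ(f_{N-1}, …, f_1)`
`+ ∑ i, (-1)^(|Ψ| + ∑ j ≥ i + 1, (|f_j| - 1)) Ψ(f_N, …, f_{i+1} f_i, …, f_1)`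
`+ (-1)^(|Ψ| + 1 + ∑ j ≥ 2, (|f_j| - 1)) Ψ(f_N, …, f_2) ∘ ψ(f_1)`,
where `m = p + 1`. -/
def diff (φ : ∀ {x y : C.Obj} {n : ℤ}, C.Hom x y n → D.Hom (G x) (G y) n)
    (ψ : ∀ {x y : C.Obj} {n : ℤ}, C.Hom x y n → D.Hom (F x) (F y) n)
    (m : ℤ) (Ψ : PreCochain C D F G p) : PreCochain C D F G m :=
  bdry m Ψ + conv m (tau G φ) Ψ - sgn k p • conv m Ψ (tau F ψ)

/-- Multilinear cochains that vanish as soon as one argument is an identity. -/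
structure IsReduced (Ψ : PreCochain C D F G p) : Prop where
  linear : ∀ {x y z w : C.Obj} {n : ℤ} (l : Chain C z w) (a b : k) (f g : C.Hom y z n)
    (r : Chain C x y),
    Ψ x w (l.append (.cons (a • f + b • g) r)) =
      a • D.castTo _ (Ψ x w (l.append (.cons f r))) + b • D.castTo _ (Ψ x w (l.append (.cons g r)))
  normalized : ∀ {x y w : C.Obj} (l : Chain C y w) (r : Chain C x y),
    Ψ x w (l.append (.cons (C.id y) r)) = 0

end PreCochain
end Cochains

/-! ### Sums over cuts and over the bar differential -/

namespace Chain

variable {C D : DGCat k} {M : Type u} [AddCommGroup M] [Module k M]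

theorem append_nil {x z : C.Obj} (c : Chain C x z) : c.append nil = c := by
  induction c with
  | nil => rfl
  | cons f c ih => simp [ih]

theorem append_assoc {w x y z : C.Obj} (a : Chain C y z) (b : Chain C x y) (c : Chain C w x) :
    (a.append b).append c = a.append (b.append c) := by
  induction a with
  | nil => rfl
  | cons f a ih => simp [ih]

/-- Sum over all cuts. -/
def sumCuts {x z : C.Obj} (c : Chain C x z) (φ : Cut C x z → M) : M := (c.cuts.map φ).sum

/-- Sum over the terms of the bar differential. -/
def sumBar {x z : C.Obj} (c : Chain C x z) (φ : Chain C x z → M) : M :=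
  (c.bar.map fun t => sgn k t.1 • φ t.2).sum

/-- The contribution of `mulHead`. -/
def sumHead {x y z : C.Obj} {n : ℤ} (f : C.Hom y z n) (c : Chain C x y) (φ : Chain C x z → M) : M :=
  ((mulHead f c).map fun t => sgn k t.1 • φ t.2).sum

theorem sumCuts_nil {x : C.Obj} (φ : Cut C x x → M) :
    (nil : Chain C x x).sumCuts φ = φ ⟨x, nil, nil⟩ := by simp [sumCuts, cuts]

theorem sumCuts_cons {x y z : C.Obj} {n : ℤ} (f : C.Hom y z n) (c : Chain C x y)
    (φ : Cut C x z → M) : (cons f c).sumCuts φ =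
      φ ⟨z, nil, cons f c⟩ + c.sumCuts fun s => φ ⟨s.mid, cons f s.left, s.right⟩ := by
  simp [sumCuts, cuts, Function.comp_def]

theorem sumHead_nil {x z : C.Obj} {n : ℤ} (f : C.Hom x z n) (φ : Chain C x z → M) :
    sumHead f nil φ = 0 := by simp [sumHead, mulHead]

theorem sumHead_cons {w x y z : C.Obj} {n m : ℤ} (f : C.Hom y z n) (g : C.Hom x y m)
    (c : Chain C w x) (φ : Chain C w z → M) :
    sumHead f (cons g c) φ = sgn k n • φ (cons (C.comp rfl f g) c) := by simp [sumHead, mulHead]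

theorem sumBar_nil {x : C.Obj} (φ : Chain C x x → M) : (nil : Chain C x x).sumBar φ = 0 := by
  simp [sumBar, bar]

theorem sumBar_cons {x y z : C.Obj} {n : ℤ} (f : C.Hom y z n) (c : Chain C x y)
    (φ : Chain C x z → M) : (cons f c).sumBar φ = -φ (cons (C.d rfl f) c) +
      sgn k (n - 1) • c.sumBar (fun c' => φ (cons f c')) + sumHead f c φ := by
  simp only [sumBar, bar, sumHead, List.map_append, List.map_cons, List.sum_append, List.sum_cons,
    List.map_map, Function.comp_def, sgn_one, neg_smul, one_smul, List.smul_sum, smul_smul,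
    ← sgn_add]

theorem sumCuts_congr {x z : C.Obj} (c : Chain C x z) {φ ψ : Cut C x z → M}
    (h : ∀ s, s.left.append s.right = c → φ s = ψ s) : c.sumCuts φ = c.sumCuts ψ := by
  induction c with
  | nil => rw [sumCuts_nil, sumCuts_nil, h _ rfl]
  | cons f c ih =>
    rw [sumCuts_cons, sumCuts_cons, h _ rfl]
    congr 1
    exact ih fun s hs => h _ (by simp [hs])

theorem sumCuts_add {x z : C.Obj} (c : Chain C x z) (φ ψ : Cut C x z → M) :
    c.sumCuts (fun s => φ s + ψ s) = c.sumCuts φ + c.sumCuts ψ := by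
  simp [sumCuts, List.sum_map_add]

theorem map_sumCuts {N : Type u} [AddCommGroup N] [Module k N] (L : M →ₗ[k] N) {x z : C.Obj}
    (c : Chain C x z) (φ : Cut C x z → M) : L (c.sumCuts φ) = c.sumCuts fun s => L (φ s) := by
  simp [sumCuts, map_list_sum, Function.comp_def]

theorem smul_sumCuts (a : k) {x z : C.Obj} (c : Chain C x z) (φ : Cut C x z → M) :
    a • c.sumCuts φ = c.sumCuts fun s => a • φ s := by
  simp [sumCuts, List.smul_sum, Function.comp_def]

theorem sumCuts_zero {x z : C.Obj} (c : Chain C x z) {φ : Cut C x z → M}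
    (h : ∀ s, s.left.append s.right = c → φ s = 0) : c.sumCuts φ = 0 := by
  rw [sumCuts_congr c (ψ := fun _ => 0) h]; simp [sumCuts]

theorem sumBar_congr {x z : C.Obj} (c : Chain C x z) {φ ψ : Chain C x z → M}
    (h : ∀ c', c'.deg = c.deg + 1 → φ c' = ψ c') : c.sumBar φ = c.sumBar ψ := by
  induction c with
  | nil => rw [sumBar_nil, sumBar_nil]
  | @cons y z n f c ih =>
    rw [sumBar_cons, sumBar_cons, h _ (by simp; ring),
      ih (φ := fun c' => φ (cons f c')) (ψ := fun c' => ψ (cons f c'))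
        fun c' hc => h _ (by simp [hc]; ring)]
    congr 1
    cases c with
    | nil => rw [sumHead_nil, sumHead_nil]
    | cons g c => rw [sumHead_cons, sumHead_cons, h _ (by simp; ring)]

theorem sumBar_add {x z : C.Obj} (c : Chain C x z) (φ ψ : Chain C x z → M) :
    c.sumBar (fun s => φ s + ψ s) = c.sumBar φ + c.sumBar ψ := by
  simp [sumBar, List.sum_map_add]

theorem map_sumBar {N : Type u} [AddCommGroup N] [Module k N] (L : M →ₗ[k] N) {x z : C.Obj}
    (c : Chain C x z) (φ : Chain C x z → M) : L (c.sumBar φ) = c.sumBar fun s => L (φ s) := by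
  simp [sumBar, map_list_sum, Function.comp_def]

theorem smul_sumBar (a : k) {x z : C.Obj} (c : Chain C x z) (φ : Chain C x z → M) :
    a • c.sumBar φ = c.sumBar fun s => a • φ s := by
  simp [sumBar, List.smul_sum, Function.comp_def, smul_smul, mul_comm]

theorem sumBar_zero {x z : C.Obj} (c : Chain C x z) {φ : Chain C x z → M}
    (h : ∀ c', c'.deg = c.deg + 1 → φ c' = 0) : c.sumBar φ = 0 := by
  rw [sumBar_congr c (ψ := fun _ => 0) h]; simp [sumBar]

/-- Coassociativity of deconcatenation. -/
theorem sumCuts_sumCuts {x z : C.Obj} (c : Chain C x z)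
    (φ : ∀ y w : C.Obj, Chain C w z → Chain C y w → Chain C x y → M) :
    (c.sumCuts fun s => s.left.sumCuts fun t => φ s.mid t.mid t.left t.right s.right) =
      c.sumCuts fun s => s.right.sumCuts fun t => φ t.mid s.mid s.left t.left t.right := by
  induction c with
  | nil => simp [sumCuts_nil]
  | cons f c ih =>
    simp only [sumCuts_cons, sumCuts_nil, sumCuts_add]
    rw [ih fun y w a b e => φ y w (cons f a) b e, ← add_assoc]

/-- Compatibility of the bar differential with deconcatenation. -/
theorem sumBar_sumCuts {x z : C.Obj} (c : Chain C x z)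
    (φ : ∀ y : C.Obj, Chain C y z → Chain C x y → M) :
    (c.sumBar fun c' => c'.sumCuts fun s => φ s.mid s.left s.right) =
      c.sumCuts fun s => (s.left.sumBar fun l => φ s.mid l s.right) +
        sgn k s.left.deg • s.right.sumBar fun r => φ s.mid s.left r := by
  induction c with
  | nil => simp [sumCuts_nil, sumBar_nil]
  | @cons y z n f c ih =>
    have key : sumHead f c (fun c' => c'.sumCuts fun s => φ s.mid s.left s.right) =
        sumHead f c (fun c' => φ z nil c') +
          c.sumCuts fun s => sumHead f s.left fun l => φ s.mid l s.right := by
      cases c with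
      | nil => simp [sumHead_nil, sumCuts_nil]
      | cons g c =>
        simp only [sumHead_cons, sumCuts_cons, sumHead_nil, zero_add, smul_add]
        simp only [sumCuts, List.smul_sum, List.map_map, Function.comp_def]
    simp only [sumCuts_cons, sumBar_cons, sumBar_nil, sumBar_add, deg_nil, sgn_zero, one_smul,
      zero_add, sumCuts_add, smul_add, deg_cons, key]
    rw [ih fun y l r => φ y (cons f l) r]
    simp only [sumCuts_add, sgn_add k (n - 1), mul_smul, smul_add, smul_sumCuts]
    have hneg : (c.sumCuts fun s => -φ s.mid (cons (C.d rfl f) s.left) s.right) =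
        -c.sumCuts fun s => φ s.mid (cons (C.d rfl f) s.left) s.right := by
      simpa using (smul_sumCuts (-1 : k) c
        fun s => φ s.mid (cons (C.d rfl f) s.left) s.right).symm
    rw [hneg]
    abel

theorem cons_castTo {x y z : C.Obj} {n m : ℤ} (h : n = m) (f : C.Hom y z n) (c : Chain C x y)
    (φ : Chain C x z → M) : φ (cons (C.castTo m f) c) = φ (cons f c) := by
  subst h; simp

/-- Functionals on chains that are linear in each argument. -/
structure IsLin {x z : C.Obj} (φ : Chain C x z → M) : Prop where
  lin : ∀ {y w : C.Obj} {n : ℤ} (l : Chain C w z) (a b : k) (f g : C.Hom y w n) (r : Chain C x y),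
    φ (l.append (cons (a • f + b • g) r)) =
      a • φ (l.append (cons f r)) + b • φ (l.append (cons g r))

theorem IsLin.tail {x y z : C.Obj} {φ : Chain C x z → M} (h : IsLin φ) {n : ℤ}
    (f : C.Hom y z n) : IsLin fun c => φ (cons f c) :=
  ⟨fun l a b f' g' r => h.lin (cons f l) a b f' g' r⟩

theorem IsLin.head {x y z : C.Obj} {φ : Chain C x z → M} (h : IsLin φ) {n : ℤ} (a b : k)
    (f g : C.Hom y z n) (c : Chain C x y) :
    φ (cons (a • f + b • g) c) = a • φ (cons f c) + b • φ (cons g c) := h.lin nil a b f g c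

theorem IsLin.head_zero {x y z : C.Obj} {φ : Chain C x z → M} (h : IsLin φ) {n : ℤ}
    (c : Chain C x y) : φ (cons (0 : C.Hom y z n) c) = 0 := by
  simpa using h.head 0 0 (0 : C.Hom y z n) 0 c

theorem sumBar_sumBar {x z : C.Obj} (c : Chain C x z) (φ : Chain C x z → M) (hφ : IsLin φ) :
    (c.sumBar fun c' => c'.sumBar φ) = 0 := by
  induction c with
  | nil => simp [sumBar_nil]
  | @cons y z n f c ih =>
    have hs : sgn k n = -sgn k (n - 1) := sgn_eq_neg k (by simp)
    have hss : sgn k (n - 1) * sgn k (n - 1) = 1 := by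
      rw [← sgn_add, sgn_eq k (n := 0) (by simp), sgn_zero]
    have key : -sumHead (C.d (rfl : n + 1 = n + 1) f) c φ +
        sgn k (n - 1) • (c.sumBar fun c' => sumHead f c' φ) +
        sumHead f c (fun c' => c'.sumBar φ) = 0 := by
      cases c with
      | nil => simp [sumHead_nil, sumBar_nil]
      | @cons x' _ m g c =>
        have key2 : sgn k (n - 1) • (sumHead g c fun c' => sumHead f c' φ) +
            sgn k n • sumHead (C.comp (rfl : n + m = n + m) f g) c φ = 0 := by
          cases c with
          | nil => simp [sumHead_nil]
          | @cons w' _ l e c =>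
            have ha : φ (cons (C.comp (rfl : (n + m) + l = _) (C.comp rfl f g) e) c) =
                φ (cons (C.comp (rfl : n + (m + l) = _) f (C.comp rfl g e)) c) := by
              rw [← cons_castTo (add_assoc n m l) _ _ φ]
              congr 2
              rw [← C.compTo_eq, C.castTo_compTo _ rfl, ← C.compTo_eq, ← C.compTo_eq,
                ← C.compTo_eq, C.compTo_assoc _ rfl rfl]
            simp only [sumHead_cons, ha, smul_smul, ← add_smul]
            rw [sgn_add k n m, hs]
            convert zero_smul k _ using 2
            ring
        have hd : φ (cons (C.d (rfl : n + m + 1 = _) (C.comp rfl f g)) c) =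
            φ (cons (C.comp (rfl : (n + 1) + m = _) (C.d rfl f) g) c) +
              sgn k n • φ (cons (C.comp (rfl : n + (m + 1) = _) f (C.d rfl g)) c) := by
          rw [← cons_castTo (show n + 1 + m = n + m + 1 by ring) _ _ φ,
            ← cons_castTo (show n + (m + 1) = n + m + 1 by ring) _ _ φ]
          have := hφ.head 1 (sgn k n)
            (C.castTo (n + m + 1) (C.comp (rfl : (n + 1) + m = _) (C.d rfl f) g))
            (C.castTo (n + m + 1) (C.comp (rfl : n + (m + 1) = _) f (C.d rfl g))) c
          rw [one_smul, one_smul] at this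
          rw [← this]
          congr 2
          simp only [← C.compTo_eq, ← C.dTo_eq, C.castTo_compTo _ rfl]
          exact C.dTo_compTo _ rfl rfl rfl f g
        simp only [sumHead_cons, sumBar_cons, smul_add, hd, smul_neg]
        have h1 : (sgn k (n - 1) • sgn k (m - 1) • c.sumBar fun c' =>
            sgn k n • φ (cons (C.comp (rfl : n + m = _) f g) c')) =
            -(sgn k (m - 1) • c.sumBar fun c' => φ (cons (C.comp (rfl : n + m = _) f g) c')) := by
          rw [← smul_sumBar, smul_smul, smul_smul, ← neg_smul, hs]
          congr 1
          linear_combination -sgn k (m - 1) * hss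
        have h2 : (sgn k n • sgn k (n + m - 1) • c.sumBar fun c' =>
            φ (cons (C.comp (rfl : n + m = _) f g) c')) =
            (sgn k (m - 1) • c.sumBar fun c' => φ (cons (C.comp (rfl : n + m = _) f g) c')) := by
          rw [smul_smul, ← sgn_add, sgn_eq k (n := m - 1) (by
            rw [show n + (n + m - 1) - (m - 1) = 2 * n by ring]; simp)]
        have h3 : sgn k (n + 1) = -sgn k n := by rw [sgn_add, sgn_one]; ring
        rw [h1, h2, h3]
        simp only [smul_smul]
        rw [show sgn k (n - 1) * sgn k n = -1 by rw [hs]; linear_combination -hss,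
          show sgn k n * sgn k n = 1 by rw [hs]; linear_combination hss]
        linear_combination (norm := module) key2
    simp only [sumBar_cons, sumBar_add, C.d_d, hφ.head_zero, neg_zero, zero_add]
    have hneg : (c.sumBar fun s => -φ (cons (C.d (rfl : n + 1 = _) f) s)) =
        -c.sumBar fun s => φ (cons (C.d (rfl : n + 1 = _) f) s) := by
      simpa using (smul_sumBar (-1 : k) c fun s => φ (cons (C.d (rfl : n + 1 = _) f) s)).symm
    rw [← smul_sumBar, ih (fun c' => φ (cons f c')) (hφ.tail f), hneg, show n + 1 - 1 = n by ring, hs]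
    refine Eq.trans ?_ key
    simp only [smul_add, smul_zero, neg_add, neg_smul, smul_neg, neg_neg]
    abel

end Chain

/-! ### The dg category of coherent natural transformations -/

namespace Chain

variable {C D : DGCat k} {M : Type u} [AddCommGroup M] [Module k M]

theorem sumCuts_isLin {x z : C.Obj} (φ : ∀ y : C.Obj, Chain C y z → Chain C x y → M)
    (hl : ∀ y r, IsLin fun l => φ y l r) (hr : ∀ y l, IsLin fun r => φ y l r) :
    IsLin fun c : Chain C x z => c.sumCuts fun s => φ s.mid s.left s.right := by
  refine ⟨fun {y w n} l a b f g r => ?_⟩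
  induction l with
  | nil =>
    have h1 : (r.sumCuts fun s => φ s.mid (cons (a • f + b • g) s.left) s.right) =
        a • (r.sumCuts fun s => φ s.mid (cons f s.left) s.right) +
          b • r.sumCuts fun s => φ s.mid (cons g s.left) s.right := by
      rw [smul_sumCuts, smul_sumCuts, ← sumCuts_add]
      exact sumCuts_congr _ fun s _ => (hl s.mid s.right).head a b f g s.left
    simp only [nil_append, sumCuts_cons, (hr _ _).head a b f g r, h1]
    module
  | cons e l ih =>
    simp only [cons_append, sumCuts_cons]
    have h1 := (hr _ nil).lin (cons e l) a b f g r
    simp only [cons_append] at h1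
    rw [h1, ih (fun y l r => φ y (cons e l) r) (fun y r => (hl y r).tail e)
      (fun y l => hr y (cons e l))]
    module

theorem sumCuts_id {x z : C.Obj} (φ : ∀ y : C.Obj, Chain C y z → Chain C x y → M)
    (hl : ∀ y v l r r', φ y (append l (cons (C.id v) r)) r' = 0)
    (hr : ∀ y v l l' r, φ y l (append l' (cons (C.id v) r)) = 0)
    {y : C.Obj} (l : Chain C y z) (r : Chain C x y) :
    ((l.append (cons (C.id y) r)).sumCuts fun s => φ s.mid s.left s.right) = 0 := by
  induction l with
  | nil =>
    have h := hr _ _ nil nil r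
    simp only [nil_append] at h
    simp only [nil_append, sumCuts_cons, h, zero_add]
    exact sumCuts_zero _ fun s _ => hl s.mid _ nil s.left s.right
  | cons e l ih =>
    have h := hr _ _ nil (cons e l) r
    simp only [cons_append] at h
    simp only [cons_append, sumCuts_cons, h, zero_add]
    exact ih (fun y l r => φ y (cons e l) r) (fun y v l r r' => hl y v (cons e l) r r')
      (fun y v l l' r => hr y v (cons e l) l' r)

theorem sumBar_isLin {x z : C.Obj} (φ : Chain C x z → M) (hφ : IsLin φ) :
    IsLin fun c : Chain C x z => c.sumBar φ := by
  refine ⟨fun {y w n} l a b f g r => ?_⟩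
  induction l with
  | nil =>
    have hh : sumHead (a • f + b • g) r φ = a • sumHead f r φ + b • sumHead g r φ := by
      cases r with
      | nil => simp [sumHead_nil]
      | cons e r =>
        simp only [sumHead_cons, map_add, map_smul, LinearMap.add_apply, LinearMap.smul_apply,
          hφ.head, smul_add, smul_comm (sgn k n)]
    have hs : (r.sumBar fun c' => φ (cons (a • f + b • g) c')) =
        a • (r.sumBar fun c' => φ (cons f c')) + b • r.sumBar fun c' => φ (cons g c') := by
      simp only [hφ.head, sumBar_add, smul_sumBar]
    simp only [nil_append, sumBar_cons, hs, hh, map_add, map_smul, hφ.head (n := n + 1)]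
    module
  | @cons v z m e l ih =>
    have h1 := hφ.lin (cons (C.d rfl e) l) a b f g r
    simp only [cons_append] at h1
    have h2 := ih (fun c' => φ (cons e c')) (hφ.tail e)
    have hh : sumHead e (l.append (cons (a • f + b • g) r)) φ =
        a • sumHead e (l.append (cons f r)) φ + b • sumHead e (l.append (cons g r)) φ := by
      cases l with
      | nil =>
        simp only [nil_append, sumHead_cons, map_add, map_smul, hφ.head]
        module
      | cons e' l =>
        have h3 := hφ.lin (cons (C.comp rfl e e') l) a b f g r
        simp only [cons_append] at h3
        simp only [cons_append, sumHead_cons, h3]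
        module
    simp only [cons_append, sumBar_cons, h1, h2, hh]
    module

/-- The value `φ r` if `l` is empty. -/
def headVal {x w : C.Obj} (φ : Chain C x w → M) : {y : C.Obj} → Chain C y w → Chain C x y → M
  | _, nil, r => φ r
  | _, cons _ _, _ => 0

/-- The value `(-1)^(deg l) φ l` if `r` is empty. -/
def tailVal {x w : C.Obj} (φ : Chain C x w → M) : {y : C.Obj} → Chain C y w → Chain C x y → M
  | _, l, nil => sgn k l.deg • φ l
  | _, _, cons _ _ => 0

theorem sumBar_id {x z : C.Obj} (φ : Chain C x z → M)
    (hφ : IsLin φ)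
    (h : ∀ y (l : Chain C y z) (r : Chain C x y), φ (l.append (cons (C.id y) r)) = 0)
    {y : C.Obj} (l : Chain C y z) (r : Chain C x y) :
    (l.append (cons (C.id y) r)).sumBar φ = headVal φ l r - tailVal φ l r := by
  induction l with
  | nil =>
    have h1 : φ (cons (C.d (rfl : (0 : ℤ) + 1 = 0 + 1) (C.id _)) r) = 0 := by
      rw [← C.dTo_eq, C.dTo_id]; exact hφ.head_zero r
    have h2 : (r.sumBar fun c' => φ (cons (C.id _) c')) = 0 :=
      sumBar_zero _ fun c' _ => h _ nil c'
    simp only [nil_append, sumBar_cons, h1, h2, headVal]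
    cases r with
    | nil => simp [sumHead_nil, tailVal, sgn_zero]
    | @cons _ _ m g r =>
      have : φ (cons (C.comp (rfl : 0 + m = 0 + m) (C.id _) g) r) = φ (cons g r) := by
        rw [← cons_castTo (zero_add m) _ _ φ, ← C.compTo_eq, C.castTo_compTo _ rfl, C.id_compTo,
          C.castTo_self]
      simp [sumHead_cons, tailVal, sgn_zero, this]
  | @cons v z n f l ih =>
    have h1 : φ (cons (C.d (rfl : n + 1 = n + 1) f) (l.append (cons (C.id y) r))) = 0 :=
      h _ (cons (C.d rfl f) l) r
    have h2 := ih (fun c' => φ (cons f c')) (hφ.tail f) (fun y l r => h y (cons f l) r)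
    simp only [cons_append, sumBar_cons, h1, h2, headVal]
    have h3 : sgn k (n - 1) • tailVal (fun c' => φ (cons f c')) l r = tailVal φ (cons f l) r := by
      cases r with
      | nil => simp [tailVal, sgn_add, smul_smul]
      | cons g r => simp [tailVal]
    rw [smul_sub, h3]
    cases l with
    | nil =>
      have : φ (cons (C.comp (rfl : n + 0 = n + 0) f (C.id _)) r) = φ (cons f r) := by
        rw [← cons_castTo (add_zero n) _ _ φ, ← C.compTo_eq, C.castTo_compTo _ rfl, C.compTo_id,
          C.castTo_self]
      simp only [nil_append, sumHead_cons, this]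
      rw [sgn_eq_neg k (m := n) (n := n - 1) (by simp)]
      module
    | cons g l =>
      have := h _ (cons (C.comp rfl f g) l) r
      simp only [cons_append] at this
      simp [sumHead_cons, this]

end Chain

namespace PreCochain

variable {C D : DGCat k} {F G H K : C.Obj → D.Obj} {p q r n m : ℤ}

theorem conv_apply (n : ℤ) (A : PreCochain C D G H p) (B : PreCochain C D F G q) {x z : C.Obj}
    (c : Chain C x z) : conv n A B x z c = c.sumCuts fun s => sgn k (q * s.left.deg) •
      D.compTo (n + c.deg) (A s.mid z s.left) (B x s.mid s.right) := rfl

theorem bdry_apply (m : ℤ) (A : PreCochain C D F G p) {x z : C.Obj} (c : Chain C x z) :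
    bdry m A x z c = D.dTo (m + c.deg) (A x z c) -
      sgn k p • c.sumBar fun t => D.castTo (m + c.deg) (A x z t) := rfl

theorem conv_add_left (n : ℤ) (A A' : PreCochain C D G H p) (B : PreCochain C D F G q) :
    conv n (A + A') B = conv n A B + conv n A' B := by
  funext x z c
  simp only [conv_apply, Pi.add_apply, map_add, LinearMap.add_apply, smul_add, Chain.sumCuts_add]

theorem conv_add_right (n : ℤ) (A : PreCochain C D G H p) (B B' : PreCochain C D F G q) :
    conv n A (B + B') = conv n A B + conv n A B' := by
  funext x z c
  simp only [conv_apply, Pi.add_apply, map_add, smul_add, Chain.sumCuts_add]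

theorem conv_smul_left (n : ℤ) (a : k) (A : PreCochain C D G H p) (B : PreCochain C D F G q) :
    conv n (a • A) B = a • conv n A B := by
  funext x z c
  simp only [conv_apply, Pi.smul_apply, map_smul, LinearMap.smul_apply, smul_comm _ a,
    ← Chain.smul_sumCuts]

theorem conv_smul_right (n : ℤ) (a : k) (A : PreCochain C D G H p) (B : PreCochain C D F G q) :
    conv n A (a • B) = a • conv n A B := by
  funext x z c
  simp only [conv_apply, Pi.smul_apply, map_smul, smul_comm _ a, ← Chain.smul_sumCuts]

/-- `conv` as a bilinear map. -/
def convL (n : ℤ) : PreCochain C D G H p →ₗ[k] PreCochain C D F G q →ₗ[k] PreCochain C D F H n :=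
  LinearMap.mk₂ k (conv n) (conv_add_left n) (conv_smul_left n) (conv_add_right n)
    (conv_smul_right n)

theorem convL_apply (n : ℤ) (A : PreCochain C D G H p) (B : PreCochain C D F G q) :
    convL n A B = conv n A B := rfl

/-- `bdry` as a linear map. -/
def bdryL (m : ℤ) : PreCochain C D F G p →ₗ[k] PreCochain C D F G m where
  toFun := bdry m
  map_add' A B := by
    funext x z c
    simp only [bdry_apply, Pi.add_apply, map_add, Chain.sumBar_add, smul_add]
    abel
  map_smul' a A := by
    funext x z c
    simp only [bdry_apply, Pi.smul_apply, map_smul, RingHom.id_apply, ← Chain.smul_sumBar]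
    module

theorem bdryL_apply (m : ℤ) (A : PreCochain C D F G p) : bdryL m A = bdry m A := rfl

theorem conv_assoc {s t : ℤ} (n : ℤ) (hs : p + q = s) (ht : q + r = t)
    (A : PreCochain C D H K p) (B : PreCochain C D G H q) (E : PreCochain C D F G r) :
    conv n (conv s A B) E = conv n A (conv t B E) := by
  funext x z c
  have hc := Chain.sumCuts_sumCuts c fun y w a b e => sgn k (r * (a.deg + b.deg) + q * a.deg) •
    D.compTo (n + c.deg) (A _ _ a) (D.compTo (t + (b.deg + e.deg)) (B _ _ b) (E _ _ e))
  simp only [conv_apply]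
  refine Eq.trans (Chain.sumCuts_congr _ fun s' _ => ?_)
    (hc.trans (Chain.sumCuts_congr _ fun s' _ => ?_))
  · rw [← LinearMap.flip_apply, Chain.map_sumCuts, Chain.smul_sumCuts]
    refine Chain.sumCuts_congr _ fun t' ht' => ?_
    rw [map_smul, LinearMap.flip_apply, ← ht', Chain.deg_append, smul_smul, ← sgn_add,
      D.compTo_assoc (t := t + (t'.right.deg + s'.right.deg)) _ (by omega) (by omega)]
  · rw [Chain.map_sumCuts, Chain.smul_sumCuts]
    refine Chain.sumCuts_congr _ fun t' ht' => ?_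
    rw [map_smul, ← ht', Chain.deg_append, smul_smul, ← sgn_add, ← ht]
    congr 2
    ring

theorem bdry_conv {p' q' : ℤ} (m : ℤ) (h : p + q = n) (hp : p + 1 = p') (hq : q + 1 = q')
    (A : PreCochain C D G H p) (B : PreCochain C D F G q) :
    bdry m (conv n A B) = conv m (bdry p' A) B + sgn k p • conv m A (bdry q' B) := by
  funext x z c
  simp only [bdry_apply, conv_apply, Pi.add_apply, Pi.smul_apply]
  have hc := Chain.sumBar_sumCuts c fun y a b => sgn k (q * a.deg) •
    D.compTo (m + c.deg) (A _ _ a) (B _ _ b)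
  have e1 : (c.sumBar fun t => D.castTo (m + c.deg) (t.sumCuts fun s => sgn k (q * s.left.deg) •
      D.compTo (n + t.deg) (A s.mid z s.left) (B x s.mid s.right))) =
      c.sumBar fun c' => c'.sumCuts fun s => sgn k (q * s.left.deg) •
        D.compTo (m + c.deg) (A s.mid z s.left) (B x s.mid s.right) := by
    refine Chain.sumBar_congr _ fun t _ => ?_
    rw [Chain.map_sumCuts]
    refine Chain.sumCuts_congr _ fun s hs => ?_
    rw [map_smul, D.castTo_compTo _ (by rw [← hs, Chain.deg_append]; omega)]
  rw [e1, hc, Chain.map_sumCuts, Chain.smul_sumCuts, Chain.smul_sumCuts, ← Chain.sumCuts_add,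
    sub_eq_add_neg, ← neg_one_smul k, Chain.smul_sumCuts, ← Chain.sumCuts_add]
  refine Chain.sumCuts_congr _ fun s hs => ?_
  have hd : c.deg = s.left.deg + s.right.deg := by rw [← hs, Chain.deg_append]
  rw [map_smul, D.dTo_compTo (p' := p' + s.left.deg) (q' := q' + s.right.deg) _ (by omega)
    (by omega) (by omega), map_sub, map_smul, LinearMap.sub_apply, LinearMap.smul_apply,
    ← LinearMap.flip_apply (D.compTo (m + c.deg)) (Chain.sumBar _ _) (B x s.mid s.right),
    Chain.map_sumBar, map_sub, map_smul, Chain.map_sumBar]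
  have e2 : (s.left.sumBar fun l => sgn k (q * l.deg) •
      D.compTo (m + c.deg) (A s.mid z l) (B x s.mid s.right)) =
      sgn k (q * s.left.deg + q) • s.left.sumBar fun l => (D.compTo (m + c.deg)).flip
        (B x s.mid s.right) (D.castTo (p' + s.left.deg) (A s.mid z l)) := by
    rw [Chain.smul_sumBar]
    refine Chain.sumBar_congr _ fun l hl => ?_
    rw [LinearMap.flip_apply, D.compTo_castTo_left _ (by omega),
      show q * l.deg = q * s.left.deg + q by rw [hl]; ring]
  have e3 : (s.right.sumBar fun r => sgn k (q * s.left.deg) •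
      D.compTo (m + c.deg) (A s.mid z s.left) (B x s.mid r)) =
      sgn k (q * s.left.deg) • s.right.sumBar fun r => D.compTo (m + c.deg) (A s.mid z s.left)
        (D.castTo (q' + s.right.deg) (B x s.mid r)) := by
    rw [Chain.smul_sumBar]
    refine Chain.sumBar_congr _ fun l hl => ?_
    rw [D.compTo_castTo_right _ (by omega)]
  rw [e2, e3, ← h, ← hq]
  have hqq : sgn k q * sgn k q = 1 := by
    rw [← sgn_add, sgn_eq k (n := 0) (by simp), sgn_zero]
  simp only [smul_add, smul_sub, smul_smul, sgn_add, add_mul, one_mul]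
  have : sgn k p * sgn k q * (sgn k (q * s.left.deg) * sgn k q) =
      sgn k (q * s.left.deg) * sgn k p := by
    linear_combination sgn k p * sgn k (q * s.left.deg) * hqq
  match_scalars <;> first | linear_combination this | linear_combination -this | ring

theorem IsReduced.isLin {A : PreCochain C D F G p} (hA : A.IsReduced) (x z : C.Obj) (N : ℤ) :
    Chain.IsLin fun c : Chain C x z => D.castTo N (A x z c) := by
  refine ⟨fun {y w n} l a b f g r => ?_⟩
  simp only [hA.linear, map_add, map_smul]
  rw [D.castTo_castTo _ (by simp), D.castTo_castTo _ (by simp)]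

theorem isReduced_of {A : PreCochain C D F G p}
    (h : ∀ (x z : C.Obj) (N : ℤ), Chain.IsLin fun c : Chain C x z => D.castTo N (A x z c))
    (h' : ∀ {x y w : C.Obj} (l : Chain C y w) (r : Chain C x y),
      A x w (l.append (.cons (C.id y) r)) = 0) : A.IsReduced where
  linear {x y z w n} l a b f g r := by
    simpa only [D.castTo_self] using
      (h x w (p + (l.append (.cons (a • f + b • g) r)).deg)).lin l a b f g r
  normalized := h'

theorem bdry_bdry {A : PreCochain C D F G p} (hA : A.IsReduced) (n : ℤ) (hm : p + 1 = m) :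
    bdry n (bdry m A) = 0 := by
  funext x z c
  simp only [bdry_apply, map_sub, map_smul, D.dTo_dTo, Chain.map_sumBar, Pi.zero_apply]
  have e1 : (c.sumBar fun t => D.castTo (n + c.deg) (D.dTo (m + t.deg) (A x z t)) -
      sgn k p • t.sumBar fun s => D.castTo (n + c.deg) (D.castTo (m + t.deg) (A x z s))) =
      c.sumBar fun t => D.dTo (n + c.deg) (D.castTo (m + c.deg) (A x z t)) := by
    have e2 : (c.sumBar fun t => D.castTo (n + c.deg) (D.dTo (m + t.deg) (A x z t)) -
      sgn k p • t.sumBar fun s => D.castTo (n + c.deg) (D.castTo (m + t.deg) (A x z s))) =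
      c.sumBar fun t => D.dTo (n + c.deg) (D.castTo (m + c.deg) (A x z t)) +
        (-sgn k p) • t.sumBar fun s => D.castTo (n + c.deg) (A x z s) := by
      refine Chain.sumBar_congr _ fun t ht => ?_
      rw [D.castTo_dTo _ (by omega), D.dTo_castTo _ (by omega), neg_smul, ← sub_eq_add_neg]
      congr 2
      exact Chain.sumBar_congr _ fun s hs => by rw [D.castTo_castTo _ (by omega)]
    rw [e2, Chain.sumBar_add, ← Chain.smul_sumBar, Chain.sumBar_sumBar _ _ (hA.isLin x z _)]
    simp
  rw [e1, ← hm, sgn_add, sgn_one]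
  module

theorem conv_isLin (h : p + q = n) {A : PreCochain C D G H p} {B : PreCochain C D F G q}
    (hA : ∀ (x z : C.Obj) (N : ℤ), Chain.IsLin fun c : Chain C x z => D.castTo N (A x z c))
    (hB : ∀ (x z : C.Obj) (N : ℤ), Chain.IsLin fun c : Chain C x z => D.castTo N (B x z c))
    (x z : C.Obj) (N : ℤ) :
    Chain.IsLin fun c : Chain C x z => D.castTo N (conv n A B x z c) := by
  have e : (fun c : Chain C x z => D.castTo N (conv n A B x z c)) = fun c =>
      c.sumCuts fun s => sgn k (q * s.left.deg) •
        D.compTo N (A s.mid z s.left) (B x s.mid s.right) := by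
    funext c
    rw [conv_apply, Chain.map_sumCuts]
    refine Chain.sumCuts_congr _ fun s hs => ?_
    rw [map_smul, D.castTo_compTo _ (by rw [← hs, Chain.deg_append]; omega)]
  rw [e]
  refine Chain.sumCuts_isLin (x := x) (z := z)
    (fun y l r => sgn k (q * l.deg) • D.compTo N (A _ _ l) (B _ _ r)) (fun y r => ?_) fun y l => ?_
  · refine ⟨fun {y' w n} l a b f g r' => ?_⟩
    have h1 := (hA y z (p + (l.append (.cons f r')).deg)).lin l a b f g r'
    have h2 : ∀ u : C.Hom y' w n, D.compTo N (A y z (l.append (.cons u r'))) (B _ _ r) =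
        D.compTo N (D.castTo (p + (l.append (.cons f r')).deg) (A y z (l.append (.cons u r'))))
          (B _ _ r) := fun u => by rw [D.compTo_castTo_left _ (by simp)]
    rw [h2, h1, h2 g]
    simp only [Chain.deg_append, Chain.deg_cons, map_add, map_smul, LinearMap.add_apply,
      LinearMap.smul_apply, D.castTo_self]
    module
  · refine ⟨fun {y' w n} l' a b f g r' => ?_⟩
    have h1 := (hB x y (q + (l'.append (.cons f r')).deg)).lin l' a b f g r'
    have h2 : ∀ u : C.Hom y' w n, D.compTo N (A y z l) (B _ _ (l'.append (.cons u r'))) =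
        D.compTo N (A y z l) (D.castTo (q + (l'.append (.cons f r')).deg)
          (B x y (l'.append (.cons u r')))) := fun u => by
      rw [D.compTo_castTo_right _ (by simp)]
    rw [h2, h1, h2 g]
    simp only [map_add, map_smul, D.castTo_self]
    module

theorem conv_isReduced (h : p + q = n) {A : PreCochain C D G H p} {B : PreCochain C D F G q}
    (hA : A.IsReduced) (hB : B.IsReduced) : (conv n A B).IsReduced := by
  refine isReduced_of (conv_isLin h hA.isLin hB.isLin) fun {x y₀ w} l r => ?_
  rw [conv_apply]
  refine Chain.sumCuts_id (x := x) (z := w) (fun y l' r' => sgn k (q * l'.deg) •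
    D.compTo (n + (l.append (.cons (C.id y₀) r)).deg) (A _ _ l') (B _ _ r')) ?_ ?_ l r
  · intro y v l r r'
    simp [hA.normalized]
  · intro y v l r r'
    simp [hB.normalized]

end PreCochain

namespace Chain

variable {C D : DGCat k} {M : Type u} [AddCommGroup M] [Module k M]

theorem sumCuts_last {x z : C.Obj} (c : Chain C x z)
    (φ : ∀ y : C.Obj, Chain C y z → Chain C x y → M)
    (h : ∀ v y l (n : ℤ) (f : C.Hom v y n) r, φ y l (cons f r) = 0) :
    (c.sumCuts fun s => φ s.mid s.left s.right) = φ x c nil := by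
  induction c with
  | nil => rw [sumCuts_nil]
  | cons f c ih =>
    rw [sumCuts_cons, h, zero_add, ih (fun y l r => φ y (cons f l) r)
      (fun v y l n g r => h v y (cons f l) n g r)]

/-- The value `φ l` if `r` is empty. -/
def lastVal {x z : C.Obj} (φ : Chain C x z → M) : {y : C.Obj} → Chain C y z → Chain C x y → M
  | _, l, nil => φ l
  | _, _, cons _ _ => 0

theorem sumCuts_tau {x y z : C.Obj} (φ : ∀ y : C.Obj, Chain C y z → Chain C x y → M)
    (hl : ∀ y v l r r', φ y (append l (cons (C.id v) r)) r' = 0)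
    (hr : ∀ u v w l (n m : ℤ) (f : C.Hom v w n) (g : C.Hom u v m) r,
      φ w l (cons f (cons g r)) = 0)
    (l : Chain C y z) (r : Chain C x y) :
    ((l.append (cons (C.id y) r)).sumCuts fun s => φ s.mid s.left s.right) =
      lastVal (fun l => φ x l (cons (C.id x) nil)) l r := by
  induction l with
  | nil =>
    cases r with
    | nil =>
      have := hl x x nil nil nil
      simp only [nil_append] at this
      simp [sumCuts_cons, sumCuts_nil, this, lastVal]
    | cons g r =>
      simp only [nil_append, sumCuts_cons (C.id _), hr, zero_add]
      exact sumCuts_zero _ fun s _ => hl s.mid _ nil s.left s.right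
  | cons e l ih =>
    have h0 : φ _ nil (cons e (l.append (cons (C.id y) r))) = 0 := by
      cases l with
      | nil => exact hr ..
      | cons g l => exact hr ..
    have := ih (fun y l r => φ y (cons e l) r) (fun y v l r r' => hl y v (cons e l) r r')
      (fun u v w l n m f g r => hr u v w (cons e l) n m f g r)
    simp only [cons_append, sumCuts_cons, h0, zero_add, this]
    cases r <;> rfl

end Chain

namespace PreCochain

variable {C D : DGCat k} {F G H K : C.Obj → D.Obj} {p q r n m : ℤ}

theorem one_nil (x : C.Obj) : one F x x .nil = D.castTo _ (D.id (F x)) := rfl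

theorem one_cons {x y z : C.Obj} (f : C.Hom y z n) (c : Chain C x y) :
    one F x z (.cons f c) = 0 := rfl

theorem tau_nil (φ : ∀ {x y : C.Obj} {n : ℤ}, C.Hom x y n → D.Hom (F x) (F y) n) (x : C.Obj) :
    tau F φ x x .nil = 0 := rfl

theorem tau_cons_nil (φ : ∀ {x y : C.Obj} {n : ℤ}, C.Hom x y n → D.Hom (F x) (F y) n)
    {x z : C.Obj} (f : C.Hom x z n) :
    tau F φ x z (.cons f .nil) = D.castTo _ (φ f) := rfl

theorem tau_cons_cons (φ : ∀ {x y : C.Obj} {n : ℤ}, C.Hom x y n → D.Hom (F x) (F y) n)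
    {w x y z : C.Obj} (f : C.Hom y z n) (g : C.Hom x y m) (c : Chain C w x) :
    tau F φ w z (.cons f (.cons g c)) = 0 := rfl

theorem one_append_cons {x y z w : C.Obj} (l : Chain C z w) (f : C.Hom y z n) (r : Chain C x y) :
    one F x w (l.append (.cons f r)) = 0 := by cases l <;> rfl

theorem one_conv (A : PreCochain C D F G p) : conv p (one G) A = A := by
  funext x z c
  rw [conv_apply]
  cases c with
  | nil =>
    rw [Chain.sumCuts_nil]
    dsimp only
    rw [one_nil, D.compTo_castTo_left _ (by simp), D.id_compTo]
    show sgn k (p * 0) • _ = _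
    rw [mul_zero, sgn_zero, one_smul]
    exact D.castTo_self _
  | cons f c =>
    rw [Chain.sumCuts_cons, Chain.sumCuts_zero _ fun s _ => by
      simp only [one_cons, map_zero, LinearMap.zero_apply, smul_zero]]
    dsimp only
    rw [one_nil, D.compTo_castTo_left _ (by simp), D.id_compTo]
    show sgn k (p * 0) • _ + 0 = _
    rw [mul_zero, sgn_zero, one_smul, add_zero]
    exact D.castTo_self _

theorem conv_one (A : PreCochain C D F G p) : conv p A (one F) = A := by
  funext x z c
  rw [conv_apply]
  rw [Chain.sumCuts_last c (fun y l r => sgn k (0 * l.deg) •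
    D.compTo (p + c.deg) (A _ _ l) (one F _ _ r)) (fun v y l n f r => by
      simp only [one_cons, map_zero, smul_zero])]
  rw [one_nil, D.compTo_castTo_right _ (by simp), D.compTo_id, zero_mul, sgn_zero, one_smul]
  exact D.castTo_self _

theorem one_isReduced : (one F : PreCochain C D F F 0).IsReduced := by
  refine ⟨fun l a b f g r => ?_, fun l r => ?_⟩ <;>
    simp only [one_append_cons, map_zero, smul_zero, add_zero]

theorem conv_tau_nil (φ : ∀ {x y : C.Obj} {n : ℤ}, C.Hom x y n → D.Hom (G x) (G y) n)
    (A : PreCochain C D F G p) (x : C.Obj) : conv n (tau G φ) A x x .nil = 0 := by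
  simp only [conv_apply, Chain.sumCuts_nil, tau_nil, map_zero, LinearMap.zero_apply, smul_zero]

theorem conv_tau_cons (φ : ∀ {x y : C.Obj} {n : ℤ}, C.Hom x y n → D.Hom (G x) (G y) n)
    (A : PreCochain C D F G p) {x y z : C.Obj} {e : ℤ} (f : C.Hom y z e) (c : Chain C x y) :
    conv n (tau G φ) A x z (.cons f c) =
      sgn k (p * (e - 1)) • D.compTo _ (φ f) (A x y c) := by
  rw [conv_apply, Chain.sumCuts_cons, tau_nil, map_zero, LinearMap.zero_apply, smul_zero, zero_add]
  have h : ∀ (N : ℤ), D.compTo N (tau G φ y z (.cons f .nil)) (A x y c) =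
      D.compTo N (φ f) (A x y c) := fun N => by
    rw [tau_cons_nil, D.compTo_castTo_left _ (by simp [Chain.deg_cons])]
  cases c with
  | nil =>
    rw [Chain.sumCuts_nil]
    dsimp only
    rw [h]
    show sgn k (p * (e - 1 + 0)) • _ = _
    rw [add_zero]
  | cons g c =>
    rw [Chain.sumCuts_cons]
    dsimp only
    rw [h, Chain.sumCuts_zero _ fun s _ => by
      simp only [tau_cons_cons, map_zero, LinearMap.zero_apply, smul_zero]]
    rw [add_zero, Chain.deg_cons f .nil, Chain.deg_nil, add_zero]

theorem tau_isLin (F : DGFunctor C D) (x z : C.Obj) (N : ℤ) :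
    Chain.IsLin fun c : Chain C x z => D.castTo N (tau F.obj (fun f => F.map f) x z c) := by
  have h0 : ∀ {a b : D.Obj} (m : ℤ), D.castTo N (0 : D.Hom a b m) = 0 := fun m => map_zero _
  refine ⟨fun {y w n} l a b f g r => ?_⟩
  cases l with
  | nil =>
    cases r with
    | nil =>
      show D.castTo N (D.castTo _ (F.map (a • f + b • g))) =
        a • D.castTo N (D.castTo _ (F.map f)) + b • D.castTo N (D.castTo _ (F.map g))
      simp only [map_add, map_smul]
      rfl
    | cons e r =>
      show D.castTo N 0 = a • D.castTo N 0 + b • D.castTo N 0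
      simp only [h0, smul_zero, add_zero]
  | cons e l =>
    cases l with
    | nil =>
      show D.castTo N 0 = a • D.castTo N 0 + b • D.castTo N 0
      simp only [h0, smul_zero, add_zero]
    | cons e' l =>
      show D.castTo N 0 = a • D.castTo N 0 + b • D.castTo N 0
      simp only [h0, smul_zero, add_zero]

theorem tau_mc (F : DGFunctor C D) : bdry 2 (tau F.obj fun f => F.map f) +
    conv 2 (tau F.obj fun f => F.map f) (tau F.obj fun f => F.map f) = 0 := by
  funext x z c
  rw [Pi.add_apply, Pi.add_apply, Pi.add_apply, bdry_apply]
  match c with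
  | .nil =>
    rw [conv_tau_nil, Chain.sumBar_nil, tau_nil, map_zero, smul_zero, sub_zero, add_zero]; rfl
  | .cons (n := e) f .nil =>
    rw [conv_tau_cons, tau_nil, map_zero, smul_zero, add_zero, Chain.sumBar_cons, Chain.sumBar_nil,
      Chain.sumHead_nil, smul_zero, add_zero, add_zero, tau_cons_nil, tau_cons_nil,
      D.dTo_castTo _ (by simp only [Chain.deg_cons, Chain.deg_nil]; ring),
      D.castTo_castTo _ (by simp only [Chain.deg_cons, Chain.deg_nil]; ring), ← C.dTo_eq, F.map_dTo,
      D.castTo_dTo _ rfl, sgn_one, neg_one_smul, neg_neg, sub_self]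
    rfl
  | .cons (n := e) f (.cons (n := e') g .nil) =>
    rw [conv_tau_cons]
    simp only [Chain.sumBar_cons, Chain.sumBar_nil, Chain.sumHead_nil, Chain.sumHead_cons,
      tau_cons_cons, tau_cons_nil, map_zero, smul_zero, add_zero, neg_zero, zero_add]
    rw [D.castTo_castTo _ (by simp only [Chain.deg_cons, Chain.deg_nil]; ring), D.compTo_castTo_right _ (by simp only [Chain.deg_cons, Chain.deg_nil]; ring), ← C.compTo_eq,
      F.map_compTo, D.castTo_compTo _ rfl, sgn_one, sgn_eq_neg k (m := e) (n := 1 * (e - 1))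
        (by rw [show e - 1 * (e - 1) - 1 = 0 by ring]; simp)]
    refine Eq.trans ?_ (zero_smul k (0 : D.Hom _ _ _))
    rw [zero_smul]
    module
  | .cons (n := e) f (.cons (n := e') g (.cons (n := e'') g' c)) =>
    rw [conv_tau_cons]
    have h : ((Chain.cons g' c).sumBar fun t =>
        (D.castTo (2 + (Chain.cons f (.cons g (.cons g' c))).deg)
          (tau F.obj (fun f => F.map f) x z (.cons f (.cons g t))))) = 0 :=
      Chain.sumBar_zero _ fun c' _ => by rw [tau_cons_cons, map_zero]
    rw [Chain.sumBar_cons, Chain.sumBar_cons, h]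
    simp only [tau_cons_cons, Chain.sumHead_cons, map_zero, smul_zero, add_zero, neg_zero, sub_zero]
    rfl

theorem conv_neg_left (A : PreCochain C D G H p) (B : PreCochain C D F G q) :
    conv n (-A) B = -conv n A B := by
  simp only [← convL_apply, map_neg, LinearMap.neg_apply]

theorem tau_tau (F : DGFunctor C D) :
    conv 2 (tau F.obj fun f => F.map f) (tau F.obj fun f => F.map f) =
      -bdry 2 (tau F.obj fun f => F.map f) :=
  (neg_eq_of_add_eq_zero_right (tau_mc F)).symm

section

variable {F G H : DGFunctor C D}

/-- The differential of Hochschild cochains for two dg functors. -/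
abbrev diffF (m : ℤ) (A : PreCochain C D F.obj G.obj p) : PreCochain C D F.obj G.obj m :=
  diff (F := F.obj) (G := G.obj) (fun f => G.map f) (fun f => F.map f) m A

theorem diff_diff {A : PreCochain C D F.obj G.obj p} (hA : A.IsReduced) (hm : p + 1 = m)
    (_hn : m + 1 = n) : diffF n (diffF m A) = 0 := by
  have h1 := bdry_conv (n := m) n (by omega) (show (1 : ℤ) + 1 = 2 by norm_num) hm
    (tau G.obj fun f => G.map f) A
  have h2 := bdry_conv (n := m) n hm hm (show (1 : ℤ) + 1 = 2 by norm_num) A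
    (tau F.obj fun f => F.map f)
  have h3 := conv_assoc (p := 1) (q := 1) (r := p) (s := 2) (t := m) n (by norm_num) (by omega)
    (tau G.obj fun f => G.map f) (tau G.obj fun f => G.map f) A
  have h4 := conv_assoc (p := 1) (q := p) (r := 1) (s := m) (t := m) n (by omega) hm
    (tau G.obj fun f => G.map f) A (tau F.obj fun f => F.map f)
  have h5 := conv_assoc (p := p) (q := 1) (r := 1) (s := m) (t := 2) n hm (by norm_num)
    A (tau F.obj fun f => F.map f) (tau F.obj fun f => F.map f)
  rw [tau_tau] at h3 h5
  simp only [diffF, diff]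
  simp only [← convL_apply, ← bdryL_apply, map_add, map_sub, map_smul, LinearMap.add_apply,
    LinearMap.sub_apply, LinearMap.smul_apply, map_neg, LinearMap.neg_apply] at h1 h2 h3 h4 h5 ⊢
  have h0 : bdryL n (bdryL m A) = 0 := bdry_bdry hA n hm
  rw [h0, h1, h2, ← h3, h4, h5, ← hm, sgn_add, sgn_one]
  match_scalars <;> ring

theorem diff_conv {p' q' : ℤ} (h : p + q = n) (hm : n + 1 = m) (hp : p + 1 = p') (hq : q + 1 = q')
    (A : PreCochain C D G.obj H.obj p) (B : PreCochain C D F.obj G.obj q) :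
    diffF m (conv n A B) = conv m (diffF p' A) B + sgn k p • conv m A (diffF q' B) := by
  have h1 := bdry_conv m h hp hq A B
  have h2 := conv_assoc (p := 1) (q := p) (r := q) (s := p') (t := n) m (by omega) h
    (tau H.obj fun f => H.map f) A B
  have h3 := conv_assoc (p := p) (q := 1) (r := q) (s := p') (t := q') m hp (by omega)
    A (tau G.obj fun f => G.map f) B
  have h4 := conv_assoc (p := p) (q := q) (r := 1) (s := n) (t := q') m h hq
    A B (tau F.obj fun f => F.map f)
  simp only [diffF, diff]
  simp only [← convL_apply, ← bdryL_apply, map_add, map_sub, map_smul, LinearMap.add_apply,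
    LinearMap.sub_apply, LinearMap.smul_apply] at h1 h2 h3 h4 ⊢
  rw [h1, h2, h3, h4, ← h, sgn_add]
  module

theorem diff_isReduced {A : PreCochain C D F.obj G.obj p} (hA : A.IsReduced) (hm : p + 1 = m) :
    (diffF m A).IsReduced := by
  refine isReduced_of (fun x z N => ?_) fun {x y w} l r => ?_
  · have hb : Chain.IsLin fun c : Chain C x z => D.castTo N (bdry m A x z c) := by
      have e : (fun c : Chain C x z => D.castTo N (bdry m A x z c)) = fun c =>
          D.dTo N (D.castTo (N - 1) (A x z c)) -
            sgn k p • c.sumBar fun t => D.castTo N (A x z t) := by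
        funext c
        rw [bdry_apply, map_sub, map_smul, Chain.map_sumBar]
        have a1 : D.castTo N (D.dTo (m + c.deg) (A x z c)) =
            D.dTo N (D.castTo (N - 1) (A x z c)) := by
          by_cases hN : p + c.deg = N - 1
          · rw [D.dTo_castTo _ hN, D.castTo_dTo _ (by omega)]
          · rw [D.castTo_of_ne hN, map_zero, D.castTo_dTo _ (by omega), D.dTo_of_ne (by omega)]
        have a2 : (c.sumBar fun t => D.castTo N (D.castTo (m + c.deg) (A x z t))) =
            c.sumBar fun t => D.castTo N (A x z t) :=
          Chain.sumBar_congr _ fun t ht => by rw [D.castTo_castTo _ (by omega)]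
        rw [a1, a2]
      rw [e]
      refine ⟨fun {y w n} l a b f g r => ?_⟩
      simp only [(hA.isLin x z (N - 1)).lin, (Chain.sumBar_isLin _ (hA.isLin x z N)).lin, map_add,
        map_smul]
      module
    have hl := conv_isLin (n := m) (by omega) (tau_isLin G) hA.isLin x z N
    have hr := conv_isLin (n := m) (by omega) hA.isLin (tau_isLin F) x z N
    refine ⟨fun {y w n} l a b f g r => ?_⟩
    simp only [diffF, diff, Pi.add_apply, Pi.sub_apply, Pi.smul_apply, map_add, map_sub, map_smul,
      hb.lin, hl.lin, hr.lin]
    module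
  · simp only [diffF, diff, Pi.add_apply, Pi.sub_apply, Pi.smul_apply, bdry_apply]
    set N := m + (l.append (.cons (C.id y) r)).deg with hN
    have e1 := Chain.sumBar_id _ (hA.isLin x w N) (fun y l r => by
      rw [hA.normalized, map_zero]) l r
    have e2 : conv m (tau G.obj fun f => G.map f) A x w (l.append (.cons (C.id y) r)) =
        sgn k p • Chain.headVal (fun c => D.castTo N (A x w c)) l r := by
      cases l with
      | nil =>
        simp only [Chain.nil_append, conv_tau_cons, Chain.headVal, DGFunctor.map_id, D.id_compTo]
        rw [sgn_eq k (m := p * (0 - 1)) (n := p)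
          (by rw [show p * (0 - 1) - p = 2 * (-p) by ring]; simp)]
        rfl
      | cons f l =>
        simp only [Chain.cons_append, conv_tau_cons, Chain.headVal, hA.normalized, map_zero, smul_zero]
        rfl
    have e3 : conv m A (tau F.obj fun f => F.map f) x w (l.append (.cons (C.id y) r)) =
        Chain.tailVal (fun c => D.castTo N (A x w c)) l r := by
      rw [conv_apply, Chain.sumCuts_tau (x := x) (z := w) (fun y l' r' => sgn k (1 * l'.deg) •
        D.compTo N (A _ _ l') (tau F.obj (fun f => F.map f) _ _ r')) ?_ ?_ l r]
      · cases r with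
        | nil =>
          simp only [tau_cons_nil, Chain.tailVal, one_mul, DGFunctor.map_id]
          show sgn k l.deg • D.compTo N (A x w l) (D.castTo _ (D.id (F.obj x))) = _
          rw [D.compTo_castTo_right _ (by simp [Chain.deg_cons]), D.compTo_id]
        | cons g r => rfl
      · intro y v l r r'
        simp [hA.normalized]
      · intro u v w l n m f g r
        simp only [tau_cons_cons, map_zero, smul_zero]
    rw [e1, e2, e3, hA.normalized, map_zero]
    module

end


end PreCochain

/-- Reduced Hochschild cochains of total degree `p` on `C` with coefficients in `D(F -, G -)`: the
product over all lengths `N` of the spaces of multilinear maps of degree `p - N` on chains of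
`N` composable morphisms, vanishing as soon as one of the arguments is an identity. -/
def Cochain {C D : DGCat k} (F G : DGFunctor C D) (p : ℤ) :
    Submodule k (PreCochain C D F.obj G.obj p) where
  carrier := {Ψ | Ψ.IsReduced}
  zero_mem' := ⟨fun _ _ _ _ _ _ => by simp, fun _ _ => rfl⟩
  add_mem' {A B} hA hB := by
    refine ⟨fun l a b f g r => ?_, fun l r => ?_⟩
    · simp only [Pi.add_apply, hA.linear l a b f g r, hB.linear l a b f g r, map_add]
      module
    · simp only [Pi.add_apply, hA.normalized l r, hB.normalized l r, add_zero]
  smul_mem' e A hA := by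
    refine ⟨fun l a b f g r => ?_, fun l r => ?_⟩
    · simp only [Pi.smul_apply, hA.linear l a b f g r, map_smul]
      module
    · simp only [Pi.smul_apply, hA.normalized l r, smul_zero]

/-- The dg category `Coh_dg(C, D)`: its objects are the dg functors `C ⟶ D`, and its morphisms are
the coherent natural transformations, i.e. the reduced Hochschild cochains. -/
def Coh (C D : DGCat k) : DGCat k where
  Obj := DGFunctor C D
  Hom F G p := Cochain F G p
  id F := ⟨PreCochain.one F.obj, PreCochain.one_isReduced⟩
  comp {_ _ _ _ _ n} h := LinearMap.mk₂ k
    (fun A B => ⟨PreCochain.conv n A.1 B.1, PreCochain.conv_isReduced h A.2 B.2⟩)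
    (fun _ _ _ => Subtype.ext (PreCochain.conv_add_left ..))
    (fun _ _ _ => Subtype.ext (PreCochain.conv_smul_left ..))
    (fun _ _ _ => Subtype.ext (PreCochain.conv_add_right ..))
    (fun _ _ _ => Subtype.ext (PreCochain.conv_smul_right ..))
  d {_ _ _ m} h :=
    { toFun := fun A => ⟨PreCochain.diffF m A.1,
        PreCochain.diff_isReduced A.2 h⟩
      map_add' := fun A B => Subtype.ext (by
        simp only [PreCochain.diffF, PreCochain.diff, ← PreCochain.convL_apply, ← PreCochain.bdryL_apply,
          Submodule.coe_add, map_add, LinearMap.add_apply]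
        module)
      map_smul' := fun a A => Subtype.ext (by
        simp only [PreCochain.diffF, PreCochain.diff, ← PreCochain.convL_apply, ← PreCochain.bdryL_apply,
          Submodule.coe_smul, map_smul, LinearMap.smul_apply, RingHom.id_apply]
        module) }
  id_comp _ A := Subtype.ext (PreCochain.one_conv A.1)
  comp_id _ A := Subtype.ext (PreCochain.conv_one A.1)
  assoc hs _ ht _ A B E := Subtype.ext (PreCochain.conv_assoc _ hs ht A.1 B.1 E.1)
  d_d h h' A := Subtype.ext (PreCochain.diff_diff A.2 h h')
  d_comp h hm hp hq _ _ A B := Subtype.ext (PreCochain.diff_conv h hm hp hq A.1 B.1)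

/-- The family of maps underlying a coherent natural transformation. -/
def Coh.val {C D : DGCat k} {F G : DGFunctor C D} {p : ℤ} (Ψ : (Coh C D).Hom F G p) :
    PreCochain C D F.obj G.obj p := Subtype.val Ψ

/-! ### The twisted tensor product -/

/-- The data needed to interpret the generators of the twisted tensor product of `C` and `D` in a
dg category `X`: objects `c × d`, morphisms `id_c ⊗ g`, and morphisms `ε(f; g_1, …, g_N)`, where
`ε(f; )`, with `N = 0`, is the morphism `f ⊗ id`. The chain `g_N, …, g_1` has its last applied
morphism at the head. The degree of `ε(f; g_1, …, g_N)` is `|f| + ∑ (|g_i| - 1)`. -/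
structure Pairing (C D X : DGCat k) where
  obj : C.Obj → D.Obj → X.Obj
  right : ∀ (c : C.Obj) {d d' : D.Obj} {n : ℤ}, D.Hom d d' n → X.Hom (obj c d) (obj c d') n
  eps : ∀ {c c' : C.Obj} {p : ℤ}, C.Hom c c' p → PreCochain D X (obj c) (obj c') p

open PreCochain

/-- The defining relations of the twisted tensor product. -/
structure Pairing.IsTwisted {C D X : DGCat k} (P : Pairing C D X) : Prop where
  /-- `id_c ⊗ g` is linear in `g`. -/
  right_linear : ∀ (c : C.Obj) {d d' : D.Obj} {n : ℤ} (a b : k) (g g' : D.Hom d d' n),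
    P.right c (a • g + b • g') = a • P.right c g + b • P.right c g'
  /-- `id_c ⊗ id_d` is the identity. -/
  right_id : ∀ (c : C.Obj) (d : D.Obj), P.right c (D.id d) = X.id (P.obj c d)
  /-- `id_c ⊗ (g g') = (id_c ⊗ g) (id_c ⊗ g')`. -/
  right_comp : ∀ (c : C.Obj) {d d' d'' : D.Obj} {p q n : ℤ} (h : p + q = n) (g : D.Hom d' d'' p)
    (g' : D.Hom d d' q), P.right c (D.comp h g g') = X.comp h (P.right c g) (P.right c g')
  /-- `d (id_c ⊗ g) = id_c ⊗ dg`. -/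
  right_d : ∀ (c : C.Obj) {d d' : D.Obj} {n m : ℤ} (h : n + 1 = m) (g : D.Hom d d' n),
    P.right c (D.d h g) = X.d h (P.right c g)
  /-- `ε(f; g_1, …, g_N)` is linear in `f`. -/
  eps_linear : ∀ {c c' : C.Obj} {p : ℤ} (a b : k) (f f' : C.Hom c c' p),
    P.eps (a • f + b • f') = a • P.eps f + b • P.eps f'
  /-- `ε(f; g_1, …, g_N)` is linear in each `g_i`, and zero if some `g_i` is an identity. -/
  eps_reduced : ∀ {c c' : C.Obj} {p : ℤ} (f : C.Hom c c' p), (P.eps f).IsReduced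
  /-- `id_c ⊗ id_d` is the identity, and `ε(id; g_1, …, g_N) = 0` if `N ≥ 1`. -/
  eps_id : ∀ c : C.Obj, P.eps (C.id c) = one (P.obj c)
  /-- `ε(f₂ f₁; g_1, …, g_N) =`
  `∑ m, (-1)^(|f₁| ∑ j > m, (|g_j| - 1)) ε(f₂; g_{m+1}, …, g_N) ε(f₁; g_1, …, g_m)`. -/
  eps_comp : ∀ {c c' c'' : C.Obj} {p q n : ℤ} (h : p + q = n) (f₂ : C.Hom c' c'' p)
    (f₁ : C.Hom c c' q), P.eps (C.comp h f₂ f₁) = conv n (P.eps f₂) (P.eps f₁)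
  /-- `ε(df; g_1, …, g_N) = d(ε(f; g_1, …, g_N))`
  `+ ∑ i, (-1)^(|f| + ∑ j > i, (|g_j| - 1)) ε(f; g_1, …, d g_i, …, g_N)`
  `+ (-1)^(|f| |g_N| + |f|) (id ⊗ g_N) ε(f; g_1, …, g_{N-1})`
  `+ ∑ i, (-1)^(|f| + ∑ j ≥ i + 1, (|g_j| - 1)) ε(f; g_1, …, g_{i+1} g_i, …, g_N)`
  `+ (-1)^(|f| + 1 + ∑ j ≥ 2, (|g_j| - 1)) ε(f; g_2, …, g_N) (id ⊗ g_1)`. -/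
  eps_d : ∀ {c c' : C.Obj} {p m : ℤ} (h : p + 1 = m) (f : C.Hom c c' p),
    P.eps (C.d h f) = diff (fun g => P.right c' g) (fun g => P.right c g) m (P.eps f)

/-- Formal expressions built from the generators `id_c ⊗ g` and `ε(f; g_1, …, g_N)` by means of
linear combinations, compositions and differentials. -/
inductive TTTerm (C D : DGCat k) : C.Obj × D.Obj → C.Obj × D.Obj → ℤ → Type u
  | right (c : C.Obj) {d d' : D.Obj} {n : ℤ} (g : D.Hom d d' n) : TTTerm C D (c, d) (c, d') n
  | eps {c c' : C.Obj} {p : ℤ} (f : C.Hom c c' p) {d d' : D.Obj} (gs : Chain D d d') :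
      TTTerm C D (c, d) (c', d') (p + gs.deg)
  | zero {x y : C.Obj × D.Obj} {n : ℤ} : TTTerm C D x y n
  | add {x y : C.Obj × D.Obj} {n : ℤ} (s t : TTTerm C D x y n) : TTTerm C D x y n
  | smul {x y : C.Obj × D.Obj} {n : ℤ} (a : k) (s : TTTerm C D x y n) : TTTerm C D x y n
  | id (x : C.Obj × D.Obj) : TTTerm C D x x 0
  | comp {x y z : C.Obj × D.Obj} {p q n : ℤ} (h : p + q = n) (s : TTTerm C D y z p)
      (t : TTTerm C D x y q) : TTTerm C D x z n
  | d {x y : C.Obj × D.Obj} {n m : ℤ} (h : n + 1 = m) (s : TTTerm C D x y n) : TTTerm C D x y m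

namespace TTTerm

variable {C D X : DGCat k}

/-- The interpretation of formal expressions. -/
def eval (P : Pairing C D X) {x y : C.Obj × D.Obj} {n : ℤ} :
    TTTerm C D x y n → X.Hom (P.obj x.1 x.2) (P.obj y.1 y.2) n
  | right c g => P.right c g
  | eps f gs => P.eps f _ _ gs
  | zero => 0
  | add s t => eval P s + eval P t
  | smul a s => a • eval P s
  | id x => X.id _
  | comp h s t => X.comp h (eval P s) (eval P t)
  | d h s => X.d h (eval P s)

/-- Two formal expressions are identified if they are equal in every dg category in which the
generators are interpreted in such a way that the defining relations hold. This is the smallest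
congruence for which the quotient is a dg category satisfying the defining relations. -/
def setoid (C D : DGCat k) (x y : C.Obj × D.Obj) (n : ℤ) : Setoid (TTTerm C D x y n) where
  r s t := ∀ (X : DGCat k) (P : Pairing C D X), P.IsTwisted → eval P s = eval P t
  iseqv := ⟨fun _ _ _ _ => rfl, fun h X P hP => (h X P hP).symm,
    fun h h' X P hP => (h X P hP).trans (h' X P hP)⟩

end TTTerm

/-- Morphisms of degree `n` of the twisted tensor product. -/
def TTHom (C D : DGCat k) (x y : C.Obj × D.Obj) (n : ℤ) : Type u := Quotient (TTTerm.setoid C D x y n)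

namespace TTHom

variable {C D X : DGCat k} {x y z : C.Obj × D.Obj} {n m p q : ℤ}

/-- The class of a formal expression. -/
def mk (s : TTTerm C D x y n) : TTHom C D x y n := Quotient.mk _ s

/-- The interpretation of morphisms of the twisted tensor product. -/
def eval (P : Pairing C D X) (hP : P.IsTwisted) (s : TTHom C D x y n) :
    X.Hom (P.obj x.1 x.2) (P.obj y.1 y.2) n :=
  Quotient.lift (TTTerm.eval P) (fun s t (h : (TTTerm.setoid C D x y n).r s t) => h X P hP) s

theorem ext {s t : TTHom C D x y n}
    (h : ∀ (X : DGCat k) (P : Pairing C D X) (hP : P.IsTwisted), eval P hP s = eval P hP t) :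
    s = t := by
  induction s using Quotient.inductionOn with | _ s
  induction t using Quotient.inductionOn with | _ t
  exact Quotient.sound fun X P hP => h X P hP

instance : Zero (TTHom C D x y n) := ⟨mk .zero⟩

instance : Add (TTHom C D x y n) :=
  ⟨Quotient.map₂ .add fun _ _ h _ _ h' X P hP => by simp only [TTTerm.eval, h X P hP, h' X P hP]⟩

instance : SMul k (TTHom C D x y n) :=
  ⟨fun a => Quotient.map (.smul a) fun _ _ h X P hP => by simp only [TTTerm.eval, h X P hP]⟩

instance : Neg (TTHom C D x y n) := ⟨fun s => (-1 : k) • s⟩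

/-- Composition. -/
def comp (h : p + q = n) : TTHom C D y z p → TTHom C D x y q → TTHom C D x z n :=
  Quotient.map₂ (.comp h) fun _ _ h _ _ h' X P hP => by
    simp only [TTTerm.eval, h X P hP, h' X P hP]

/-- The differential. -/
def d (h : n + 1 = m) : TTHom C D x y n → TTHom C D x y m :=
  Quotient.map (.d h) fun _ _ h X P hP => by simp only [TTTerm.eval, h X P hP]

variable (P : Pairing C D X) (hP : P.IsTwisted)

theorem eval_mk (s : TTTerm C D x y n) : eval P hP (mk s) = s.eval P := rfl

theorem eval_zero : eval P hP (0 : TTHom C D x y n) = 0 := rfl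

theorem eval_add (s t : TTHom C D x y n) : eval P hP (s + t) = eval P hP s + eval P hP t :=
  Quotient.inductionOn₂ s t fun _ _ => rfl

theorem eval_smul (a : k) (s : TTHom C D x y n) : eval P hP (a • s) = a • eval P hP s :=
  Quotient.inductionOn s fun _ => rfl

theorem eval_neg (s : TTHom C D x y n) : eval P hP (-s) = -eval P hP s := by
  rw [← neg_one_smul k (eval P hP s)]; exact eval_smul P hP _ s

theorem eval_comp (h : p + q = n) (s : TTHom C D y z p) (t : TTHom C D x y q) :
    eval P hP (comp h s t) = X.comp h (eval P hP s) (eval P hP t) :=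
  Quotient.inductionOn₂ s t fun _ _ => rfl

theorem eval_d (h : n + 1 = m) (s : TTHom C D x y n) :
    eval P hP (d h s) = X.d h (eval P hP s) :=
  Quotient.inductionOn s fun _ => rfl

instance : AddCommGroup (TTHom C D x y n) where
  add_assoc a b c := ext fun X P hP => by simp only [eval_add, add_assoc]
  zero_add a := ext fun X P hP => by simp only [eval_add, eval_zero, zero_add]
  add_zero a := ext fun X P hP => by simp only [eval_add, eval_zero, add_zero]
  add_comm a b := ext fun X P hP => by simp only [eval_add, add_comm]
  neg_add_cancel a := ext fun X P hP => by
    simp only [eval_add, eval_neg, eval_zero, neg_add_cancel]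
  nsmul := nsmulRec
  zsmul := zsmulRec

instance : Module k (TTHom C D x y n) where
  one_smul a := ext fun X P hP => by simp only [eval_smul, one_smul]
  mul_smul a b s := ext fun X P hP => by simp only [eval_smul, mul_smul]
  smul_zero a := ext fun X P hP => by simp only [eval_smul, eval_zero, smul_zero]
  smul_add a s t := ext fun X P hP => by simp only [eval_smul, eval_add, smul_add]
  add_smul a b s := ext fun X P hP => by simp only [eval_smul, eval_add, add_smul]
  zero_smul s := ext fun X P hP => by simp only [eval_smul, eval_zero, zero_smul]

end TTHom

/-- The twisted tensor product of `C` and `D`: the dg category with set of objects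
`Ob C × Ob D` presented by the generators `id_c ⊗ g` and `ε(f; g_1, …, g_N)` (with
`ε(f; ) = f ⊗ id`) and the relations `Pairing.IsTwisted`. -/
def TT (C D : DGCat k) : DGCat k where
  Obj := C.Obj × D.Obj
  Hom := TTHom C D
  id x := TTHom.mk (.id x)
  comp h := LinearMap.mk₂ k (TTHom.comp h)
    (fun _ _ _ => TTHom.ext fun X P hP => by
      simp only [TTHom.eval_comp, TTHom.eval_add, map_add, LinearMap.add_apply])
    (fun _ _ _ => TTHom.ext fun X P hP => by
      simp only [TTHom.eval_comp, TTHom.eval_smul, map_smul, LinearMap.smul_apply])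
    (fun _ _ _ => TTHom.ext fun X P hP => by
      simp only [TTHom.eval_comp, TTHom.eval_add, map_add])
    (fun _ _ _ => TTHom.ext fun X P hP => by
      simp only [TTHom.eval_comp, TTHom.eval_smul, map_smul])
  d h :=
    { toFun := TTHom.d h
      map_add' := fun _ _ => TTHom.ext fun X P hP => by
        simp only [TTHom.eval_d, TTHom.eval_add, map_add]
      map_smul' := fun _ _ => TTHom.ext fun X P hP => by
        simp only [TTHom.eval_d, TTHom.eval_smul, map_smul, RingHom.id_apply] }
  id_comp h f := TTHom.ext fun X P hP => by
    simp only [LinearMap.mk₂_apply, TTHom.eval_comp, TTHom.eval_mk, TTTerm.eval, X.id_comp]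
  comp_id h f := TTHom.ext fun X P hP => by
    simp only [LinearMap.mk₂_apply, TTHom.eval_comp, TTHom.eval_mk, TTTerm.eval, X.comp_id]
  assoc hs hsr ht hpt f g e := TTHom.ext fun X P hP => by
    simp only [LinearMap.mk₂_apply, TTHom.eval_comp, X.assoc hs hsr ht hpt]
  d_d h h' f := TTHom.ext fun X P hP => by
    simp only [LinearMap.coe_mk, AddHom.coe_mk, TTHom.eval_d, X.d_d, TTHom.eval_zero]
  d_comp h hm hp hq hl hr f g := TTHom.ext fun X P hP => by
    simp only [LinearMap.mk₂_apply, LinearMap.coe_mk, AddHom.coe_mk, TTHom.eval_d, TTHom.eval_comp,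
      TTHom.eval_add, TTHom.eval_smul, X.d_comp h hm hp hq hl hr]

namespace TT

variable {C D X : DGCat k}

/-- The dg functor out of the twisted tensor product given by an interpretation of the
generators. -/
def lift (P : Pairing C D X) (hP : P.IsTwisted) : DGMap (TT C D) X fun x => P.obj x.1 x.2 where
  map :=
    { toFun := TTHom.eval P hP
      map_add' := TTHom.eval_add P hP
      map_smul' := TTHom.eval_smul P hP }
  map_id _ := rfl
  map_comp h f g := TTHom.eval_comp P hP h f g
  map_d h f := TTHom.eval_d P hP h f

/-- The object `c × d`. -/
def obj (c : C.Obj) (d : D.Obj) : (TT C D).Obj := (c, d)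

/-- The morphism `id_c ⊗ g`. -/
def right (c : C.Obj) {d d' : D.Obj} {n : ℤ} (g : D.Hom d d' n) :
    (TT C D).Hom (obj c d) (obj c d') n :=
  TTHom.mk (.right c g)

/-- The morphism `ε(f; g_1, …, g_N)`. -/
def eps {c c' : C.Obj} {p : ℤ} (f : C.Hom c c' p) {d d' : D.Obj} (gs : Chain D d d') :
    (TT C D).Hom (obj c d) (obj c' d') (p + gs.deg) :=
  TTHom.mk (.eps f gs)

/-- The generators of the twisted tensor product. -/
def univ (C D : DGCat k) : Pairing C D (TT C D) where
  obj := obj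
  right := right
  eps f _ _ gs := eps f gs

theorem lift_right (P : Pairing C D X) (hP : P.IsTwisted) (c : C.Obj) {d d' : D.Obj} {n : ℤ}
    (g : D.Hom d d' n) : (lift P hP).map (right c g) = P.right c g := rfl

theorem lift_eps (P : Pairing C D X) (hP : P.IsTwisted) {c c' : C.Obj} {p : ℤ} (f : C.Hom c c' p)
    {d d' : D.Obj} (gs : Chain D d d') : (lift P hP).map (eps f gs) = P.eps f d d' gs := rfl

/-- A dg functor out of the twisted tensor product is determined by its values on generators. -/
theorem map_ext {o : (TT C D).Obj → X.Obj} {F G : DGMap (TT C D) X o}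
    (h₁ : ∀ (c : C.Obj) {d d' : D.Obj} {n : ℤ} (g : D.Hom d d' n),
      F.map (right c g) = G.map (right c g))
    (h₂ : ∀ {c c' : C.Obj} {p : ℤ} (f : C.Hom c c' p) {d d' : D.Obj} (gs : Chain D d d'),
      F.map (eps f gs) = G.map (eps f gs)) : F = G := by
  have h : ∀ {x y : C.Obj × D.Obj} {n : ℤ} (s : TTTerm C D x y n),
      F.map (TTHom.mk s : (TT C D).Hom x y n) = G.map (TTHom.mk s : (TT C D).Hom x y n) := by
    intro x y n s
    induction s with
    | right c g => exact h₁ c g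
    | eps f gs => exact h₂ f gs
    | @zero x y n =>
      have h0 : ∀ x y : (TT C D).Obj, F.map (0 : (TT C D).Hom x y n) = G.map 0 := fun x y => by
        rw [map_zero, map_zero]
      exact h0 x y
    | @add x y n s t hs ht =>
      exact (map_add (F.map (x := x) (y := y) (n := n)) (TTHom.mk s) (TTHom.mk t)).trans
        ((congrArg₂ (· + ·) hs ht).trans
          (map_add (G.map (x := x) (y := y) (n := n)) (TTHom.mk s) (TTHom.mk t)).symm)
    | @smul x y n a s hs =>
      exact (map_smul (F.map (x := x) (y := y) (n := n)) a (TTHom.mk s)).trans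
        ((congrArg (a • ·) hs).trans
          (map_smul (G.map (x := x) (y := y) (n := n)) a (TTHom.mk s)).symm)
    | id x => exact (F.map_id x).trans (G.map_id x).symm
    | @comp x y z p q n h s t hs ht =>
      exact (F.map_comp (x := x) (y := y) (z := z) h (TTHom.mk s) (TTHom.mk t)).trans
        ((congrArg₂ (fun a b => X.comp h a b) hs ht).trans
          (G.map_comp (x := x) (y := y) (z := z) h (TTHom.mk s) (TTHom.mk t)).symm)
    | @d x y n m h s hs =>
      exact (F.map_d (x := x) (y := y) h (TTHom.mk s)).trans
        ((congrArg (fun a => X.d h a) hs).trans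
          (G.map_d (x := x) (y := y) h (TTHom.mk s)).symm)
  cases F with | mk mF _ _ _
  cases G with | mk mG _ _ _
  congr
  funext x y n
  ext f
  exact Quotient.inductionOn f fun s => h s

end TT

/-! ### Functoriality of the twisted tensor product -/

namespace Chain

variable {C D : DGCat k} {M : Type u} [AddCommGroup M] [Module k M]

theorem map_append (o : C.Obj → D.Obj)
    (φ : ∀ {x y : C.Obj} {n : ℤ}, C.Hom x y n → D.Hom (o x) (o y) n) {x y z : C.Obj}
    (l : Chain C y z) (r : Chain C x y) :
    (l.append r).map o φ = (l.map o φ).append (r.map o φ) := by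
  induction l with
  | nil => rfl
  | cons f l ih => simp only [cons_append, map, ih]

theorem sumCuts_map (o : C.Obj → D.Obj)
    (φ : ∀ {x y : C.Obj} {n : ℤ}, C.Hom x y n → D.Hom (o x) (o y) n) {x z : C.Obj}
    (c : Chain C x z) (ψ : Cut D (o x) (o z) → M) :
    (c.map o φ).sumCuts ψ =
      c.sumCuts fun s => ψ ⟨o s.mid, s.left.map o φ, s.right.map o φ⟩ := by
  induction c with
  | nil => simp only [map, sumCuts_nil]
  | cons f c ih => simp only [map, sumCuts_cons, ih]

theorem sumBar_map (G : DGFunctor C D) {x z : C.Obj} (c : Chain C x z)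
    (ψ : Chain D (G.obj x) (G.obj z) → M) :
    (c.map G.obj fun f => G.map f).sumBar ψ =
      c.sumBar fun c' => ψ (c'.map G.obj fun f => G.map f) := by
  induction c with
  | nil => simp only [map, sumBar_nil]
  | @cons y z n f c ih =>
    have h : sumHead (G.map f) (c.map G.obj fun f => G.map f) ψ =
        sumHead f c fun c' => ψ (c'.map G.obj fun f => G.map f) := by
      cases c with
      | nil => simp only [map, sumHead_nil]
      | @cons _ _ m g c =>
        simp only [map, sumHead_cons]
        rw [show G.map (C.comp rfl f g) = D.comp rfl (G.map f) (G.map g) from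
          G.toMap.map_comp rfl f g]
    simp only [map, sumBar_cons, ih, h]
    rw [show G.map (C.d rfl f) = D.d rfl (G.map f) from G.toMap.map_d rfl f]

end Chain

namespace PreCochain

variable {C D X Y : DGCat k} {F G H : D.Obj → X.Obj} {p q n m : ℤ}

/-- Postcomposition of a cochain with a dg functor. -/
def push (Φ : DGFunctor X Y) (A : PreCochain D X F G p) :
    PreCochain D Y (fun d => Φ.obj (F d)) (fun d => Φ.obj (G d)) p :=
  fun x y c => Φ.map (A x y c)

theorem push_conv (Φ : DGFunctor X Y) (A : PreCochain D X G H p) (B : PreCochain D X F G q) :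
    push Φ (conv n A B) = conv n (push Φ A) (push Φ B) := by
  funext x z c
  simp only [push, conv_apply, Chain.map_sumCuts, map_smul, Φ.map_compTo]

theorem push_bdry (Φ : DGFunctor X Y) (A : PreCochain D X F G p) :
    push Φ (bdry m A) = bdry m (push Φ A) := by
  funext x z c
  simp only [push, bdry_apply, map_sub, map_smul, Chain.map_sumBar, Φ.map_dTo, Φ.map_castTo]

theorem push_one (Φ : DGFunctor X Y) :
    push Φ (one F : PreCochain D X F F 0) = one fun d => Φ.obj (F d) := by
  funext x z c
  cases c with
  | nil => simp only [push, one_nil, Φ.map_castTo, Φ.map_id]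
  | cons f c => simp only [push, one_cons, map_zero]

theorem push_tau (Φ : DGFunctor X Y)
    (φ : ∀ {x y : D.Obj} {n : ℤ}, D.Hom x y n → X.Hom (F x) (F y) n) :
    push Φ (tau F φ) = tau (fun d => Φ.obj (F d)) fun f => Φ.map (φ f) := by
  funext x z c
  match c with
  | .nil => simp only [push, tau_nil, map_zero]
  | .cons f .nil => simp only [push, tau_cons_nil, Φ.map_castTo]
  | .cons f (.cons g c) => simp only [push, tau_cons_cons, map_zero]

theorem push_diff (Φ : DGFunctor X Y)
    (φ : ∀ {x y : D.Obj} {n : ℤ}, D.Hom x y n → X.Hom (G x) (G y) n)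
    (ψ : ∀ {x y : D.Obj} {n : ℤ}, D.Hom x y n → X.Hom (F x) (F y) n)
    (A : PreCochain D X F G p) :
    push Φ (diff φ ψ m A) = diff (F := fun d => Φ.obj (F d)) (G := fun d => Φ.obj (G d))
      (fun f => Φ.map (φ f)) (fun f => Φ.map (ψ f)) m (push Φ A) := by
  unfold diff
  rw [← push_bdry, ← push_tau, ← push_tau, ← push_conv, ← push_conv]
  funext x z c
  simp only [push, Pi.add_apply, Pi.sub_apply, Pi.smul_apply, map_add, map_sub, map_smul]

/-- Precomposition of a cochain with a dg functor. -/
def pull (Φ : DGFunctor C D) (A : PreCochain D X F G p) :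
    PreCochain C X (fun c => F (Φ.obj c)) (fun c => G (Φ.obj c)) p :=
  fun _ _ c => X.castTo (p + c.deg) (A _ _ (c.map Φ.obj fun f => Φ.map f))

theorem pull_conv (Φ : DGFunctor C D) (A : PreCochain D X G H p) (B : PreCochain D X F G q) :
    pull Φ (conv n A B) = conv n (pull Φ A) (pull Φ B) := by
  funext x z c
  simp only [pull, conv_apply, Chain.sumCuts_map, Chain.map_sumCuts, map_smul, Chain.deg_map]
  refine Chain.sumCuts_congr _ fun s _ => ?_
  rw [X.compTo_castTo_left _ (by simp), X.compTo_castTo_right _ (by simp)]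
  have e : ∀ {u v w : X.Obj} {a b m l : ℤ} (_ : m = l) (f : X.Hom v w a) (g : X.Hom u v b),
      X.castTo l (X.compTo m f g) = X.compTo l f g := by
    intro u v w a b m l h f g
    subst h
    exact X.castTo_self _
  exact congrArg _ (e (by simp) _ _)

theorem pull_bdry (Φ : DGFunctor C D) (A : PreCochain D X F G p) (h : p + 1 = m) :
    pull Φ (bdry m A) = bdry m (pull Φ A) := by
  funext x z c
  simp only [pull, bdry_apply, Chain.sumBar_map, Chain.map_sumBar, map_smul, map_sub]
  have e : ∀ {u v : X.Obj} {a m l : ℤ} (_ : m = l) (f : X.Hom u v a),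
      X.castTo l (X.dTo m f) = X.dTo l f := by
    intro u v a m l h f
    subst h
    exact X.castTo_self _
  rw [X.dTo_castTo _ (by simp)]
  congr 1
  · exact e (by simp) _
  · refine congrArg _ (Chain.sumBar_congr _ fun t ht => ?_)
    rw [X.castTo_castTo _ (by simp only [Chain.deg_map]; omega), X.castTo_castTo _ (by simp)]

theorem pull_one (Φ : DGFunctor C D) :
    pull Φ (one F : PreCochain D X F F 0) = one fun c => F (Φ.obj c) := by
  funext x z c
  cases c with
  | nil => exact X.castTo_self _
  | cons f c => exact map_zero _

theorem pull_tau (Φ : DGFunctor C D)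
    (φ : ∀ {x y : D.Obj} {n : ℤ}, D.Hom x y n → X.Hom (F x) (F y) n) :
    pull Φ (tau F φ) = tau (fun c => F (Φ.obj c)) fun f => φ (Φ.map f) := by
  funext x z c
  match c with
  | .nil => exact map_zero _
  | .cons f .nil => exact X.castTo_self _
  | .cons f (.cons g c) => exact map_zero _

theorem pull_diff (Φ : DGFunctor C D)
    (φ : ∀ {x y : D.Obj} {n : ℤ}, D.Hom x y n → X.Hom (G x) (G y) n)
    (ψ : ∀ {x y : D.Obj} {n : ℤ}, D.Hom x y n → X.Hom (F x) (F y) n)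
    (A : PreCochain D X F G p) (h : p + 1 = m) :
    pull Φ (diff φ ψ m A) = diff (F := fun c => F (Φ.obj c)) (G := fun c => G (Φ.obj c))
      (fun f => φ (Φ.map f)) (fun f => ψ (Φ.map f)) m (pull Φ A) := by
  unfold diff
  rw [← pull_bdry _ _ h, ← pull_tau, ← pull_tau, ← pull_conv, ← pull_conv]
  funext x z c
  simp only [pull, Pi.add_apply, Pi.sub_apply, Pi.smul_apply, map_add, map_sub, map_smul]

theorem pull_isReduced (Φ : DGFunctor C D) {A : PreCochain D X F G p} (hA : A.IsReduced) :
    (pull Φ A).IsReduced := by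
  have e : ∀ {u v : D.Obj} {c c' : Chain D u v} (N : ℤ), c = c' →
      X.castTo N (A u v c) = X.castTo N (A u v c') := fun N h => by rw [h]
  constructor
  · intro x y z w n l a b f g r
    have h : ∀ (N : ℤ) (f : C.Hom y z n),
        X.castTo N (A _ _ ((l.append (.cons f r)).map Φ.obj fun f => Φ.map f)) =
        X.castTo N (A _ _ ((l.map Φ.obj fun f => Φ.map f).append
          (.cons (Φ.map f) (r.map Φ.obj fun f => Φ.map f)))) :=
      fun N f => e N (by rw [Chain.map_append]; rfl)
    simp only [pull]
    rw [X.castTo_castTo _ (by simp), X.castTo_castTo _ (by simp)]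
    have h' := congrArg (X.castTo (p + (l.append (.cons (a • f + b • g) r)).deg))
      (hA.linear (l.map Φ.obj fun f => Φ.map f) a b (Φ.map f) (Φ.map g)
        (r.map Φ.obj fun f => Φ.map f))
    rw [map_add, map_smul, map_smul, X.castTo_castTo _ (by simp), X.castTo_castTo _ (by simp),
      ← map_smul Φ.map, ← map_smul Φ.map, ← map_add Φ.map] at h'
    rw [h, h, h, h']
  · intro x y w l r
    have h : ((l.append (.cons (C.id y) r)).map Φ.obj fun f => Φ.map f) =
        (l.map Φ.obj fun f => Φ.map f).append
          (.cons (D.id (Φ.obj y)) (r.map Φ.obj fun f => Φ.map f)) := by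
      rw [Chain.map_append]; simp only [Chain.map, Φ.map_id]
    refine (e _ h).trans ?_
    rw [hA.normalized, map_zero]

end PreCochain

namespace Pairing

variable {C D C' D' X : DGCat k}

/-- Precomposition of an interpretation of the generators with dg functors. -/
def comap (P : Pairing C' D' X) (F : DGFunctor C C') (G : DGFunctor D D') : Pairing C D X where
  obj c d := P.obj (F.obj c) (G.obj d)
  right c _ _ _ g := P.right (F.obj c) (G.map g)
  eps f := pull G (P.eps (F.map f))

theorem IsTwisted.comap {P : Pairing C' D' X} (hP : P.IsTwisted) (F : DGFunctor C C')
    (G : DGFunctor D D') : (P.comap F G).IsTwisted where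
  right_linear c {d d' n} a b g g' := by
    simp only [Pairing.comap, map_add, map_smul, hP.right_linear]
    rfl
  right_id c d := by simp only [Pairing.comap, G.map_id, hP.right_id]
  right_comp c {d d' d'' p q n} h g g' := by
    have := G.toMap.map_comp h g g'
    exact (congrArg _ this).trans (hP.right_comp _ h _ _)
  right_d c {d d' n m} h g := by
    have := G.toMap.map_d h g
    exact (congrArg _ this).trans (hP.right_d _ h _)
  eps_linear {c c' p} a b f f' := by
    simp only [Pairing.comap, map_add, map_smul, hP.eps_linear]
    funext x y e
    show X.castTo (p + e.deg) (a • _ + b • _) = a • X.castTo _ _ + b • X.castTo _ _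
    rw [map_add, map_smul, map_smul]
  eps_reduced f := pull_isReduced G (hP.eps_reduced _)
  eps_id c := by
    simp only [Pairing.comap, F.map_id, hP.eps_id]
    exact pull_one G
  eps_comp {c c' c'' p q n} h f₂ f₁ := by
    have := F.toMap.map_comp h f₂ f₁
    exact (congrArg (fun f => pull G (P.eps f)) this).trans
      ((congrArg (pull G) (hP.eps_comp h _ _)).trans (pull_conv G _ _))
  eps_d {c c' p m} h f := by
    have := F.toMap.map_d h f
    exact (congrArg (fun f => pull G (P.eps f)) this).trans
      ((congrArg (pull G) (hP.eps_d h _)).trans (pull_diff G _ _ _ h))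

end Pairing

namespace TT

variable {C D E C' D' : DGCat k}

/-- The generators of the twisted tensor product satisfy the defining relations. -/
theorem univ_isTwisted (C D : DGCat k) : (univ C D).IsTwisted where
  right_linear c {d d' n} a b g g' := TTHom.ext fun X P hP => hP.right_linear c a b g g'
  right_id c d := TTHom.ext fun X P hP => hP.right_id c d
  right_comp c {d d' d'' p q n} h g g' := TTHom.ext fun X P hP => hP.right_comp c h g g'
  right_d c {d d' n m} h g := TTHom.ext fun X P hP => hP.right_d c h g
  eps_linear {c c' p} a b f f' := by
    funext x y e
    refine TTHom.ext fun X P hP => ?_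
    exact congrFun (congrFun (congrFun (hP.eps_linear a b f f') x) y) e
  eps_reduced {c c' p} f := by
    constructor
    · intro x y z w n l a b g g' r
      refine TTHom.ext fun X P hP => ?_
      refine ((hP.eps_reduced f).linear l a b g g' r).trans ?_
      have h₁ := (lift P hP).functor.map_castTo (x := obj c x) (y := obj c' w)
        (p + (l.append (.cons (a • g + b • g') r)).deg) (eps f (l.append (.cons g r)))
      have h₂ := (lift P hP).functor.map_castTo (x := obj c x) (y := obj c' w)
        (p + (l.append (.cons (a • g + b • g') r)).deg) (eps f (l.append (.cons g' r)))
      exact ((TTHom.eval_add P hP _ _).trans (congrArg₂ (· + ·)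
        ((TTHom.eval_smul P hP a _).trans (congrArg (a • ·) h₁))
        ((TTHom.eval_smul P hP b _).trans (congrArg (b • ·) h₂)))).symm
    · intro x y w l r
      exact TTHom.ext fun X P hP => (hP.eps_reduced f).normalized l r
  eps_id c := by
    funext x y e
    refine TTHom.ext fun X P hP => ?_
    refine (congrFun (congrFun (congrFun (hP.eps_id c) x) y) e).trans ?_
    exact (congrFun (congrFun (congrFun (push_one (F := obj c) (lift P hP).functor) x) y) e).symm
  eps_comp {c c' c'' p q n} h f₂ f₁ := by
    funext x y e
    refine TTHom.ext fun X P hP => ?_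
    refine (congrFun (congrFun (congrFun (hP.eps_comp h f₂ f₁) x) y) e).trans ?_
    exact (congrFun (congrFun (congrFun (push_conv (lift P hP).functor ((univ C D).eps f₂)
      ((univ C D).eps f₁)) x) y) e).symm
  eps_d {c c' p m} h f := by
    funext x y e
    refine TTHom.ext fun X P hP => ?_
    refine (congrFun (congrFun (congrFun (hP.eps_d h f) x) y) e).trans ?_
    exact (congrFun (congrFun (congrFun (push_diff (lift P hP).functor (m := m)
      (fun g => (univ C D).right c' g) (fun g => (univ C D).right c g)
      ((univ C D).eps f)) x) y) e).symm

/-- The twisted tensor product of two dg functors; it sends `id_c ⊗ g` to `id_{F c} ⊗ G g` and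
`ε(f; g_1, …, g_N)` to `ε(F f; G g_1, …, G g_N)`. -/
def map (F : DGFunctor C C') (G : DGFunctor D D') : DGFunctor (TT C D) (TT C' D') where
  obj x := (F.obj x.1, G.obj x.2)
  toMap := lift ((univ C' D').comap F G) ((univ_isTwisted C' D').comap F G)

end TT

/-! ### Interleavings, the associator and the twisted composition -/

/-- For chains `g_N, …, g_1` in `D` and `h_M, …, h_1` in `E`, the formal sum of the chains obtained
by inserting each `g_i` exactly once, in the same order, in the form `ε(g_i; block)` for a possibly
empty block of consecutive `h_j`, the blocks being disjoint, and replacing each remaining `h_j` by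
`id ⊗ h_j`, taken at the current object of `D`. Each summand is recorded with the exponent
`∑ i, (|g_i| - 1) ∑ (|h_j| - 1)` of its sign, where, for each `i`, the inner sum is over all the
`h_j` applied after the block of `g_i`. -/
def Pairing.interleave {D E X : DGCat k} (P : Pairing D E X) {d : D.Obj} :
    {d' : D.Obj} → Chain D d d' → {e e' : E.Obj} → Chain E e e' →
      List (ℤ × Chain X (P.obj d e) (P.obj d' e'))
  | _, .nil, _, _, hs => [(0, hs.map (P.obj d) fun h => P.right d h)]
  | d', .cons g gs, _, _, hs =>
    hs.cuts.flatMap fun s => s.right.cuts.flatMap fun t =>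
      (P.interleave gs t.right).map fun r =>
        ((Chain.cons g gs).deg * s.left.deg + gs.deg * t.left.deg + r.1,
          (s.left.map (P.obj d') fun h => P.right d' h).append (.cons (P.eps g _ _ t.left) r.2))

/-- The evaluation of dg functors and coherent natural transformations. -/
def evalPairing (C D : DGCat k) : Pairing (Coh C D) C D where
  obj F c := F.obj c
  right F _ _ _ f := F.map f
  eps Ψ := Coh.val Ψ

/-- The one-sided associator `(C ⊗ D) ⊗ E ⟶ C ⊗ (D ⊗ E)` of the twisted tensor product, as
determined by its values on generators: `(c, d) ⊗ h ↦ c ⊗ (d ⊗ h)`,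
`ε(c ⊗ g; h_1, …, h_N) ↦ c ⊗ ε(g; h_1, …, h_N)`, and `ε(ε(f; g_1, …, g_M); h_1, …, h_N)` is sent to
the signed sum of all `ε(f; …)` over the interleavings of `g_1, …, g_M` and `h_1, …, h_N`. -/
structure IsAssociator {C D E : DGCat k}
    (α : DGMap (TT (TT C D) E) (TT C (TT D E)) fun x => TT.obj x.1.1 (TT.obj x.1.2 x.2)) : Prop where
  right : ∀ (c : C.Obj) (d : D.Obj) {e e' : E.Obj} {n : ℤ} (h : E.Hom e e' n),
    α.map (TT.right (C := TT C D) (TT.obj c d) h) = TT.right (D := TT D E) c (TT.right d h)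
  eps_right : ∀ (c : C.Obj) {d d' : D.Obj} {n : ℤ} (g : D.Hom d d' n) {e e' : E.Obj}
    (hs : Chain E e e'),
    α.map (TT.eps (C := TT C D) (TT.right c g) hs) = TT.right (D := TT D E) c (TT.eps g hs)
  eps_eps : ∀ {c c' : C.Obj} {p : ℤ} (f : C.Hom c c' p) {d d' : D.Obj} (gs : Chain D d d')
    {e e' : E.Obj} (hs : Chain E e e'),
    α.map (TT.eps (C := TT C D) (TT.eps f gs) hs) =
      (((TT.univ D E).interleave gs hs).map fun t => sgn k t.1 •
        (TT C (TT D E)).castTo (p + gs.deg + hs.deg)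
          (TT.eps (C := C) (D := TT D E) f t.2)).sum

/-- The twisted composition `Coh(B, C) ⊗ Coh(A, B) ⟶ Coh(A, C)`: on objects it is the composition of
dg functors; `id_G ⊗ Ψ` is sent to `G ∘ Ψ`, and `ε(Θ; Ψ_1, …, Ψ_N)` is sent to the coherent natural
transformation whose value on a chain is the signed sum of the values of `Θ` on all the
interleavings of `Ψ_1, …, Ψ_N` with the chain. In particular, `Θ ⊗ id_F = ε(Θ; )` is sent
to `Θ` precomposed with `F`. -/
structure IsTwistedComposition {A B C : DGCat k}
    (m : DGMap (TT (Coh B C) (Coh A B)) (Coh A C) fun x => DGFunctor.comp x.2 x.1) : Prop where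
  right : ∀ (G : DGFunctor B C) {F F' : DGFunctor A B} {n : ℤ} (Ψ : (Coh A B).Hom F F' n)
    {x y : A.Obj} (c : Chain A x y),
    Coh.val (m.map (TT.right (C := Coh B C) (D := Coh A B) G Ψ)) x y c =
      G.map (Coh.val Ψ x y c)
  eps : ∀ {G G' : DGFunctor B C} {p : ℤ} (Θ : (Coh B C).Hom G G' p) {F F' : DGFunctor A B}
    (Ψs : Chain (Coh A B) F F') {x y : A.Obj} (c : Chain A x y),
    Coh.val (m.map (TT.eps (C := Coh B C) (D := Coh A B) Θ Ψs)) x y c =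
      (((evalPairing A B).interleave Ψs c).map fun t => sgn k t.1 •
        C.castTo (p + Ψs.deg + c.deg) (Coh.val Θ (F.obj x) (F'.obj y) t.2)).sum

end Twisted

namespace Twisted

variable {k : Type u} [Field k]

/-! ### Sums over cuts and bar differentials of pairs of chains -/

/-! The proof takes place in bar coalgebras. Chains graded by `deg`, with deconcatenation (`cuts`)
and the differential `bar`, form the bar coalgebra of a dg category; `conv` is the convolution
product of cochains on it, and `diff` is the convolution differential twisted by the twisting
cochains `tau` of the two dg functors.

The relations of `Pairing.IsTwisted` for generators indexed by D and E with values in X say exactly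
that `ε` is a dg functor from D to `Coh E X` (`IsTwisted.curry`, `uncurry_isTwisted`). Hence dg
functors out of a twisted tensor product are obtained by uncurrying, and both constructions of the
theorem reduce to a single one, `IsTwisted.brace`: a twisted pairing P of D and E with values in Y
induces a dg functor from `Coh Y X` to `Coh D (Coh E X)`, which evaluates a cochain on all
interleavings of a D-chain with an E-chain. Taking for P the universal pairing of D and E and
precomposing with the curried universal pairing of C and `TT D E` gives the associator; taking for P
the evaluation of `Coh A B` on A gives the twisted composition.

The brace is a dg functor because the sum over interleavings is a map of dg coalgebras from Bar(D) ⊗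
Bar(E) to Bar(Y). It is the coalgebra map whose corestriction to single morphisms is `letter`, which
is `id ⊗ h` on one h alone, `ε(g; block)` on one g with a block, and zero on other pairs;
`sumInt_eq` is the resulting recursion. Compatibility with deconcatenation is `sumInt_sumCuts`.
Compatibility with the bar differentials (`IsTwisted.sumInt_sumBar`) follows from the Maurer–Cartan
equation `IsTwisted.letter_mc`, which repackages the defining relations. These two facts yield
`braceCochain_conv` and `braceCochain_diff`.

Uniqueness of the associator is `map_ext_left`: the relations for `ε(f; -)` reduce an arbitrary f in
`TT C D` to generators. The associativity square is checked on the same generators. Its only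
substantial case is `IsTwisted.sumInt_sumInt`: the two ways of interleaving three chains are
coalgebra maps out of a threefold tensor product with the same corestriction (`sumInt_letter`),
hence equal by induction on the total length. -/

theorem sgn_mul_self (n : ℤ) : sgn k n * sgn k n = 1 := by
  rw [← sgn_add, sgn_eq k (n := 0) (by simp), sgn_zero]

theorem sgn_smul_sgn_smul {M : Type*} [AddCommGroup M] [Module k M] (m n : ℤ) (x : M) :
    sgn k m • sgn k n • x = sgn k (m + n) • x := by
  rw [smul_smul, ← sgn_add]

namespace Chain

variable {C D E : DGCat k} {M : Type u} [AddCommGroup M] [Module k M]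

/-- The number of morphisms of a chain. -/
def length {x : C.Obj} : {y : C.Obj} → Chain C x y → ℕ
  | _, nil => 0
  | _, cons _ c => length c + 1

@[simp] theorem length_nil {x : C.Obj} : (nil : Chain C x x).length = 0 := rfl

@[simp] theorem length_cons {x y z : C.Obj} {n : ℤ} (f : C.Hom y z n) (c : Chain C x y) :
    (cons f c).length = c.length + 1 := rfl

@[simp] theorem length_append {x y z : C.Obj} (l : Chain C y z) (r : Chain C x y) :
    (l.append r).length = l.length + r.length := by
  induction l with
  | nil => simp
  | cons f l ih => simp [ih]; ring

theorem sumCuts_comm {x z : C.Obj} {x' z' : D.Obj} (c : Chain C x z) (c' : Chain D x' z')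
    (φ : Cut C x z → Cut D x' z' → M) :
    (c.sumCuts fun s => c'.sumCuts fun t => φ s t) =
      c'.sumCuts fun t => c.sumCuts fun s => φ s t := by
  simp only [sumCuts]
  induction c.cuts with
  | nil => simp
  | cons a l ih => simp [ih, List.sum_map_add]

theorem sumBar_sumCuts_comm {x z : C.Obj} {x' z' : D.Obj} (c : Chain C x z) (c' : Chain D x' z')
    (φ : Chain C x z → Cut D x' z' → M) :
    (c.sumBar fun s => c'.sumCuts fun t => φ s t) =
      c'.sumCuts fun t => c.sumBar fun s => φ s t := by
  simp only [sumCuts, sumBar]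
  induction c.bar with
  | nil => simp
  | cons a l ih =>
    simp only [List.map_cons, List.sum_cons, List.sum_map_add, ih]
    simp only [List.smul_sum, List.map_map, Function.comp_def]

/-- The signed sum over all simultaneous cuts of two chains. -/
def sumCuts₂ {d d' : D.Obj} {e e' : E.Obj} (gs : Chain D d d') (hs : Chain E e e')
    (ψ : ∀ (u : D.Obj) (v : E.Obj), Chain D u d' → Chain E v e' → Chain D d u → Chain E e v → M) :
    M :=
  gs.sumCuts fun s => hs.sumCuts fun t =>
    sgn k (s.right.deg * t.left.deg) • ψ s.mid t.mid s.left t.left s.right t.right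

/-- The signed sum over the bar differential of a pair of chains. -/
def sumBar₂ {d d' : D.Obj} {e e' : E.Obj} (gs : Chain D d d') (hs : Chain E e e')
    (φ : Chain D d d' → Chain E e e' → M) : M :=
  gs.sumBar (fun c => φ c hs) + sgn k gs.deg • hs.sumBar fun c => φ gs c

section

variable {d d' : D.Obj} {e e' : E.Obj} (gs : Chain D d d') (hs : Chain E e e')

theorem sumCuts₂_congr
    {ψ ψ' : ∀ (u : D.Obj) (v : E.Obj), Chain D u d' → Chain E v e' → Chain D d u → Chain E e v → M}
    (h : ∀ u v a b a' b', a.append a' = gs → b.append b' = hs →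
      ψ u v a b a' b' = ψ' u v a b a' b') : sumCuts₂ gs hs ψ = sumCuts₂ gs hs ψ' :=
  sumCuts_congr _ fun s hs => sumCuts_congr _ fun t ht => by rw [h _ _ _ _ _ _ hs ht]

theorem sumCuts₂_add
    (ψ ψ' : ∀ (u : D.Obj) (v : E.Obj), Chain D u d' → Chain E v e' → Chain D d u → Chain E e v → M) :
    (sumCuts₂ gs hs fun u v a b a' b' => ψ u v a b a' b' + ψ' u v a b a' b') =
      sumCuts₂ gs hs ψ + sumCuts₂ gs hs ψ' := by
  simp only [sumCuts₂, smul_add, sumCuts_add]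

theorem map_sumCuts₂ {N : Type u} [AddCommGroup N] [Module k N] (L : M →ₗ[k] N)
    (ψ : ∀ (u : D.Obj) (v : E.Obj), Chain D u d' → Chain E v e' → Chain D d u → Chain E e v → M) :
    L (sumCuts₂ gs hs ψ) = sumCuts₂ gs hs fun u v a b a' b' => L (ψ u v a b a' b') := by
  simp only [sumCuts₂, map_sumCuts, map_smul]

theorem sumCuts₂_zero
    {ψ : ∀ (u : D.Obj) (v : E.Obj), Chain D u d' → Chain E v e' → Chain D d u → Chain E e v → M}
    (h : ∀ u v a b a' b', a.append a' = gs → b.append b' = hs → ψ u v a b a' b' = 0) :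
    sumCuts₂ gs hs ψ = 0 :=
  sumCuts_zero _ fun s hs => sumCuts_zero _ fun t ht => by rw [h _ _ _ _ _ _ hs ht, smul_zero]

theorem sumBar₂_congr {φ ψ : Chain D d d' → Chain E e e' → M}
    (h : ∀ a b, a.deg + b.deg = gs.deg + hs.deg + 1 → φ a b = ψ a b) :
    sumBar₂ gs hs φ = sumBar₂ gs hs ψ := by
  unfold sumBar₂
  rw [sumBar_congr gs (φ := fun c => φ c hs) (ψ := fun c => ψ c hs)
      fun c hc => h _ _ (by rw [hc]; ring),
    sumBar_congr hs (φ := fun c => φ gs c) (ψ := fun c => ψ gs c) fun c hc => h _ _ (by rw [hc]; ring)]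

theorem map_sumBar₂ {N : Type u} [AddCommGroup N] [Module k N] (L : M →ₗ[k] N)
    (φ : Chain D d d' → Chain E e e' → M) :
    L (sumBar₂ gs hs φ) = sumBar₂ gs hs fun a b => L (φ a b) := by
  simp only [sumBar₂, map_add, map_smul, map_sumBar]

/-- Coassociativity of the deconcatenation of pairs of chains. -/
theorem sumCuts₂_sumCuts₂
    (φ : ∀ (u : D.Obj) (v : E.Obj) (u' : D.Obj) (v' : E.Obj), Chain D u' d' → Chain E v' e' →
      Chain D u u' → Chain E v v' → Chain D d u → Chain E e v → M) :
    (sumCuts₂ gs hs fun u v a b a' b' => sumCuts₂ a b fun u' v' l m l' m' =>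
      φ u v u' v' l m l' m' a' b') =
    sumCuts₂ gs hs fun u' v' l m a b => sumCuts₂ a b fun u v l' m' a' b' =>
      φ u v u' v' l m l' m' a' b' := by
  -- The exponent is the Koszul sign for regrouping (l, l', a'), (m, m', b') into (l, m), (l', m'),
  -- (a', b'): the piece a' moves past m and m', and l' moves past m. Both bracketings produce this
  -- same sign, so coassociativity can be applied in each variable separately.
  have h₁ := sumCuts_sumCuts gs fun u u' l l' a' =>
    hs.sumCuts fun t => t.left.sumCuts fun t' =>
      sgn k (a'.deg * t'.left.deg + a'.deg * t'.right.deg + l'.deg * t'.left.deg) •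
        φ u t.mid u' t'.mid l t'.left l' t'.right a' t.right
  have h₂ : ∀ (u u' : D.Obj) (l : Chain D u' d') (l' : Chain D u u') (a' : Chain D d u), _ :=
    fun u u' l l' a' => sumCuts_sumCuts hs fun v v' m m' b' =>
      sgn k (a'.deg * m.deg + a'.deg * m'.deg + l'.deg * m.deg) •
        φ u v u' v' l m l' m' a' b'
  simp only [h₂] at h₁
  refine Eq.trans ?_ (h₁.trans ?_)
  · refine sumCuts_congr _ fun s _ => ?_
    simp only [sumCuts₂, smul_sumCuts]
    rw [sumCuts_comm]
    refine sumCuts_congr _ fun s' hs' => ?_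
    rw [← h₂]
    refine sumCuts_congr _ fun t _ => sumCuts_congr _ fun t' ht' => ?_
    rw [sgn_smul_sgn_smul, ← ht', deg_append]
    congr 2; ring
  · refine sumCuts_congr _ fun s _ => ?_
    simp only [sumCuts₂, smul_sumCuts]
    rw [sumCuts_comm]
    refine sumCuts_congr _ fun t _ => sumCuts_congr _ fun s' hs' => sumCuts_congr _ fun t' ht' => ?_
    rw [sgn_smul_sgn_smul, ← hs', deg_append]
    congr 2; ring

/-- Compatibility of the bar differential of pairs of chains with deconcatenation. -/
theorem sumBar₂_sumCuts₂
    (ψ : ∀ (u : D.Obj) (v : E.Obj), Chain D u d' → Chain E v e' → Chain D d u → Chain E e v → M) :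
    (sumBar₂ gs hs fun c c' => sumCuts₂ c c' ψ) =
      sumCuts₂ gs hs fun u v a b a' b' => (sumBar₂ a b fun c c' => ψ u v c c' a' b') +
        sgn k (a.deg + b.deg) • sumBar₂ a' b' fun c c' => ψ u v a b c c' := by
  have h₁ := sumBar_sumCuts gs fun u a a' => hs.sumCuts fun t =>
    sgn k (a'.deg * t.left.deg) • ψ u t.mid a t.left a' t.right
  have h₂ : ∀ (u : D.Obj) (a : Chain D u d') (a' : Chain D d u), _ := fun u a a' =>
    sumBar_sumCuts hs fun v b b' => sgn k (a'.deg * b.deg) • ψ u v a b a' b'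
  have h₃ : (hs.sumBar fun c => sumCuts₂ gs c ψ) = gs.sumCuts fun s => hs.sumBar fun c =>
      c.sumCuts fun t =>
        sgn k (s.right.deg * t.left.deg) • ψ s.mid t.mid s.left t.left s.right t.right :=
    sumBar_sumCuts_comm ..
  simp only [h₂] at h₃
  rw [sumBar₂, h₃]
  refine (congrArg (· + _) h₁).trans ?_
  rw [smul_sumCuts, ← sumCuts_add]
  refine sumCuts_congr _ fun s hs' => ?_
  rw [sumBar_sumCuts_comm, sumBar_sumCuts_comm, smul_sumCuts, smul_sumCuts, ← sumCuts_add,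
    ← sumCuts_add]
  refine sumCuts_congr _ fun t ht => ?_
  -- Every term of a bar differential has degree one more than the chain it comes from, so the
  -- Koszul sign is constant along the sum and can be taken out of it.
  have e₁ : (s.right.sumBar fun r => sgn k (r.deg * t.left.deg) •
      ψ s.mid t.mid s.left t.left r t.right) = sgn k ((s.right.deg + 1) * t.left.deg) •
        s.right.sumBar fun r => ψ s.mid t.mid s.left t.left r t.right := by
    rw [smul_sumBar]
    exact sumBar_congr _ fun r hr => by rw [hr]
  have e₂ : (t.left.sumBar fun l => sgn k (s.right.deg * l.deg) •
      ψ s.mid t.mid s.left l s.right t.right) = sgn k (s.right.deg * (t.left.deg + 1)) •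
        t.left.sumBar fun l => ψ s.mid t.mid s.left l s.right t.right := by
    rw [smul_sumBar]
    exact sumBar_congr _ fun r hr => by rw [hr]
  rw [e₁, e₂, ← hs', deg_append, ← smul_sumBar, ← smul_sumBar]
  simp only [sumBar₂, smul_add, smul_smul, mul_add, add_mul, one_mul, mul_one, sgn_add, ← mul_assoc]
  have hr := sgn_mul_self (k := k) s.right.deg
  -- The one nontrivial cancellation is in the term where b is differentiated: the sign of the
  -- D-piece a' occurs twice, once from `gs.deg` and once from the shifted Koszul sign.
  match_scalars <;> first | ring1 | linear_combination (sgn k s.left.deg * sgn k (s.right.deg * t.left.deg)) * hr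

end

end Chain
end Twisted

namespace Twisted

variable {k : Type u} [Field k]

open PreCochain

/-! ### Sums over interleavings -/

namespace Chain

variable {C D E : DGCat k} {M : Type u} [AddCommGroup M] [Module k M]

/-- A multilinear functional as a linear function of the last applied morphism. -/
def IsLin.headMap {x y z : C.Obj} {φ : Chain C x z → M} (h : IsLin φ) {n : ℤ} (c : Chain C x y) :
    C.Hom y z n →ₗ[k] M where
  toFun f := φ (cons f c)
  map_add' f g := by simpa using h.head 1 1 f g c
  map_smul' a f := by simpa using h.head a 0 f 0 c

theorem IsLin.headMap_apply {x y z : C.Obj} {φ : Chain C x z → M} (h : IsLin φ) {n : ℤ}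
    (c : Chain C x y) (f : C.Hom y z n) : h.headMap c f = φ (cons f c) := rfl

theorem IsLin.map {N : Type u} [AddCommGroup N] [Module k N] (L : M →ₗ[k] N) {x z : C.Obj}
    {φ : Chain C x z → M} (hφ : IsLin φ) : IsLin fun c => L (φ c) :=
  ⟨fun l a b f g r => by rw [hφ.lin]; simp⟩

theorem IsLin.smul_deg {x z : C.Obj} {φ : Chain C x z → M} (hφ : IsLin φ) (s : ℤ → k) :
    IsLin fun c => s c.deg • φ c :=
  ⟨fun l a b f g r => by rw [hφ.lin]; simp only [deg_append, deg_cons]; module⟩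

theorem IsLin.append_left {x y z : C.Obj} {φ : Chain C x z → M} (hφ : IsLin φ)
    (l : Chain C y z) : IsLin fun c => φ (l.append c) :=
  ⟨fun l' a b f g r => by simp only [← append_assoc, hφ.lin]⟩

theorem IsLin.append_right {x y z : C.Obj} {φ : Chain C x z → M} (hφ : IsLin φ)
    (r : Chain C x y) : IsLin fun c => φ (c.append r) :=
  ⟨fun l' a b f g r => by simp only [append_assoc, cons_append, hφ.lin]⟩

theorem sumCuts_first {x z : C.Obj} (c : Chain C x z)
    (φ : ∀ y : C.Obj, Chain C y z → Chain C x y → M)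
    (h : ∀ v y (n : ℤ) (f : C.Hom v z n) (l : Chain C y v) r, φ y (cons f l) r = 0) :
    (c.sumCuts fun s => φ s.mid s.left s.right) = φ z nil c := by
  cases c with
  | nil => rw [sumCuts_nil]
  | cons f c => rw [sumCuts_cons, sumCuts_zero _ fun s _ => h .., add_zero]

/-- Isolates the cut whose left piece is a single morphism. It applies to cuts along which a letter
without D-entry is evaluated, since such a letter is supported on chains of length one. -/
theorem sumCuts_single {x y z : C.Obj} {n : ℤ} (f : C.Hom y z n) (c : Chain C x y)
    (φ : ∀ y : C.Obj, Chain C y z → Chain C x y → M) (h₀ : ∀ r, φ z nil r = 0)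
    (h₂ : ∀ u v w (n m : ℤ) (f : C.Hom v z n) (g : C.Hom u v m) (l : Chain C w u) r,
      φ w (cons f (cons g l)) r = 0) :
    ((cons f c).sumCuts fun s => φ s.mid s.left s.right) = φ y (cons f nil) c := by
  rw [sumCuts_cons, h₀, zero_add, sumCuts_first c fun y l r => φ y (cons f l) r]
  intro v y n g l r
  exact h₂ ..

end Chain

namespace Pairing

open Chain

variable {D E X : DGCat k} {M : Type u} [AddCommGroup M] [Module k M] (P : Pairing D E X)
  {d d' : D.Obj} {e e' : E.Obj}

/-- The signed sum of the values of a functional over all interleavings of two chains. -/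
def sumInt (gs : Chain D d d') (hs : Chain E e e')
    (φ : Chain X (P.obj d e) (P.obj d' e') → M) : M :=
  ((P.interleave gs hs).map fun t => sgn k t.1 • φ t.2).sum

/-- The chain `id ⊗ h_N, …, id ⊗ h_1`. -/
abbrev rightChain (d : D.Obj) (hs : Chain E e e') : Chain X (P.obj d e) (P.obj d e') :=
  hs.map (P.obj d) fun h => P.right d h

theorem sumInt_nil (hs : Chain E e e') (φ : Chain X (P.obj d e) (P.obj d e') → M) :
    P.sumInt .nil hs φ = φ (P.rightChain d hs) := by
  simp [sumInt, interleave, sgn_zero]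

/-- The piece `s.left` consists of the h to the left of the block of g, `t.left` is that block, and
`t.right` is interleaved with the remaining D-entries. Accordingly all D-entries contribute a sign
with `s.left`, while only those of `gs` contribute one with `t.left`. -/
theorem sumInt_cons {d'' : D.Obj} {n : ℤ} (g : D.Hom d' d'' n) (gs : Chain D d d')
    (hs : Chain E e e') (φ : Chain X (P.obj d e) (P.obj d'' e') → M) :
    P.sumInt (.cons g gs) hs φ = hs.sumCuts fun s => s.right.sumCuts fun t =>
      sgn k ((cons g gs).deg * s.left.deg + gs.deg * t.left.deg) •
        P.sumInt gs t.right fun c =>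
          φ ((P.rightChain d'' s.left).append (.cons (P.eps g _ _ t.left) c)) := by
  simp only [sumInt, interleave, sumCuts, List.flatMap, List.map_flatten, List.sum_flatten,
    List.map_map, Function.comp_def, List.smul_sum, sgn_smul_sgn_smul]

section

variable (gs : Chain D d d') (hs : Chain E e e')

theorem sumInt_add (φ ψ : Chain X (P.obj d e) (P.obj d' e') → M) :
    (P.sumInt gs hs fun c => φ c + ψ c) = P.sumInt gs hs φ + P.sumInt gs hs ψ := by
  simp [sumInt, List.sum_map_add]

theorem map_sumInt {N : Type u} [AddCommGroup N] [Module k N] (L : M →ₗ[k] N)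
    (φ : Chain X (P.obj d e) (P.obj d' e') → M) :
    L (P.sumInt gs hs φ) = P.sumInt gs hs fun c => L (φ c) := by
  simp [sumInt, map_list_sum, Function.comp_def]

theorem smul_sumInt (r : k) (φ : Chain X (P.obj d e) (P.obj d' e') → M) :
    r • P.sumInt gs hs φ = P.sumInt gs hs fun c => r • φ c :=
  P.map_sumInt gs hs (r • LinearMap.id) φ

theorem sumInt_zero : (P.sumInt gs hs fun _ => (0 : M)) = 0 := by
  simp [sumInt]

theorem sumInt_sumCuts_comm {C : DGCat k} {x z : C.Obj} (c : Chain C x z)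
    (φ : Chain X (P.obj d e) (P.obj d' e') → Cut C x z → M) :
    (P.sumInt gs hs fun b => c.sumCuts fun s => φ b s) =
      c.sumCuts fun s => P.sumInt gs hs fun b => φ b s := by
  simp only [sumCuts, sumInt]
  induction P.interleave gs hs with
  | nil => simp
  | cons a l ih =>
    simp only [List.map_cons, List.sum_cons, List.sum_map_add, ih]
    simp only [List.smul_sum, List.map_map, Function.comp_def]

/-- An entry `ε(g; block)` contributes `|g| - 1` plus the degree of the block, so every interleaving
has degree `gs.deg + hs.deg`. Hence degree casts may be rewritten under the sum with this equation
at hand. -/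
theorem sumInt_congr {φ ψ : Chain X (P.obj d e) (P.obj d' e') → M}
    (h : ∀ c, c.deg = gs.deg + hs.deg → φ c = ψ c) : P.sumInt gs hs φ = P.sumInt gs hs ψ := by
  induction gs generalizing e e' hs with
  | nil => rw [sumInt_nil, sumInt_nil, h]; simp
  | cons g gs ih =>
    rw [sumInt_cons, sumInt_cons]
    refine sumCuts_congr _ fun s hs => sumCuts_congr _ fun t ht => ?_
    congr 1
    refine ih _ fun c hc => h _ ?_
    rw [← hs, ← ht]
    simp [hc]
    ring

theorem isLin_sumInt {C : DGCat k} {x z : C.Obj}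
    {φ : Chain C x z → Chain X (P.obj d e) (P.obj d' e') → M} (h : ∀ b, IsLin fun c => φ c b) :
    IsLin fun c => P.sumInt gs hs fun b => φ c b :=
  ⟨fun l a b f g r => by simp only [(h _).lin, sumInt_add, smul_sumInt]⟩

end

/-- The component of the sum over interleavings with values in single morphisms. -/
def letter (gs : Chain D d d') (hs : Chain E e e') :
    X.Hom (P.obj d e) (P.obj d' e') (1 + (gs.deg + hs.deg)) :=
  match gs with
  | .nil => X.castTo _ (tau (P.obj d) (fun h => P.right d h) e e' hs)
  | .cons g .nil => X.castTo _ (P.eps g e e' hs)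
  | .cons _ (.cons _ _) => 0

theorem letter_nil (hs : Chain E e e') : P.letter (.nil : Chain D d d) hs =
    X.castTo _ (tau (P.obj d) (fun h => P.right d h) e e' hs) := rfl

theorem letter_nil_nil : P.letter (.nil : Chain D d d) (.nil : Chain E e e) = 0 :=
  map_zero _

theorem letter_nil_cons_nil {n : ℤ} (h : E.Hom e e' n) :
    P.letter (.nil : Chain D d d) (.cons h .nil) = X.castTo _ (P.right d h) := by
  rw [letter_nil, tau_cons_nil, X.castTo_castTo _ (by simp)]

theorem letter_nil_cons_cons {e'' e''' : E.Obj} {n m : ℤ} (h : E.Hom e'' e''' n)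
    (h' : E.Hom e' e'' m) (hs : Chain E e e') :
    P.letter (.nil : Chain D d d) (.cons h (.cons h' hs)) = 0 :=
  map_zero _

theorem letter_single {n : ℤ} (g : D.Hom d d' n) (hs : Chain E e e') :
    P.letter (.cons g .nil) hs = X.castTo _ (P.eps g e e' hs) := rfl

theorem letter_cons_cons {d'' d''' : D.Obj} {n m : ℤ} (g : D.Hom d'' d''' n)
    (g' : D.Hom d' d'' m) (gs : Chain D d d') (hs : Chain E e e') :
    P.letter (.cons g (.cons g' gs)) hs = 0 := rfl

/-- The value of a functional on the empty chain if both chains are empty, and `0` otherwise. -/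
def nilPart : ∀ {d d' : D.Obj} (_ : Chain D d d') {e e' : E.Obj} (_ : Chain E e e'),
    (Chain X (P.obj d e) (P.obj d' e') → M) → M
  | _, _, .nil, _, _, .nil, φ => φ .nil
  | _, _, .nil, _, _, .cons _ _, _ => 0
  | _, _, .cons _ _, _, _, _, _ => 0

/-- The left counit law for the coalgebra of pairs of chains, `nilPart` being the counit: only the
cut with both left pieces empty survives, and its sign is trivial. -/
theorem sumCuts₂_nilPart (gs : Chain D d d') (hs : Chain E e e')
    (φ : ∀ u v, Chain X (P.obj u v) (P.obj d' e') → Chain D d u → Chain E e v → M) :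
    (sumCuts₂ gs hs fun u v a b a' b' => P.nilPart a b fun c => φ u v c a' b') =
      φ d' e' .nil gs hs := by
  refine (sumCuts_first gs (fun u a a' => hs.sumCuts fun t => sgn k (a'.deg * t.left.deg) •
    P.nilPart a t.left fun c => φ u t.mid c a' t.right) ?_).trans
    ((sumCuts_first hs (fun v b b' => sgn k (gs.deg * b.deg) •
      P.nilPart (.nil : Chain D d' d') b fun c => φ d' v c gs b') ?_).trans ?_)
  · intro v y n f l r
    exact sumCuts_zero _ fun t _ => smul_zero _
  · intro v y n f l r
    exact smul_zero _
  · show sgn k (gs.deg * 0) • φ d' e' .nil gs hs = _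
    rw [mul_zero, sgn_zero, one_smul]

/-- The sum over interleavings, expanded with respect to the last applied morphism. -/
theorem sumInt_eq (gs : Chain D d d') (hs : Chain E e e')
    {φ : Chain X (P.obj d e) (P.obj d' e') → M} (hφ : IsLin φ) :
    P.sumInt gs hs φ = P.nilPart gs hs φ + sumCuts₂ gs hs fun _ _ a b a' b' =>
      P.sumInt a' b' fun c => φ (.cons (P.letter a b) c) := by
  -- A letter without D-entry is zero unless its E-chain is a single h, where it is `id ⊗ h`. The
  -- sum over cuts therefore has a single surviving term.
  have key : ∀ {d e} (gs : Chain D d d') {e₁ : E.Obj} {n : ℤ} (h : E.Hom e₁ e' n)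
      (hs : Chain E e e₁) (φ : Chain X (P.obj d e) (P.obj d' e') → M) (_ : IsLin φ),
      ((cons h hs).sumCuts fun t => sgn k (gs.deg * t.left.deg) •
        P.sumInt gs t.right fun c => φ (.cons (P.letter (.nil : Chain D d' d') t.left) c)) =
      sgn k (gs.deg * (n - 1)) • P.sumInt gs hs fun c => φ (.cons (P.right d' h) c) := by
    intro d e gs e₁ n h hs φ hφ
    rw [sumCuts_single h hs fun v b b' => sgn k (gs.deg * b.deg) • P.sumInt gs b' fun c =>
      φ (.cons (P.letter (.nil : Chain D d' d') b) c)]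
    · rw [letter_nil_cons_nil]
      simp only [deg_cons, deg_nil, add_zero]
      congr 1
      refine P.sumInt_congr _ _ fun c _ => ?_
      exact cons_castTo (by simp) _ _ φ
    · intro b'
      simp only [letter_nil_nil, hφ.head_zero, sumInt_zero, smul_zero]
    · intro u v w n m f g l r
      simp only [letter_nil_cons_cons, hφ.head_zero, sumInt_zero, smul_zero]
  have e₀ : ∀ {e : E.Obj} (gs : Chain D d d') (φ : Chain X (P.obj d e) (P.obj d' e) → M)
      (_ : IsLin φ), ((nil : Chain E e e).sumCuts fun t => sgn k (gs.deg * t.left.deg) •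
        P.sumInt gs t.right fun c => φ (.cons (P.letter (.nil : Chain D d' d') t.left) c)) = 0 := by
    intro e gs φ hφ
    rw [sumCuts_nil]
    simp only [letter_nil_nil, hφ.head_zero, sumInt_zero, smul_zero]
  cases gs with
  | nil =>
    rw [sumCuts₂, sumCuts_nil]
    cases hs with
    | nil => rw [e₀ _ _ hφ, sumInt_nil, add_zero]; rfl
    | cons h hs =>
      rw [key _ _ _ _ hφ, sumInt_nil, sumInt_nil, deg_nil, zero_mul, sgn_zero, one_smul]
      exact (zero_add _).symm
  | @cons d₁ _ n g gs =>
    -- The leftmost entry of an interleaving is either `id ⊗ h` for the leftmost h, or `ε(g; block)`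
    -- with the block at the very left end. These correspond to the cuts of `cons g gs` with left
    -- piece empty and with left piece g; longer left pieces carry a zero letter.
    have e₁ : P.sumInt (.cons g gs) hs φ =
        ((hs.sumCuts fun t => sgn k ((cons g gs).deg * t.left.deg) • P.sumInt (cons g gs) t.right
          fun c => φ (.cons (P.letter (.nil : Chain D d' d') t.left) c))) +
        hs.sumCuts fun t => sgn k (gs.deg * t.left.deg) •
          P.sumInt gs t.right fun c => φ (.cons (P.eps g _ _ t.left) c) := by
      rw [sumInt_cons]
      cases hs with
      | nil =>
        rw [e₀ _ _ hφ, zero_add, sumCuts_nil]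
        refine sumCuts_congr _ fun t _ => ?_
        simp only [deg_nil, mul_zero, zero_add]
        rfl
      | @cons e₁ _ m h hs =>
        rw [key _ _ _ _ hφ, sumCuts_cons, add_comm]
        congr 1
        · rw [sumInt_cons, smul_sumCuts]
          refine sumCuts_congr _ fun s _ => ?_
          rw [smul_sumCuts]
          refine sumCuts_congr _ fun t _ => ?_
          rw [sgn_smul_sgn_smul]
          simp only [deg_cons]
          congr 2
          ring
        · refine sumCuts_congr _ fun t _ => ?_
          simp only [deg_nil, mul_zero, zero_add]
          rfl
    rw [e₁, sumCuts₂, sumCuts_cons]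
    refine Eq.trans ?_ (zero_add _).symm
    congr 1
    rw [sumCuts_first gs fun u a a' => hs.sumCuts fun t => sgn k (a'.deg * t.left.deg) •
      P.sumInt a' t.right fun c => φ (.cons (P.letter (.cons g a) t.left) c)]
    · refine sumCuts_congr _ fun t ht => ?_
      congr 1
      refine P.sumInt_congr _ _ fun c _ => ?_
      rw [letter_single]
      exact (cons_castTo (by simp; ring) _ _ φ).symm
    · intro v y n f l r
      simp only [letter_cons_cons, hφ.head_zero, sumInt_zero, smul_zero, sumCuts_zero, implies_true]

/-- The sum over interleavings is compatible with deconcatenation. -/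
theorem sumInt_sumCuts (gs : Chain D d d') (hs : Chain E e e')
    (ψ : ∀ y, Chain X y (P.obj d' e') → Chain X (P.obj d e) y → M)
    (hl : ∀ y r, IsLin fun l => ψ y l r) (hr : ∀ y l, IsLin fun r => ψ y l r) :
    (P.sumInt gs hs fun c => c.sumCuts fun s => ψ s.mid s.left s.right) =
      sumCuts₂ gs hs fun _ _ a b a' b' => P.sumInt a b fun l => P.sumInt a' b' fun r => ψ _ l r := by
  -- Induction on the total length: once a nonzero letter is split off, the remaining pair of chains
  -- is strictly shorter.
  obtain ⟨N, hN⟩ : ∃ N, gs.length + hs.length ≤ N := ⟨_, le_rfl⟩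
  induction N generalizing d d' e e' with
  | zero =>
    cases gs with
    | cons g gs => simp at hN
    | nil =>
      cases hs with
      | cons g gs => simp at hN
      | nil => simp [sumInt_nil, sumCuts₂, Chain.map, sumCuts_nil, sgn_zero]
  | succ N ih =>
    have e₁ := P.sumInt_eq gs hs (hr _ nil)
    rw [P.sumInt_eq gs hs (sumCuts_isLin ψ hl hr)]
    have e₂ : (P.nilPart gs hs fun c => c.sumCuts fun s => ψ s.mid s.left s.right) =
        P.nilPart gs hs fun c => ψ _ nil c := by
      cases gs <;> cases hs <;> simp [nilPart, sumCuts_nil]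
    -- A cut of a chain with head letter either has empty left piece or has the letter in its left
    -- piece. The second kind amounts to a cut of the tail, to which the induction hypothesis
    -- applies.
    have e₃ : (sumCuts₂ gs hs fun u v a b a' b' => P.sumInt a' b' fun c =>
        (cons (P.letter a b) c).sumCuts fun s => ψ s.mid s.left s.right) =
        (sumCuts₂ gs hs fun u v a b a' b' => P.sumInt a' b' fun c =>
          ψ _ nil (cons (P.letter a b) c)) +
        sumCuts₂ gs hs fun u v a b a' b' => sumCuts₂ a' b' fun u' v' m m' r r' =>
          P.sumInt m m' fun l => P.sumInt r r' fun c => ψ _ (cons (P.letter a b) l) c := by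
      rw [← sumCuts₂_add]
      refine sumCuts₂_congr _ _ fun u v a b a' b' ha hb => ?_
      simp only [sumCuts_cons, sumInt_add]
      congr 1
      -- If both a and b are empty the remaining pair is not shorter, but then the letter is zero
      -- and both sides vanish.
      by_cases h0 : 0 < a.length + b.length
      · refine ih a' b' (fun y l r => ψ y (cons (P.letter a b) l) r) (fun y r => (hl y r).tail _)
          (fun y l => hr y _) ?_
        rw [← ha, ← hb, length_append, length_append] at hN
        omega
      · cases a with
        | cons g gs => simp at h0
        | nil =>
          cases b with
          | cons g gs => simp at h0
          | nil =>
            have h₁ : ∀ {w y : X.Obj} {n : ℤ} (l : Chain X y w) (r : Chain X (P.obj d e) y),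
                ψ y (cons (0 : X.Hom w (P.obj d' e') n) l) r = 0 := fun l r => (hl _ r).head_zero l
            simp only [letter_nil_nil, h₁, sumInt_zero]
            rw [sumCuts₂_zero _ _ fun _ _ _ _ _ _ _ _ => rfl]
            simp only [sumCuts, List.map_const', List.sum_replicate, smul_zero, sumInt_zero]
    -- The terms with empty left piece recombine by e₁ into a sum over all interleavings. In the
    -- others, coassociativity moves the head letter into the left pair, where `sumInt_eq` is read
    -- backwards; the counit law e₄ supplies the missing `nilPart`.
    rw [e₂, e₃, ← add_assoc, ← e₁, ← sumCuts₂_sumCuts₂ gs hs fun u v u' v' a b m m' r r' =>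
          P.sumInt m m' fun l => P.sumInt r r' fun c => ψ _ (cons (P.letter a b) l) c]
    have e₄ := P.sumCuts₂_nilPart gs hs fun u v l a' b' => P.sumInt a' b' fun r => ψ _ l r
    rw [← e₄, ← sumCuts₂_add]
    refine sumCuts₂_congr _ _ fun u v a b a' b' ha hb => ?_
    exact (P.sumInt_eq a b (P.isLin_sumInt a' b' fun r => hl _ r)).symm

end Pairing
end Twisted

/-! ### The Maurer–Cartan equation and the bar differential of interleavings. -/

namespace Twisted

variable {k : Type u} [Field k]

open PreCochain

namespace Chain

variable {C : DGCat k} {M : Type u} [AddCommGroup M] [Module k M]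

theorem sumHead_isLin {x y z : C.Obj} {n : ℤ} (f : C.Hom y z n) {φ : Chain C x z → M}
    (hφ : IsLin φ) : IsLin fun c : Chain C x y => sumHead f c φ := by
  refine ⟨fun l a b g g' r => ?_⟩
  cases l with
  | nil =>
    simp only [nil_append, sumHead_cons, map_add, map_smul, hφ.head]
    module
  | cons h l =>
    have h3 := hφ.lin (cons (C.comp rfl f h) l) a b g g' r
    simp only [cons_append] at h3
    simp only [cons_append, sumHead_cons, h3]
    module

theorem sumCuts_const_zero {x z : C.Obj} (c : Chain C x z) : (c.sumCuts fun _ => (0 : M)) = 0 :=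
  sumCuts_zero c fun _ _ => rfl

theorem sumBar_const_zero {x z : C.Obj} (c : Chain C x z) : (c.sumBar fun _ => (0 : M)) = 0 :=
  sumBar_zero c fun _ _ => rfl

/-- The bar differential of a nonempty chain consists of nonempty chains only, since multiplying two
neighbours still leaves an entry. -/
theorem sumBar_eq_zero {x y z : C.Obj} {n : ℤ} (f : C.Hom y z n) (c : Chain C x y)
    {φ : Chain C x z → M} (h : ∀ {y : C.Obj} {n : ℤ} (f : C.Hom y z n) (c : Chain C x y),
      φ (cons f c) = 0) : (cons f c).sumBar φ = 0 := by
  rw [sumBar_cons, h, neg_zero, zero_add, sumBar_zero _ fun _ _ => h .., smul_zero, zero_add]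
  cases c with
  | nil => rw [sumHead_nil]
  | cons g c => rw [sumHead_cons, h, smul_zero]

end Chain

namespace PreCochain

variable {C D : DGCat k} {F G H : C.Obj → D.Obj} {p q n m : ℤ} {x z : C.Obj}

/-- With the cast pushed inside, all summands lie in one Hom space of fixed degree N, instead of a
space depending on the chain. -/
theorem castTo_conv {N : ℤ} (A : PreCochain C D G H p) (B : PreCochain C D F G q) (c : Chain C x z)
    (h : n + c.deg = N) : D.castTo N (conv n A B x z c) =
      c.sumCuts fun s => sgn k (q * s.left.deg) •
        D.compTo N (A s.mid z s.left) (B x s.mid s.right) := by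
  subst h
  rw [D.castTo_self, conv_apply]

theorem castTo_bdry {N : ℤ} (A : PreCochain C D F G p) (c : Chain C x z) (h : m + c.deg = N) :
    D.castTo N (bdry m A x z c) = D.dTo N (A x z c) -
      sgn k p • c.sumBar fun t => D.castTo N (A x z t) := by
  subst h
  rw [D.castTo_self, bdry_apply]

theorem castTo_diff {N : ℤ} (φ : ∀ {x y : C.Obj} {n : ℤ}, C.Hom x y n → D.Hom (G x) (G y) n)
    (ψ : ∀ {x y : C.Obj} {n : ℤ}, C.Hom x y n → D.Hom (F x) (F y) n)
    (A : PreCochain C D F G p) (c : Chain C x z) (h : m + c.deg = N) :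
    D.castTo N (diff φ ψ m A x z c) =
      (D.dTo N (A x z c) - sgn k p • c.sumBar fun t => D.castTo N (A x z t)) +
      (c.sumCuts fun s => sgn k (p * s.left.deg) •
        D.compTo N (tau G φ s.mid z s.left) (A x s.mid s.right)) -
      sgn k p • c.sumCuts fun s => sgn k (1 * s.left.deg) •
        D.compTo N (A s.mid z s.left) (tau F ψ x s.mid s.right) := by
  subst h
  rw [D.castTo_self]
  rfl

end PreCochain

namespace Pairing

open Chain

variable {D E X : DGCat k} {M : Type u} [AddCommGroup M] [Module k M]

/-- The dg functor `id_c ⊗ -` of a twisted pairing. -/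
def IsTwisted.rightFunctor {P : Pairing D E X} (hP : P.IsTwisted) (d : D.Obj) :
    DGFunctor E X where
  obj := P.obj d
  toMap :=
    { map :=
        { toFun := P.right d
          map_add' := fun g g' => by simpa using hP.right_linear d 1 1 g g'
          map_smul' := fun a g => by simpa using hP.right_linear d a 0 g 0 }
      map_id := hP.right_id d
      map_comp := hP.right_comp d
      map_d := hP.right_d d }

/-- The component with values in single morphisms of the interleaving map is a twisting cochain. -/
theorem IsTwisted.letter_mc {P : Pairing D E X} (hP : P.IsTwisted) (N : ℤ) {d d' : D.Obj}
    {e e' : E.Obj} (gs : Chain D d d') (hs : Chain E e e') :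
    (sumCuts₂ gs hs fun _ _ a b a' b' => sgn k (1 + (a.deg + b.deg)) •
      X.compTo N (P.letter a b) (P.letter a' b')) - X.dTo N (P.letter gs hs) =
    sumBar₂ gs hs fun c c' => X.castTo N (P.letter c c') := by
  -- Every term naturally has degree `2 + (gs.deg + hs.deg)`; for any other N all casts,
  -- compositions and differentials vanish by convention.
  by_cases hN : 2 + (gs.deg + hs.deg) = N
  swap
  · rw [sumCuts₂_zero, X.dTo_of_ne (by omega), sumBar₂_congr (ψ := fun _ _ => 0)]
    · simp [sumBar₂, sumBar]
    · intro a b h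
      rw [X.castTo_of_ne (by omega)]
    · intro u v a b a' b' ha hb
      rw [X.compTo_of_ne, smul_zero]
      rw [← ha, ← hb, deg_append, deg_append] at hN
      omega
  -- The length of `gs` selects the relation: for length 0 it is the Maurer–Cartan equation of the
  -- dg functor `id ⊗ -`, for length 1 the formula for `ε(dg; -)`, for length 2 the formula for `ε(g
  -- g'; -)`. From length 3 on everything vanishes, as a product of two nonzero letters uses at most
  -- two D-entries and the bar differential shortens a chain by at most one.
  match gs with
  | .nil =>
    simp only [deg_nil, zero_add] at hN
    have h := congrArg (X.castTo N)
      (congrFun (congrFun (congrFun (tau_mc (hP.rightFunctor d)) e) e') hs)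
    rw [Pi.add_apply, Pi.add_apply, Pi.add_apply, map_add, castTo_bdry _ _ hN, castTo_conv _ _ _ hN,
      Pi.zero_apply, Pi.zero_apply, Pi.zero_apply, map_zero] at h
    rw [sumCuts₂, sumCuts_nil, sumBar₂, sumBar_nil,
      show sgn k (nil : Chain D d d).deg = 1 from sgn_zero k, one_smul, zero_add,
      letter_nil, X.dTo_castTo _ (by simp)]
    have e₁ : (hs.sumBar fun c => X.castTo N (P.letter (.nil : Chain D d d) c)) =
        hs.sumBar fun c => X.castTo N (tau (P.obj d) (fun h => P.right d h) e e' c) :=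
      sumBar_congr _ fun c _ => by rw [letter_nil, X.castTo_castTo _ (by simp)]
    have e₂ : (hs.sumCuts fun t => sgn k ((nil : Chain D d d).deg * t.left.deg) •
        sgn k (1 + ((nil : Chain D d d).deg + t.left.deg)) •
        X.compTo N (P.letter (.nil : Chain D d d) t.left) (P.letter .nil t.right)) =
        -hs.sumCuts fun t => sgn k (1 * t.left.deg) • X.compTo N
          (tau (P.obj d) (fun h => P.right d h) t.mid e' t.left)
          (tau (P.obj d) (fun h => P.right d h) e t.mid t.right) := by
      rw [← neg_one_smul k, smul_sumCuts]
      refine sumCuts_congr _ fun t _ => ?_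
      rw [letter_nil, letter_nil, X.compTo_castTo_left _ (by simp),
        X.compTo_castTo_right _ (by simp), deg_nil, zero_mul, sgn_zero, one_smul, zero_add, one_mul,
        sgn_add, sgn_one, mul_smul]
    rw [e₁]
    refine (congrArg (· - _) e₂).trans ?_
    rw [sgn_one, neg_one_smul, sub_neg_eq_add] at h
    exact (sub_eq_iff_eq_add.2 (neg_eq_of_add_eq_zero_left (by
      rw [add_comm (sumBar _ _)]; exact h)))
  | .cons (n := n) g .nil =>
    have h := congrArg (X.castTo N)
      (congrFun (congrFun (congrFun (hP.eps_d rfl g) e) e') hs)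
    simp only [deg_cons, deg_nil] at hN
    rw [castTo_diff _ _ _ _ (by omega)] at h
    rw [sumCuts₂, sumCuts_cons, sumCuts_nil, sumBar₂, sumBar_cons, sumBar_nil, sumHead_nil,
      smul_zero, add_zero, add_zero]
    have e₁ : (hs.sumBar fun c => X.castTo N (P.letter (.cons g nil) c)) =
        hs.sumBar fun c => X.castTo N (P.eps g e e' c) :=
      sumBar_congr _ fun c _ => by rw [letter_single, X.castTo_castTo _ (by simp; ring)]
    have e₂ : (hs.sumCuts fun t => sgn k ((cons g nil).deg * t.left.deg) •
        sgn k (1 + ((nil : Chain D d' d').deg + t.left.deg)) •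
        X.compTo N (P.letter (.nil : Chain D d' d') t.left) (P.letter (.cons g .nil) t.right)) =
        -hs.sumCuts fun t => sgn k (n * t.left.deg) • X.compTo N
          (tau (P.obj d') (fun h => P.right d' h) t.mid e' t.left) (P.eps g e t.mid t.right) := by
      rw [← neg_one_smul k, smul_sumCuts]
      refine sumCuts_congr _ fun t _ => ?_
      rw [letter_nil, letter_single, X.compTo_castTo_left _ (by simp),
        X.compTo_castTo_right _ (by simp; ring), sgn_smul_sgn_smul, ← sgn_one,
        sgn_smul_sgn_smul]
      congr 1
      refine sgn_eq k ?_
      simp only [deg_cons, deg_nil]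
      ring_nf
      simp
    have e₃ : (hs.sumCuts fun t => sgn k ((nil : Chain D d d).deg * t.left.deg) •
        sgn k (1 + ((cons g nil).deg + t.left.deg)) •
        X.compTo N (P.letter (.cons g .nil) t.left) (P.letter (.nil : Chain D d d) t.right)) =
        sgn k n • hs.sumCuts fun t => sgn k (1 * t.left.deg) • X.compTo N
          (P.eps g t.mid e' t.left) (tau (P.obj d) (fun h => P.right d h) e t.mid t.right) := by
      rw [smul_sumCuts]
      refine sumCuts_congr _ fun t _ => ?_
      rw [letter_nil, letter_single, X.compTo_castTo_right _ (by simp),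
        X.compTo_castTo_left _ (by simp; ring), sgn_smul_sgn_smul, sgn_smul_sgn_smul]
      congr 2
      simp only [deg_cons, deg_nil]
      ring
    rw [letter_single, letter_single, e₁, X.castTo_castTo _ (by simp; ring), h,
      X.dTo_castTo _ (by simp; ring), show sgn k (cons g nil).deg = -sgn k n from
        sgn_eq_neg k (m := n - 1 + 0) (n := n) (by ring_nf; decide)]
    refine (congrArg (· - _) (congrArg₂ (· + ·) e₂ e₃)).trans ?_
    module
  | .cons (n := n) g (.cons (n := m) g' .nil) =>
    have h := congrArg (X.castTo N)
      (congrFun (congrFun (congrFun (hP.eps_comp rfl g g') e) e') hs)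
    simp only [deg_cons, deg_nil] at hN
    rw [castTo_conv _ _ _ (by omega)] at h
    rw [sumBar₂, sumBar_cons, sumBar_cons, sumBar_nil, sumHead_nil, sumHead_cons, letter_cons_cons,
      letter_single, letter_cons_cons, X.castTo_castTo _ (by simp; ring), h, letter_cons_cons,
      sumBar_zero hs fun _ _ => by rw [letter_cons_cons, map_zero], sumCuts₂, sumCuts_cons,
      sumCuts_cons, sumCuts_nil]
    simp only [letter_cons_cons, map_zero, smul_zero, LinearMap.zero_apply, sub_zero, neg_zero,
      add_zero, zero_add]
    rw [sumCuts_const_zero, zero_add, add_zero,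
      smul_sumCuts]
    refine sumCuts_congr _ fun t _ => ?_
    rw [letter_single, letter_single, X.compTo_castTo_right _ (by simp; ring),
      X.compTo_castTo_left _ (by simp; ring), sgn_smul_sgn_smul, sgn_smul_sgn_smul]
    congr 2
    simp only [deg_cons, deg_nil]
    ring
  | .cons (n := n) g (.cons (n := m) g' (.cons g'' gs)) =>
    rw [letter_cons_cons, map_zero, sub_zero, sumBar₂]
    simp only [sumBar_cons, sumHead_cons, letter_cons_cons, map_zero, neg_zero, zero_add, smul_zero,
      add_zero, sumCuts₂, sumCuts_cons, LinearMap.zero_apply]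
    simp only [sumCuts_const_zero, sumBar_const_zero]
    have : sumHead g'' gs (fun _ => (0 : X.Hom (P.obj d e) (P.obj d' e') N)) = 0 := by
      cases gs <;> simp [sumHead_nil, sumHead_cons]
    simp only [this, smul_zero, add_zero]

variable (P : Pairing D E X) {d d' : D.Obj} {e e' : E.Obj}

theorem sumInt_sumCuts₂_comm {C C' : DGCat k} {x z : C.Obj} {x' z' : C'.Obj} (gs : Chain D d d')
    (hs : Chain E e e') (c : Chain C x z) (c' : Chain C' x' z')
    (φ : Chain X (P.obj d e) (P.obj d' e') → ∀ (u : C.Obj) (v : C'.Obj), Chain C u z →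
      Chain C' v z' → Chain C x u → Chain C' x' v → M) :
    (P.sumInt gs hs fun b => sumCuts₂ c c' fun u v l m l' m' => φ b u v l m l' m') =
      sumCuts₂ c c' fun u v l m l' m' => P.sumInt gs hs fun b => φ b u v l m l' m' := by
  simp only [sumCuts₂, sumInt_sumCuts_comm, smul_sumInt]

theorem sumInt_sumBar_comm {C : DGCat k} {x z : C.Obj} (gs : Chain D d d') (hs : Chain E e e')
    (c : Chain C x z) (φ : Chain X (P.obj d e) (P.obj d' e') → Chain C x z → M) :
    (P.sumInt gs hs fun b => c.sumBar fun s => φ b s) =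
      c.sumBar fun s => P.sumInt gs hs fun b => φ b s := by
  simp only [sumBar, sumInt]
  induction P.interleave gs hs with
  | nil => simp
  | cons a l ih =>
    simp only [List.map_cons, List.sum_cons, List.sum_map_add, ih, smul_add]
    simp only [List.smul_sum, List.map_map, Function.comp_def, smul_comm (sgn k a.1)]

theorem sumInt_sumBar₂_comm {C C' : DGCat k} {x z : C.Obj} {x' z' : C'.Obj} (gs : Chain D d d')
    (hs : Chain E e e') (c : Chain C x z) (c' : Chain C' x' z')
    (φ : Chain X (P.obj d e) (P.obj d' e') → Chain C x z → Chain C' x' z' → M) :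
    (P.sumInt gs hs fun b => sumBar₂ c c' fun s s' => φ b s s') =
      sumBar₂ c c' fun s s' => P.sumInt gs hs fun b => φ b s s' := by
  simp only [sumBar₂, sumInt_add, sumInt_sumBar_comm, ← smul_sumInt]

/-- The counit vanishes on boundaries, because no boundary contains the empty pair. -/
theorem sumBar₂_nilPart (gs : Chain D d d') (hs : Chain E e e')
    (φ : Chain X (P.obj d e) (P.obj d' e') → M) :
    (sumBar₂ gs hs fun c c' => P.nilPart c c' φ) = 0 := by
  cases gs with
  | nil =>
    rw [sumBar₂, sumBar_nil, zero_add]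
    cases hs with
    | nil => rw [sumBar_nil, smul_zero]
    | cons h hs => rw [sumBar_eq_zero _ _ fun _ _ => rfl, smul_zero]
  | cons g gs =>
    rw [sumBar₂, sumBar_eq_zero _ _ fun _ _ => rfl, sumBar_zero hs (φ := fun c => P.nilPart (cons g gs) c φ) fun _ _ => rfl, smul_zero,
      add_zero]

/-- The sum over interleavings is compatible with the bar differentials. -/
theorem IsTwisted.sumInt_sumBar {P : Pairing D E X} (hP : P.IsTwisted) (gs : Chain D d d')
    (hs : Chain E e e') (φ : Chain X (P.obj d e) (P.obj d' e') → M) (hφ : IsLin φ) :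
    (P.sumInt gs hs fun c => c.sumBar φ) = sumBar₂ gs hs fun c c' => P.sumInt c c' φ := by
  -- The same induction on total length as for deconcatenation; a letter on two empty chains is
  -- zero, so only strictly shorter pairs matter.
  obtain ⟨N, hN⟩ : ∃ N, gs.length + hs.length ≤ N := ⟨_, le_rfl⟩
  induction N generalizing d d' e e' with
  | zero =>
    cases gs with
    | cons g gs => simp at hN
    | nil =>
      cases hs with
      | cons g gs => simp at hN
      | nil => simp [sumInt_nil, sumBar₂, Chain.map, sumBar_nil]
  | succ N ih =>
    have e₀ : (P.nilPart gs hs fun c => c.sumBar φ) = 0 := by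
      cases gs <;> cases hs <;> simp [nilPart, sumBar_nil]
    -- The bar term multiplying the two leftmost entries: the rest is expanded once more to exhibit
    -- its own leftmost letter.
    have e₁ : ∀ (u v) (a : Chain D u d') (b : Chain E v e') (a' : Chain D d u) (b' : Chain E e v),
        (P.sumInt a' b' fun c => sumHead (P.letter a b) c φ) =
        sumCuts₂ a' b' fun _ _ m m' r r' => P.sumInt r r' fun c =>
          sgn k (1 + (a.deg + b.deg)) • φ (.cons (X.compTo (2 + (a.deg + b.deg + (m.deg + m'.deg)))
            (P.letter a b) (P.letter m m')) c) := by
      intro u v a b a' b'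
      rw [P.sumInt_eq _ _ (sumHead_isLin _ hφ)]
      have : (P.nilPart a' b' fun c => sumHead (P.letter a b) c φ) = 0 := by
        cases a' <;> cases b' <;> simp [nilPart, sumHead_nil]
      rw [this, zero_add]
      refine sumCuts₂_congr _ _ fun _ _ m m' r r' _ _ => P.sumInt_congr _ _ fun c _ => ?_
      rw [sumHead_cons, ← X.compTo_eq,
        ← cons_castTo (show _ = 2 + (a.deg + b.deg + (m.deg + m'.deg)) by ring) _ _ φ,
        X.castTo_compTo _ rfl]
    have e₂ : ∀ (u v) (a : Chain D u d') (b : Chain E v e') (a' : Chain D d u) (b' : Chain E e v)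
        (_ : a.append a' = gs) (_ : b.append b' = hs),
        (P.sumInt a' b' fun c => c.sumBar fun c' => φ (.cons (P.letter a b) c')) =
        sumBar₂ a' b' fun c c' => P.sumInt c c' fun r => φ (.cons (P.letter a b) r) := by
      intro u v a b a' b' ha hb
      by_cases h0 : 0 < a.length + b.length
      · refine ih a' b' _ (hφ.tail _) ?_
        rw [← ha, ← hb, length_append, length_append] at hN
        omega
      · cases a with
        | cons g gs => simp at h0
        | nil =>
          cases b with
          | cons g gs => simp at h0
          | nil =>
            simp only [letter_nil_nil, hφ.head_zero, sumInt_zero]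
            simp [sumBar₂, sumBar, sumInt_zero]
    rw [P.sumInt_eq gs hs (sumBar_isLin _ hφ), e₀, zero_add]
    -- The bar differential of a chain with head letter has three contributions: the differential of
    -- the letter, the bar differential of the tail (given by the induction hypothesis), and the
    -- product of the letter with the next one.
    have e₃ : (sumCuts₂ gs hs fun u v a b a' b' => P.sumInt a' b' fun c =>
          (cons (P.letter a b) c).sumBar φ) =
        (sumCuts₂ gs hs fun u v a b a' b' =>
          -(P.sumInt a' b' fun c => φ (.cons (X.dTo (2 + (a.deg + b.deg)) (P.letter a b)) c)) +
          sgn k (a.deg + b.deg) • sumBar₂ a' b' fun c c' =>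
            P.sumInt c c' fun r => φ (.cons (P.letter a b) r)) +
        sumCuts₂ gs hs fun u v a b a' b' => sumCuts₂ a' b' fun _ _ m m' r r' =>
          P.sumInt r r' fun c => sgn k (1 + (a.deg + b.deg)) •
            φ (.cons (X.compTo (2 + (a.deg + b.deg + (m.deg + m'.deg)))
              (P.letter a b) (P.letter m m')) c) := by
      rw [← sumCuts₂_add]
      refine sumCuts₂_congr _ _ fun u v a b a' b' ha hb => ?_
      rw [← e₁, ← e₂ u v a b a' b' ha hb]
      simp only [sumBar_cons, sumInt_add, ← smul_sumInt]
      congr 1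
      congr 1
      · rw [← neg_one_smul k, smul_sumInt]
        refine P.sumInt_congr _ _ fun c _ => ?_
        rw [neg_one_smul, ← X.dTo_eq,
          ← cons_castTo (show _ = 2 + (a.deg + b.deg) by ring) _ _ φ, X.castTo_dTo _ rfl]
      · congr 2
        ring
    rw [e₃, ← sumCuts₂_sumCuts₂ gs hs fun u v u' v' a b m m' r r' =>
      P.sumInt r r' fun c => sgn k (1 + (a.deg + b.deg)) •
        φ (.cons (X.compTo (2 + (a.deg + b.deg + (m.deg + m'.deg)))
          (P.letter a b) (P.letter m m')) c), ← sumCuts₂_add]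
    -- On the other side the counit term disappears, and what remains can be distributed over the
    -- two pieces of a cut. The part acting on the right piece matches the tail term above.
    have e₄ : (sumBar₂ gs hs fun c c' => P.sumInt c c' φ) =
        sumBar₂ gs hs fun c c' => sumCuts₂ c c' fun _ _ a b a' b' =>
          P.sumInt a' b' fun c => φ (.cons (P.letter a b) c) := by
      have h : (sumBar₂ gs hs fun c c' => P.sumInt c c' φ) =
          sumBar₂ gs hs fun c c' => P.nilPart c c' φ + sumCuts₂ c c' fun _ _ a b a' b' =>
            P.sumInt a' b' fun c => φ (.cons (P.letter a b) c) :=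
        sumBar₂_congr _ _ fun c c' _ => P.sumInt_eq c c' hφ
      rw [h, ← zero_add (sumBar₂ gs hs fun c c' => sumCuts₂ _ _ _), ← P.sumBar₂_nilPart gs hs φ]
      simp only [sumBar₂, sumBar_add, smul_add]
      abel
    rw [e₄, sumBar₂_sumCuts₂]
    refine sumCuts₂_congr _ _ fun u v a b a' b' _ _ => ?_
    -- The part acting on the left piece is moved into the head entry by linearity, where
    -- `letter_mc` replaces it by products of two letters minus the differential of a letter.
    have e₅ : (sumBar₂ a b fun c c' => P.sumInt a' b' fun r => φ (.cons (P.letter c c') r)) =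
        P.sumInt a' b' fun r => hφ.headMap r (sumBar₂ a b fun c c' =>
          X.castTo (2 + (a.deg + b.deg)) (P.letter c c')) := by
      rw [← sumInt_sumBar₂_comm]
      refine P.sumInt_congr _ _ fun r _ => ?_
      rw [map_sumBar₂]
      refine sumBar₂_congr _ _ fun c c' h => ?_
      exact (cons_castTo (by omega) _ _ φ).symm
    rw [e₅, ← hP.letter_mc]
    simp only [map_sub, map_sumCuts₂, map_smul]
    simp only [sub_eq_add_neg, sumInt_add, sumInt_sumCuts₂_comm]
    simp only [hφ.headMap_apply]
    have e₆ : (P.sumInt a' b' fun r => -φ (.cons (X.dTo (2 + (a.deg + b.deg)) (P.letter a b)) r)) =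
        -P.sumInt a' b' fun r => φ (.cons (X.dTo (2 + (a.deg + b.deg)) (P.letter a b)) r) := by
      simpa using (P.smul_sumInt a' b' (-1) fun r =>
        φ (.cons (X.dTo (2 + (a.deg + b.deg)) (P.letter a b)) r)).symm
    rw [e₆]
    -- Only the degree annotation of the product changes: the degrees of the two pieces of a cut add
    -- up to those of a and b.
    have e₇ : (sumCuts₂ a b fun _ _ l l' m m' => P.sumInt a' b' fun c =>
        sgn k (1 + (l.deg + l'.deg)) • φ (.cons (X.compTo (2 + (l.deg + l'.deg + (m.deg + m'.deg)))
          (P.letter l l') (P.letter m m')) c)) =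
        sumCuts₂ a b fun _ _ l l' m m' => P.sumInt a' b' fun c =>
        sgn k (1 + (l.deg + l'.deg)) • φ (.cons (X.compTo (2 + (a.deg + b.deg))
          (P.letter l l') (P.letter m m')) c) := by
      refine sumCuts₂_congr _ _ fun _ _ l l' m m' h h' => ?_
      rw [show l.deg + l'.deg + (m.deg + m'.deg) = a.deg + b.deg by
        rw [← h, ← h', deg_append, deg_append]; ring]
    rw [e₇]
    abel

end Pairing
end Twisted

/-! ### Multilinearity and normalization of sums over interleavings; compatibility with convolution.
-/

namespace Twisted

variable {k : Type u} [Field k]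

open PreCochain

namespace Chain

variable {C D : DGCat k} {M : Type u} [AddCommGroup M] [Module k M]

/-- Functionals on chains vanishing as soon as one argument is an identity. -/
structure IsNormalized {x z : C.Obj} (φ : Chain C x z → M) : Prop where
  zero : ∀ {y : C.Obj} (l : Chain C y z) (r : Chain C x y), φ (l.append (cons (C.id y) r)) = 0

theorem IsNormalized.append_left {x y z : C.Obj} {φ : Chain C x z → M} (hφ : IsNormalized φ)
    (l : Chain C y z) : IsNormalized fun c => φ (l.append c) :=
  ⟨fun l' r => by simp only [← append_assoc, hφ.zero]⟩

theorem IsNormalized.append_right {x y z : C.Obj} {φ : Chain C x z → M} (hφ : IsNormalized φ)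
    (r : Chain C x y) : IsNormalized fun c => φ (c.append r) :=
  ⟨fun l' r' => by simp only [append_assoc, cons_append, hφ.zero]⟩

theorem IsNormalized.tail {x y z : C.Obj} {φ : Chain C x z → M} (hφ : IsNormalized φ) {n : ℤ}
    (f : C.Hom y z n) : IsNormalized fun c => φ (cons f c) :=
  hφ.append_left (cons f nil)

/-- The degree of the entry depends on the chain c, so its linearity only makes sense after casting
to a fixed degree; the functional on chains does not see such a cast of its head. -/
theorem IsLin.cons_family {x z : C.Obj} {u v w : D.Obj} (s : ℤ → ℤ)
    {T : ∀ c : Chain C x z, D.Hom u v (s c.deg)}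
    (hT : ∀ N : ℤ, IsLin fun c : Chain C x z => D.castTo N (T c))
    {φ : Chain D w v → M} (hφ : IsLin φ) (r : Chain D w u) :
    IsLin fun c : Chain C x z => φ (cons (T c) r) := by
  refine ⟨fun l a b f g r' => ?_⟩
  set N := s (l.append (cons f r')).deg with hN
  have h := (hT N).lin l a b f g r'
  rw [← cons_castTo (m := N) (by simp [hN]) (T (l.append (cons f r'))) _ φ,
    ← cons_castTo (m := N) (by simp [hN]) _ _ φ, h, hφ.head,
    cons_castTo (m := N) (by simp [hN]) (T (l.append (cons g r'))) _ φ]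

theorem IsLin.cons_cochain {F G : C.Obj → D.Obj} {p : ℤ} {A : PreCochain C D F G p}
    {x z : C.Obj} (hA : ∀ N : ℤ, IsLin fun c : Chain C x z => D.castTo N (A x z c))
    {w : D.Obj} {φ : Chain D w (G z) → M} (hφ : IsLin φ) (r : Chain D w (F x)) :
    IsLin fun c : Chain C x z => φ (cons (A x z c) r) :=
  hφ.cons_family (fun n => p + n) hA r

theorem isLin_sumCuts {x z : C.Obj} {x' z' : D.Obj} (c : Chain D x' z')
    {φ : Chain C x z → Cut D x' z' → M} (h : ∀ s, IsLin fun b => φ b s) :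
    IsLin fun b => c.sumCuts fun s => φ b s :=
  ⟨fun l a b f g r => by simp only [(h _).lin, sumCuts_add, smul_sumCuts]⟩

end Chain

namespace PreCochain

open Chain

variable {C D : DGCat k} {F G : C.Obj → D.Obj} {p q : ℤ}

theorem isLin_compTo_left {x z : C.Obj} {w : D.Obj} {A : PreCochain C D F G p}
    (hA : ∀ N : ℤ, IsLin fun c : Chain C x z => D.castTo N (A x z c)) (N : ℤ)
    (g : D.Hom w (F x) q) : IsLin fun c : Chain C x z => D.compTo N (A x z c) g := by
  -- The degree `N - q` is the only one in which the value of A can contribute to a composite of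
  -- degree N; in every other degree both expressions are zero.
  have h := (hA (N - q)).map ((D.compTo N).flip g)
  convert h using 2 with c
  rw [LinearMap.flip_apply]
  by_cases hN : p + c.deg = N - q
  · rw [D.compTo_castTo_left _ hN]
  · rw [D.castTo_of_ne hN, D.compTo_of_ne (by omega), map_zero, LinearMap.zero_apply]

theorem isLin_compTo_right {x z : C.Obj} {w : D.Obj} {A : PreCochain C D F G p}
    (hA : ∀ N : ℤ, IsLin fun c : Chain C x z => D.castTo N (A x z c)) (N : ℤ)
    (f : D.Hom (G z) w q) : IsLin fun c : Chain C x z => D.compTo N f (A x z c) := by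
  have h := (hA (N - q)).map (D.compTo N f)
  convert h using 2 with c
  by_cases hN : p + c.deg = N - q
  · rw [D.compTo_castTo_right _ hN]
  · rw [D.castTo_of_ne hN, D.compTo_of_ne (by omega), map_zero]

end PreCochain

namespace Pairing

open Chain

variable {D E X Y : DGCat k} {M : Type u} [AddCommGroup M] [Module k M] {P : Pairing D E Y}
  {d d' : D.Obj} {e e' : E.Obj}

theorem IsTwisted.isLin_rightChain (hP : P.IsTwisted) (d : D.Obj)
    {φ : Chain Y (P.obj d e) (P.obj d e') → M} (hφ : IsLin φ) :
    IsLin fun hs => φ (P.rightChain d hs) := by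
  refine ⟨fun l a b f g r => ?_⟩
  simp only [rightChain, map_append, Chain.map, hP.right_linear, hφ.lin]

theorem IsTwisted.isNormalized_rightChain (hP : P.IsTwisted) (d : D.Obj)
    {φ : Chain Y (P.obj d e) (P.obj d e') → M} (hφ : IsNormalized φ) :
    IsNormalized fun hs => φ (P.rightChain d hs) := ⟨fun l r => by
  simp only [rightChain, map_append, Chain.map, hP.right_id]
  exact hφ.zero _ _⟩

/-- For each cut, an entry h lies to the left of the block of g, in this block, or in the part left
to the recursion. Linearity comes from `right_linear`, from `eps_reduced` and from the induction
hypothesis respectively; the signs depend only on degrees. -/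
theorem IsTwisted.isLin_sumInt_right (hP : P.IsTwisted) (gs : Chain D d d')
    {φ : Chain Y (P.obj d e) (P.obj d' e') → M} (hφ : IsLin φ) :
    IsLin fun hs => P.sumInt gs hs φ := by
  induction gs generalizing e' with
  | nil => simpa only [sumInt_nil] using hP.isLin_rightChain _ hφ
  | @cons _ d'' n g gs ih =>
    simp only [sumInt_cons]
    refine sumCuts_isLin (fun y l r => r.sumCuts fun t =>
      sgn k ((cons g gs).deg * l.deg + gs.deg * t.left.deg) • P.sumInt gs t.right fun c =>
        φ ((P.rightChain d'' l).append (.cons (P.eps g _ _ t.left) c))) ?_ ?_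
    · intro y r
      refine isLin_sumCuts r fun s => ?_
      exact IsLin.smul_deg (P.isLin_sumInt gs _ fun b =>
        hP.isLin_rightChain d'' (hφ.append_right (.cons (P.eps g _ _ s.left) b)))
          fun n => sgn k ((cons g gs).deg * n + gs.deg * s.left.deg)
    · intro y l
      refine sumCuts_isLin (fun y' b r => sgn k ((cons g gs).deg * l.deg + gs.deg * b.deg) •
        P.sumInt gs r fun c =>
          φ ((P.rightChain d'' l).append (.cons (P.eps g _ _ b) c))) ?_ ?_
      · intro y' r
        exact IsLin.smul_deg (P.isLin_sumInt gs r fun c => IsLin.cons_cochain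
          ((hP.eps_reduced g).isLin _ _) (hφ.append_left (P.rightChain d'' l)) c)
            fun n => sgn k ((cons g gs).deg * l.deg + gs.deg * n)
      · intro y' b
        exact (ih ((hφ.append_left _).tail _)).map
          (sgn k ((cons g gs).deg * l.deg + gs.deg * b.deg) • LinearMap.id)

/-- An identity among the h stays as `id ⊗ id`, an identity on which the functional is normalized,
or enters a block, where `ε` vanishes, or is passed on to the recursion. -/
theorem IsTwisted.isNormalized_sumInt_right (hP : P.IsTwisted) (gs : Chain D d d')
    {φ : Chain Y (P.obj d e) (P.obj d' e') → M} (hφ : IsLin φ) (hφ' : IsNormalized φ) :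
    IsNormalized fun hs => P.sumInt gs hs φ := by
  induction gs generalizing e' with
  | nil => simpa only [sumInt_nil] using hP.isNormalized_rightChain _ hφ'
  | @cons _ d'' n g gs ih =>
    simp only [sumInt_cons]
    refine ⟨fun {y₀} l₀ r₀ => sumCuts_id (fun y l r => r.sumCuts fun t =>
      sgn k ((cons g gs).deg * l.deg + gs.deg * t.left.deg) • P.sumInt gs t.right fun c =>
        φ ((P.rightChain d'' l).append (.cons (P.eps g _ _ t.left) c))) ?_ ?_ l₀ r₀⟩
    · intro y v l r r'
      refine sumCuts_zero _ fun t _ => ?_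
      have : ∀ c, φ ((P.rightChain d'' (l.append (cons (E.id v) r))).append
          (cons (P.eps g t.mid y t.left) c)) = 0 := fun c =>
        (hP.isNormalized_rightChain d''
          (hφ'.append_right (cons (P.eps g t.mid y t.left) c))).zero l r
      simp only [this, sumInt_zero, smul_zero]
    · intro y v l l' r
      refine sumCuts_id (fun y' b r => sgn k ((cons g gs).deg * l.deg + gs.deg * b.deg) •
        P.sumInt gs r fun c =>
          φ ((P.rightChain d'' l).append (.cons (P.eps g _ _ b) c))) ?_ ?_ l' r
      · intro y' v' m m' r'
        have : ∀ c, φ ((P.rightChain d'' l).append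
            (cons (P.eps g y' y (m.append (cons (E.id v') m'))) c)) = 0 := fun c => by
          rw [(hP.eps_reduced g).normalized]
          exact (hφ.append_left _).head_zero c
        simp only [this, sumInt_zero, smul_zero]
      · intro y' v' b m r'
        refine (congrArg _ ?_).trans (smul_zero _)
        exact (ih ((hφ.append_left _).tail _) ((hφ'.append_left _).tail _)).zero m r'

theorem IsTwisted.isLin_sumInt_left (hP : P.IsTwisted) (hs : Chain E e e')
    {φ : Chain Y (P.obj d e) (P.obj d' e') → M} (hφ : IsLin φ) :
    IsLin fun gs => P.sumInt gs hs φ := by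
  refine ⟨fun {y w n} l a b f g r => ?_⟩
  induction l generalizing e' with
  | nil =>
    simp only [nil_append, sumInt_cons, smul_sumCuts, ← sumCuts_add]
    refine sumCuts_congr _ fun s _ => sumCuts_congr _ fun t _ => ?_
    simp only [hP.eps_linear, Pi.add_apply, Pi.smul_apply, (hφ.append_left _).head, sumInt_add,
      ← smul_sumInt, deg_cons]
    module
  | cons g' l ih =>
    simp only [cons_append, sumInt_cons, smul_sumCuts, ← sumCuts_add]
    refine sumCuts_congr _ fun s _ => sumCuts_congr _ fun t _ => ?_
    rw [ih _ ((hφ.append_left _).tail _)]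
    simp only [deg_cons, deg_append]
    module

/-- An identity among the g produces `ε(id; block)`, which is zero for a nonempty block and the
identity for an empty one; the functional vanishes on it in both cases, by linearity and by
normalization. -/
theorem IsTwisted.isNormalized_sumInt_left (hP : P.IsTwisted) (hs : Chain E e e')
    {φ : Chain Y (P.obj d e) (P.obj d' e') → M} (hφ : IsLin φ) (hφ' : IsNormalized φ) :
    IsNormalized fun gs => P.sumInt gs hs φ := by
  refine ⟨fun {y} l r => ?_⟩
  induction l generalizing e' with
  | nil =>
    simp only [nil_append, sumInt_cons]
    refine sumCuts_zero _ fun s _ => sumCuts_zero _ fun t _ => ?_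
    refine (congrArg _ ?_).trans (smul_zero _)
    refine (P.sumInt_congr _ _ (ψ := fun _ => 0) fun c _ => ?_).trans (P.sumInt_zero _ _)
    rw [hP.eps_id]
    obtain ⟨m, b, b'⟩ := t
    cases b with
    | nil =>
      rw [one_nil]
      exact (cons_castTo (by simp) _ _ fun c => φ (append _ c)).trans (hφ'.zero _ _)
    | cons h b =>
      rw [one_cons]
      exact (hφ.append_left _).head_zero c
  | cons g' l ih =>
    simp only [cons_append, sumInt_cons]
    refine sumCuts_zero _ fun s _ => sumCuts_zero _ fun t _ => ?_
    rw [ih _ ((hφ.append_left _).tail _) ((hφ'.append_left _).tail _), smul_zero]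

variable {F G H : Y.Obj → X.Obj} {p q n m : ℤ}

/-- The values of a cochain on the interleavings of a fixed chain with other chains. -/
def braceVal (P : Pairing D E Y) (A : PreCochain Y X F G p) (gs : Chain D d d') :
    PreCochain E X (fun e => F (P.obj d e)) (fun e => G (P.obj d' e)) (p + gs.deg) :=
  fun _ _ hs => P.sumInt gs hs fun c => X.castTo (p + gs.deg + hs.deg) (A _ _ c)

theorem castTo_braceVal (A : PreCochain Y X F G p) (gs : Chain D d d') (hs : Chain E e e')
    (N : ℤ) : X.castTo N (P.braceVal A gs e e' hs) = P.sumInt gs hs fun c =>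
      X.castTo N (A _ _ c) := by
  rw [braceVal, map_sumInt]
  exact P.sumInt_congr _ _ fun c hc => X.castTo_castTo _ (by omega) _

theorem IsTwisted.braceVal_isReduced (hP : P.IsTwisted) {A : PreCochain Y X F G p}
    (hA : A.IsReduced) (gs : Chain D d d') : (P.braceVal A gs).IsReduced := by
  refine isReduced_of (fun x z N => ?_) fun {x y w} l r => ?_
  · simp only [castTo_braceVal]
    exact hP.isLin_sumInt_right gs (hA.isLin _ _ N)
  · exact (hP.isNormalized_sumInt_right gs (hA.isLin _ _ _)
      ⟨fun l r => by rw [hA.normalized, map_zero]⟩).zero l r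

/-- Sums over interleavings of a convolution product. -/
theorem sumInt_conv (A : PreCochain Y X G H p) (B : PreCochain Y X F G q)
    (hA : ∀ (x z : Y.Obj) (N : ℤ), IsLin fun c : Chain Y x z => X.castTo N (A x z c))
    (hB : ∀ (x z : Y.Obj) (N : ℤ), IsLin fun c : Chain Y x z => X.castTo N (B x z c))
    (gs : Chain D d d') (hs : Chain E e e') {N : ℤ} (hN : n + (gs.deg + hs.deg) = N) :
    (P.sumInt gs hs fun c => X.castTo N (conv n A B _ _ c)) =
      gs.sumCuts fun s => sgn k (q * s.left.deg) • hs.sumCuts fun t =>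
        sgn k ((q + s.right.deg) * t.left.deg) •
          X.compTo N (P.braceVal A s.left t.mid e' t.left) (P.braceVal B s.right e t.mid t.right) := by
  -- A convolution product is a sum over cuts of a functional linear in both pieces, so
  -- compatibility with deconcatenation applies to it.
  have h₁ := P.sumInt_sumCuts gs hs (fun y l r => sgn k (q * l.deg) • X.compTo N (A _ _ l) (B _ _ r))
    (fun y r => (isLin_compTo_left (hA _ _) N (B _ _ r)).smul_deg fun n => sgn k (q * n))
    (fun y l => (isLin_compTo_right (hB _ _) N (A _ _ l)).map (sgn k (q * l.deg) • LinearMap.id))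
  rw [P.sumInt_congr gs hs fun c hc => castTo_conv A B c (by omega), h₁, sumCuts₂]
  refine sumCuts_congr _ fun s hs' => ?_
  rw [smul_sumCuts]
  refine sumCuts_congr _ fun t ht => ?_
  have h₂ : ∀ (l : Chain Y (P.obj s.mid t.mid) (P.obj d' e')), l.deg = s.left.deg + t.left.deg →
      (P.sumInt s.right t.right fun r => sgn k (q * l.deg) • X.compTo N (A _ _ l) (B _ _ r)) =
      (sgn k (q * (s.left.deg + t.left.deg)) • (X.compTo N).flip
        (P.braceVal B s.right e t.mid t.right))
          (X.castTo (p + s.left.deg + t.left.deg) (A _ _ l)) := by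
    intro l hl
    rw [LinearMap.smul_apply, LinearMap.flip_apply, X.compTo_castTo_left _ (by omega), braceVal,
      map_sumInt, smul_sumInt]
    exact P.sumInt_congr _ _ fun r hr => by
      rw [show sgn k (q * l.deg) = sgn k (q * (s.left.deg + t.left.deg)) by rw [hl],
        X.compTo_castTo_right _ (by omega)]
  -- With pieces a, a' of `gs` and b, b' of `hs`, the exponent is q(|a| + |b|) + |a'||b| = q|a| + (q
  -- + |a'|)|b|. This is the sign of a convolution over D followed by that of a composition in `Coh
  -- E X`, where the value of B on a' has degree q + |a'|.
  rw [P.sumInt_congr _ _ h₂, ← map_sumInt, sgn_smul_sgn_smul, LinearMap.smul_apply,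
    sgn_smul_sgn_smul]
  exact congrArg₂ (· • ·) (congrArg (sgn k) (by ring)) rfl

theorem sumInt_of_cons_eq_zero (gs : Chain D d d') (hs : Chain E e e')
    {φ : Chain Y (P.obj d e) (P.obj d' e') → M} (hφ : IsLin φ)
    (h : ∀ {y : Y.Obj} {n : ℤ} (f : Y.Hom y (P.obj d' e') n) c, φ (cons f c) = 0) :
    P.sumInt gs hs φ = P.nilPart gs hs φ := by
  rw [P.sumInt_eq _ _ hφ, sumCuts₂_zero, add_zero]
  intro u v a b a' b' _ _
  simp only [h, sumInt_zero]

/-- The right counit law, the mirror image of `sumCuts₂_nilPart`. -/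
theorem sumCuts₂_nilPart_right (P : Pairing D E Y) (gs : Chain D d d') (hs : Chain E e e')
    (φ : ∀ u v, Chain D u d' → Chain E v e' → Chain Y (P.obj d e) (P.obj u v) → M) :
    (sumCuts₂ gs hs fun u v a b a' b' => P.nilPart a' b' fun c => φ u v a b c) =
      φ d e gs hs .nil := by
  refine (sumCuts_last gs (fun u a a' => hs.sumCuts fun t => sgn k (a'.deg * t.left.deg) •
    P.nilPart a' t.right fun c => φ u t.mid a t.left c) ?_).trans
    ((sumCuts_last hs (fun v b b' => sgn k ((.nil : Chain D d d).deg * b.deg) •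
      P.nilPart (.nil : Chain D d d) b' fun c => φ d v gs b c) ?_).trans ?_)
  · intro v y l n f r
    exact sumCuts_zero _ fun t _ => smul_zero _
  · intro v y l n f r
    exact smul_zero _
  · show sgn k (0 * _) • φ d e gs hs .nil = _
    rw [zero_mul, sgn_zero, one_smul]

/-- The sum over interleavings for a functional vanishing on long chains. -/
theorem sumInt_of_cons_cons_eq_zero (gs : Chain D d d') (hs : Chain E e e')
    {φ : Chain Y (P.obj d e) (P.obj d' e') → M} (hφ : IsLin φ)
    (h : ∀ {y z : Y.Obj} {n m : ℤ} (f : Y.Hom y (P.obj d' e') n) (g : Y.Hom z y m) c,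
      φ (cons f (cons g c)) = 0) :
    P.sumInt gs hs φ = P.nilPart gs hs φ + φ (.cons (P.letter gs hs) .nil) := by
  rw [P.sumInt_eq _ _ hφ, ← P.sumCuts₂_nilPart_right gs hs fun u v a b c =>
    φ (.cons (P.letter a b) c)]
  congr 1
  refine sumCuts₂_congr _ _ fun u v a b a' b' _ _ => ?_
  exact sumInt_of_cons_eq_zero _ _ (hφ.tail _) fun f c => h _ _ _

end Pairing
end Twisted

/-! ### Cochains with values in coherent natural transformations. -/

namespace Twisted

variable {k : Type u} [Field k]

open PreCochain

namespace Coh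

variable {C D : DGCat k} {F G H : (Coh C D).Obj} {p q n m : ℤ}

/-- The action on objects of an object of `Coh C D`. -/
def fobj (F : (Coh C D).Obj) (x : C.Obj) : D.Obj := DGFunctor.obj F x

/-- The action on morphisms of an object of `Coh C D`. -/
def fmap (F : (Coh C D).Obj) {x y : C.Obj} {n : ℤ} :
    C.Hom x y n →ₗ[k] D.Hom (fobj F x) (fobj F y) n :=
  DGFunctor.map F

/-- The value on a chain as a linear function of the coherent natural transformation. -/
def evalChain {x y : C.Obj} (c : Chain C x y) :
    (Coh C D).Hom F G p →ₗ[k] D.Hom (fobj F x) (fobj G y) (p + c.deg) where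
  toFun Ψ := val Ψ x y c
  map_add' _ _ := rfl
  map_smul' _ _ := rfl

theorem ext {Ψ Ψ' : (Coh C D).Hom F G p}
    (h : ∀ {x y : C.Obj} (c : Chain C x y), evalChain c Ψ = evalChain c Ψ') : Ψ = Ψ' :=
  Subtype.ext (funext fun _ => funext fun _ => funext fun c => h c)

theorem evalChain_castTo (N : ℤ) (Ψ : (Coh C D).Hom F G p) {x y : C.Obj} (c : Chain C x y) :
    evalChain c ((Coh C D).castTo N Ψ) = D.castTo (N + c.deg) (evalChain c Ψ) := by
  by_cases h : p = N
  · subst h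
    rw [(Coh C D).castTo_self, D.castTo_self]
  · rw [(Coh C D).castTo_of_ne h, D.castTo_of_ne (by omega), map_zero]

theorem evalChain_compTo (h : p + q = n) (A : (Coh C D).Hom G H p) (B : (Coh C D).Hom F G q)
    {x z : C.Obj} (c : Chain C x z) : evalChain c ((Coh C D).compTo n A B) =
      c.sumCuts fun s => sgn k (q * s.left.deg) •
        D.compTo (n + c.deg) (evalChain s.left A) (evalChain s.right B) := by
  rw [(Coh C D).compTo_eq h]
  rfl

theorem evalChain_dTo (h : p + 1 = m) (A : (Coh C D).Hom F G p) {x z : C.Obj} (c : Chain C x z) :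
    evalChain c ((Coh C D).dTo m A) =
      (D.dTo (m + c.deg) (evalChain c A) -
        sgn k p • c.sumBar fun t => D.castTo (m + c.deg) (evalChain t A)) +
      (c.sumCuts fun s => sgn k (p * s.left.deg) • D.compTo (m + c.deg)
        (tau (fobj G) (fun f => fmap G f) s.mid z s.left) (evalChain s.right A)) -
      sgn k p • c.sumCuts fun s => sgn k (1 * s.left.deg) • D.compTo (m + c.deg)
        (evalChain s.left A) (tau (fobj F) (fun f => fmap F f) x s.mid s.right) := by
  rw [(Coh C D).dTo_eq h]
  rfl

end Coh

namespace PreCochain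

open Chain Coh

variable {D E X : DGCat k} {d d' : D.Obj} {e e' : E.Obj} {p q n m : ℤ}
  {F G H : D.Obj → (Coh E X).Obj}

/-- Convolution over D nested with composition in `Coh E X`. The inner sign involves the degree `q +
s.right.deg` of the value of B, not q alone. -/
theorem evalChain_conv (A : PreCochain D (Coh E X) G H p) (B : PreCochain D (Coh E X) F G q)
    (h : p + q = n) (gs : Chain D d d') (hs : Chain E e e') :
    evalChain hs (conv n A B d d' gs) =
      gs.sumCuts fun s => sgn k (q * s.left.deg) • hs.sumCuts fun t =>
        sgn k ((q + s.right.deg) * t.left.deg) • X.compTo (n + gs.deg + hs.deg)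
          (evalChain t.left (A s.mid d' s.left)) (evalChain t.right (B d s.mid s.right)) := by
  rw [conv_apply, map_sumCuts]
  refine sumCuts_congr _ fun s hs' => ?_
  rw [map_smul, evalChain_compTo (by rw [← hs', deg_append]; omega)]

/-- The first group of terms is the differential of `Coh E X` applied to the value on `gs`, whose
degree is `p + gs.deg`. The remaining ones are the bar differential of `gs` and the two outer
actions through φ and ψ. This is the form to be compared with the differential of an interleaved
cochain. -/
theorem evalChain_diff
    (φ : ∀ {x y : D.Obj} {n : ℤ}, D.Hom x y n → (Coh E X).Hom (G x) (G y) n)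
    (ψ : ∀ {x y : D.Obj} {n : ℤ}, D.Hom x y n → (Coh E X).Hom (F x) (F y) n)
    (A : PreCochain D (Coh E X) F G p) (h : p + 1 = m) (gs : Chain D d d') (hs : Chain E e e') :
    evalChain hs (diff φ ψ m A d d' gs) =
      ((X.dTo (m + gs.deg + hs.deg) (evalChain hs (A d d' gs)) - sgn k (p + gs.deg) •
          hs.sumBar fun t => X.castTo (m + gs.deg + hs.deg) (evalChain t (A d d' gs))) +
        (hs.sumCuts fun t => sgn k ((p + gs.deg) * t.left.deg) • X.compTo (m + gs.deg + hs.deg)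
          (tau (fobj (G d')) (fun f => fmap (G d') f) t.mid e' t.left)
          (evalChain t.right (A d d' gs))) -
        sgn k (p + gs.deg) • hs.sumCuts fun t => sgn k (1 * t.left.deg) •
          X.compTo (m + gs.deg + hs.deg) (evalChain t.left (A d d' gs))
          (tau (fobj (F d)) (fun f => fmap (F d) f) e t.mid t.right)) -
      (sgn k p • gs.sumBar fun t => X.castTo (m + gs.deg + hs.deg) (evalChain hs (A d d' t))) +
      (gs.sumCuts fun s => sgn k (p * s.left.deg) • hs.sumCuts fun t =>
        sgn k ((p + s.right.deg) * t.left.deg) • X.compTo (m + gs.deg + hs.deg)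
          (evalChain t.left (tau G φ s.mid d' s.left))
          (evalChain t.right (A d s.mid s.right))) -
      sgn k p • gs.sumCuts fun s => sgn k (1 * s.left.deg) • hs.sumCuts fun t =>
        sgn k ((1 + s.right.deg) * t.left.deg) • X.compTo (m + gs.deg + hs.deg)
          (evalChain t.left (A s.mid d' s.left))
          (evalChain t.right (tau F ψ d s.mid s.right)) := by
  rw [← evalChain_conv _ _ (by omega), ← evalChain_conv _ _ h, ← evalChain_dTo (by omega)]
  simp only [← evalChain_castTo]
  rw [← map_sumBar, ← map_smul, ← map_smul, ← map_sub, ← map_add, ← map_sub]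
  rfl

end PreCochain

theorem PreCochain.push_isReduced {C D X : DGCat k} {F G : C.Obj → D.Obj} {p : ℤ}
    (Φ : DGFunctor D X) {A : PreCochain C D F G p} (hA : A.IsReduced) :
    (push Φ A).IsReduced where
  linear l a b f g r := by
    simp only [push, hA.linear, map_add, map_smul, Φ.map_castTo]
  normalized l r := by simp only [push, hA.normalized, map_zero]

/-! ### Currying of twisted pairings and the brace dg functor. -/

namespace Pairing

open Chain

variable {D E X Y : DGCat k}

/-- Postcomposition of an interpretation of the generators with a dg functor. -/
def postcomp (P : Pairing D E Y) (Φ : DGFunctor Y X) : Pairing D E X where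
  obj d e := Φ.obj (P.obj d e)
  right d _ _ _ g := Φ.map (P.right d g)
  eps f := push Φ (P.eps f)

theorem IsTwisted.postcomp {P : Pairing D E Y} (hP : P.IsTwisted) (Φ : DGFunctor Y X) :
    (P.postcomp Φ).IsTwisted where
  right_linear c {d d' n} a b g g' := by
    simp only [Pairing.postcomp, hP.right_linear, map_add, map_smul]
    rfl
  right_id c d := by simp only [Pairing.postcomp, hP.right_id, Φ.map_id]
  right_comp c {d d' d'' p q n} h g g' :=
    (congrArg Φ.map (hP.right_comp c h g g')).trans (Φ.toMap.map_comp h _ _)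
  right_d c {d d' n m} h g := (congrArg Φ.map (hP.right_d c h g)).trans (Φ.toMap.map_d h _)
  eps_linear {c c' p} a b f f' := by
    simp only [Pairing.postcomp, hP.eps_linear]
    funext x y e
    simp only [push, Pi.add_apply, Pi.smul_apply, map_add, map_smul]
    rfl
  eps_reduced f := push_isReduced Φ (hP.eps_reduced f)
  eps_id c := (congrArg (push Φ) (hP.eps_id c)).trans (push_one Φ)
  eps_comp {c c' c'' p q n} h f₂ f₁ :=
    (congrArg (push Φ) (hP.eps_comp h f₂ f₁)).trans (push_conv Φ _ _)
  eps_d {c c' p m} h f := (congrArg (push Φ) (hP.eps_d h f)).trans (push_diff Φ _ _ _)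

/-- The object of `Coh E X` given by `id_d ⊗ -`. -/
def IsTwisted.curryObj {Q : Pairing D E X} (hQ : Q.IsTwisted) (d : D.Obj) : (Coh E X).Obj :=
  hQ.rightFunctor d

/-- The coherent natural transformation given by `ε(f; -)`. -/
def IsTwisted.curryHom {Q : Pairing D E X} (hQ : Q.IsTwisted) {d d' : D.Obj} {n : ℤ} :
    D.Hom d d' n →ₗ[k] (Coh E X).Hom (hQ.curryObj d) (hQ.curryObj d') n where
  toFun f := ⟨Q.eps f, hQ.eps_reduced f⟩
  map_add' f f' := Subtype.ext
    ((by simpa using hQ.eps_linear 1 1 f f' : Q.eps (f + f') = Q.eps f + Q.eps f'))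
  map_smul' a f := Subtype.ext
    ((by simpa using hQ.eps_linear a 0 f 0 : Q.eps (a • f) = a • Q.eps f))

/-- The dg functor to coherent natural transformations determined by a twisted pairing. -/
def IsTwisted.curry {Q : Pairing D E X} (hQ : Q.IsTwisted) : DGFunctor D (Coh E X) where
  obj := hQ.curryObj
  toMap :=
    { map := hQ.curryHom
      map_id := fun x => Subtype.ext (hQ.eps_id x)
      map_comp := fun h f g => Subtype.ext (hQ.eps_comp h f g)
      map_d := fun h f => Subtype.ext (hQ.eps_d h f) }

/-- The pairing determined by a dg functor to coherent natural transformations. -/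
def uncurry (J : DGFunctor D (Coh E X)) : Pairing D E X where
  obj d e := (J.obj d).obj e
  right d _ _ _ g := (J.obj d).map g
  eps f := Coh.val (J.map f)

/-- The relations of a twisted pairing are precisely the axioms of dg functors: those for `right`
say that each object goes to a dg functor, those for `eps` that morphisms go functorially to reduced
cochains. -/
theorem uncurry_isTwisted (J : DGFunctor D (Coh E X)) : (uncurry J).IsTwisted where
  right_linear d {_ _ _} a b g g' := by
    simp only [uncurry, map_add, map_smul]
    rfl
  right_id d e := (J.obj d).map_id e
  right_comp d {_ _ _ _ _ _} h g g' := (J.obj d).toMap.map_comp h g g'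
  right_d d {_ _ _ _} h g := (J.obj d).toMap.map_d h g
  eps_linear {_ _ _} a b f f' := by
    simp only [uncurry, map_add, map_smul]
    rfl
  eps_reduced f := Subtype.property (J.map f)
  eps_id d := congrArg Coh.val (J.map_id d)
  eps_comp {_ _ _ _ _ _} h f g := congrArg Coh.val (J.toMap.map_comp h f g)
  eps_d {_ _ _ _} h f := congrArg Coh.val (J.toMap.map_d h f)

variable {P : Pairing D E Y} {d d' : D.Obj} {e e' : E.Obj} {p q n m : ℤ}

section

variable {F G : DGFunctor Y X} {A : PreCochain Y X F.obj G.obj p}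

/-- The coherent natural transformation of values of a cochain on interleavings. -/
def IsTwisted.braceHom (hP : P.IsTwisted) (hA : A.IsReduced) (gs : Chain D d d') :
    (Coh E X).Hom ((hP.postcomp F).curryObj d) ((hP.postcomp G).curryObj d') (p + gs.deg) :=
  ⟨P.braceVal A gs, hP.braceVal_isReduced hA gs⟩

theorem IsTwisted.evalChain_castTo_braceHom (hP : P.IsTwisted) (hA : A.IsReduced)
    (gs : Chain D d d') (hs : Chain E e e') (N : ℤ) :
    Coh.evalChain hs ((Coh E X).castTo N (hP.braceHom hA gs)) = P.sumInt gs hs fun c =>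
      X.castTo (N + hs.deg) (A _ _ c) :=
  (Coh.evalChain_castTo N (hP.braceHom hA gs) hs).trans (castTo_braceVal A gs hs (N + hs.deg))

/-- The cochain with values in coherent natural transformations determined by a cochain. -/
def IsTwisted.braceCochain (hP : P.IsTwisted) (hA : A.IsReduced) :
    PreCochain D (Coh E X) (hP.postcomp F).curryObj (hP.postcomp G).curryObj p :=
  fun _ _ gs => hP.braceHom hA gs

/-- Equalities in `Coh E X` are tested on each E-chain, where they become linearity and
normalization of the sum over interleavings in its D-chain. -/
theorem IsTwisted.braceCochain_isReduced (hP : P.IsTwisted) (hA : A.IsReduced) :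
    (hP.braceCochain hA).IsReduced := by
  refine isReduced_of (fun x z N => ⟨fun l a b f g r => Coh.ext fun {e e'} hs => ?_⟩)
    fun l r => Coh.ext fun {e e'} hs => ?_
  · rw [map_add, map_smul, map_smul]
    refine (hP.evalChain_castTo_braceHom hA _ hs N).trans (Eq.trans ?_ (congrArg₂ (a • · + b • ·)
      (hP.evalChain_castTo_braceHom hA _ hs N) (hP.evalChain_castTo_braceHom hA _ hs N)).symm)
    exact (hP.isLin_sumInt_left hs (hA.isLin _ _ (N + hs.deg))).lin l a b f g r
  · exact (hP.isNormalized_sumInt_left hs (hA.isLin _ _ _)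
      ⟨fun l r => by rw [hA.normalized, map_zero]⟩).zero l r

end

section

variable {F G H : DGFunctor Y X}

/-- The unit cochain vanishes on nonempty chains, and the only empty interleaving is that of two
empty chains. -/
theorem IsTwisted.braceCochain_one (hP : P.IsTwisted) (F : DGFunctor Y X) :
    hP.braceCochain (F := F) (G := F) one_isReduced = one (hP.postcomp F).curryObj := by
  funext d d' gs
  refine Coh.ext fun {e e'} hs => ?_
  refine (P.sumInt_of_cons_eq_zero gs hs (one_isReduced.isLin _ _ _) fun f c =>
    (map_zero _)).trans ?_
  cases gs with
  | nil =>
    refine Eq.trans ?_ (Coh.evalChain_castTo (0 + 0) ((Coh E X).id ((hP.postcomp F).curryObj d))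
      hs).symm
    cases hs with
    | nil => rfl
    | cons h hs => exact (map_zero _).symm
  | cons g gs => rfl

/-- Compatibility of interleavings with deconcatenation, in the form `sumInt_conv`; the signs there
are those of `evalChain_conv`. -/
theorem IsTwisted.braceCochain_conv (hP : P.IsTwisted) (h : p + q = n)
    {A : PreCochain Y X G.obj H.obj p} {B : PreCochain Y X F.obj G.obj q} (hA : A.IsReduced)
    (hB : B.IsReduced) : hP.braceCochain (conv_isReduced h hA hB) =
      conv n (hP.braceCochain hA) (hP.braceCochain hB) := by
  funext d d' gs
  refine Coh.ext fun {e e'} hs => ?_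
  refine Eq.trans ?_ (evalChain_conv _ _ h gs hs).symm
  exact P.sumInt_conv A B hA.isLin hB.isLin gs hs (by ring)

/-- The part of the twisting cochain of a dg functor supported on morphisms of the second factor. -/
def rightTau (P : Pairing D E Y) (F : DGFunctor Y X) (N : ℤ) :
    ∀ {d d' : D.Obj} (_ : Chain D d d') {e e' : E.Obj} (_ : Chain E e e'),
      X.Hom (F.obj (P.obj d e)) (F.obj (P.obj d' e')) N
  | d, _, .nil, e, e', hs => X.castTo N
      (tau (fun e => F.obj (P.obj d e)) (fun h => F.map (P.right d h)) e e' hs)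
  | _, _, .cons _ _, _, _, _ => 0

/-- The values of the twisting cochain of the dg functor determined by a twisted pairing. -/
def IsTwisted.tauVal (hP : P.IsTwisted) (F : DGFunctor Y X) (gs : Chain D d d')
    (hs : Chain E e e') :
    X.Hom (F.obj (P.obj d e)) (F.obj (P.obj d' e')) (1 + gs.deg + hs.deg) :=
  Coh.evalChain hs
    (tau (hP.postcomp F).curryObj (fun g => (hP.postcomp F).curryHom g) d d' gs)

/-- As `tau` is supported on chains of length one, only the image of the letter under F survives.
Letters without D-entry form `rightTau`, which enters the differential of `Coh E X`; letters with
one D-entry form `tauVal`, which enters the outer twisting. -/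
theorem IsTwisted.braceVal_tau (hP : P.IsTwisted) (F : DGFunctor Y X) (gs : Chain D d d')
    (hs : Chain E e e') :
    P.braceVal (tau F.obj fun f => F.map f) gs e e' hs =
      P.rightTau F (1 + gs.deg + hs.deg) gs hs + hP.tauVal F gs hs := by
  refine (P.sumInt_of_cons_cons_eq_zero gs hs (tau_isLin F _ _ _) fun f g c =>
    (congrArg _ (tau_cons_cons ..)).trans (map_zero _)).trans ?_
  have h₀ : (P.nilPart gs hs fun c => X.castTo (1 + gs.deg + hs.deg)
      (tau F.obj (fun f => F.map f) (P.obj d e) (P.obj d' e') c)) = 0 := by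
    cases gs with
    | nil =>
      cases hs with
      | nil => exact (congrArg _ (tau_nil ..)).trans (map_zero _)
      | cons h hs => rfl
    | cons g gs => rfl
  rw [h₀, zero_add, tau_cons_nil, X.castTo_castTo _ (by simp)]
  match gs with
  | .nil =>
    refine Eq.trans ?_ (add_zero _).symm
    rw [letter_nil, F.map_castTo, X.castTo_castTo _ (by simp)]
    exact congrArg _ (congrFun (congrFun (congrFun (push_tau F fun h => P.right d h) e) e') hs)
  | .cons (n := n) g .nil =>
    refine Eq.trans ?_ (zero_add _).symm
    rw [letter_single, F.map_castTo, X.castTo_castTo _ (by simp; ring)]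
    exact (Coh.evalChain_castTo _ ((hP.postcomp F).curryHom g) hs).symm
  | .cons g (.cons g' gs) =>
    refine Eq.trans ?_ (zero_add _).symm
    rw [letter_cons_cons, map_zero, map_zero]
    rfl

/-- The interleaving map carries the twisting cochain of a dg functor on Y to the sum of an inner
and an outer one, and commutes with the bar differentials. The two differentials therefore agree
term by term. -/
theorem IsTwisted.braceCochain_diff (hP : P.IsTwisted) (h : p + 1 = m)
    {A : PreCochain Y X F.obj G.obj p} (hA : A.IsReduced) :
    hP.braceCochain (diff_isReduced hA h) = diff (F := (hP.postcomp F).curryObj)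
      (G := (hP.postcomp G).curryObj) (fun g => (hP.postcomp G).curryHom g)
      (fun g => (hP.postcomp F).curryHom g) m (hP.braceCochain hA) := by
  funext d d' gs
  refine Coh.ext fun {e e'} hs => ?_
  have hA' := hA.isLin
  have e₂ : Coh.evalChain hs (diff (F := (hP.postcomp F).curryObj)
      (G := (hP.postcomp G).curryObj) (fun g => (hP.postcomp G).curryHom g)
      (fun g => (hP.postcomp F).curryHom g) m (hP.braceCochain hA) d d' gs) =
      ((X.dTo (m + gs.deg + hs.deg) (P.braceVal A gs e e' hs) - sgn k (p + gs.deg) •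
          hs.sumBar fun t => X.castTo (m + gs.deg + hs.deg) (P.braceVal A gs e e' t)) +
        (hs.sumCuts fun t => sgn k ((p + gs.deg) * t.left.deg) • X.compTo (m + gs.deg + hs.deg)
          (tau (fun e => G.obj (P.obj d' e)) (fun h => G.map (P.right d' h)) t.mid e' t.left)
          (P.braceVal A gs e t.mid t.right)) -
        sgn k (p + gs.deg) • hs.sumCuts fun t => sgn k (1 * t.left.deg) •
          X.compTo (m + gs.deg + hs.deg) (P.braceVal A gs t.mid e' t.left)
          (tau (fun e => F.obj (P.obj d e)) (fun h => F.map (P.right d h)) e t.mid t.right)) -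
      (sgn k p • gs.sumBar fun t => X.castTo (m + gs.deg + hs.deg) (P.braceVal A t e e' hs)) +
      (gs.sumCuts fun s => sgn k (p * s.left.deg) • hs.sumCuts fun t =>
        sgn k ((p + s.right.deg) * t.left.deg) • X.compTo (m + gs.deg + hs.deg)
          (hP.tauVal G s.left t.left) (P.braceVal A s.right e t.mid t.right)) -
      sgn k p • gs.sumCuts fun s => sgn k (1 * s.left.deg) • hs.sumCuts fun t =>
        sgn k ((1 + s.right.deg) * t.left.deg) • X.compTo (m + gs.deg + hs.deg)
          (P.braceVal A s.left t.mid e' t.left) (hP.tauVal F s.right t.right) :=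
    evalChain_diff _ _ (hP.braceCochain hA) h gs hs
  simp only [castTo_braceVal] at e₂
  set N := m + gs.deg + hs.deg with hN
  -- The differential on Y splits into its bar part and its two actions, which are treated in e₃, e₆
  -- and e₇.
  have e₁ : P.braceVal (diffF m A) gs e e' hs =
      (P.sumInt gs hs fun c => X.castTo N (bdry m A _ _ c)) +
      (P.sumInt gs hs fun c => X.castTo N (conv m (tau G.obj fun f => G.map f) A _ _ c)) +
      -(sgn k p) • P.sumInt gs hs fun c =>
        X.castTo N (conv m A (tau F.obj fun f => F.map f) _ _ c) := by
    rw [smul_sumInt, ← sumInt_add, ← sumInt_add]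
    refine P.sumInt_congr gs hs fun c _ => ?_
    rw [neg_smul, ← sub_eq_add_neg, ← map_add, ← map_smul, ← map_sub]
    rfl
  -- By `sumInt_sumBar` the bar part becomes the bar differential of the pair: its `gs` summand is
  -- the outer bar differential, and its `hs` summand, carrying the sign of `gs.deg`, the inner one.
  have e₃ : (P.sumInt gs hs fun c => X.castTo N (bdry m A _ _ c)) =
      X.dTo N (P.braceVal A gs e e' hs) -
        sgn k p • sumBar₂ gs hs fun c c' => P.sumInt c c' fun b => X.castTo N (A _ _ b) := by
    rw [P.sumInt_congr gs hs fun c hc => castTo_bdry A c (by omega),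
      ← hP.sumInt_sumBar gs hs _ (hA' _ _ N), sub_eq_add_neg, ← neg_smul, smul_sumInt, braceVal,
      map_sumInt, ← sumInt_add]
    refine P.sumInt_congr gs hs fun c hc => ?_
    rw [X.dTo_castTo _ (by omega), neg_smul, sub_eq_add_neg]
  -- In the left action `rightTau` forces the left D-piece to be empty and gives the left action
  -- inside `Coh E X`, while `tauVal` gives the outer left action.
  have e₆ : (P.sumInt gs hs fun c =>
      X.castTo N (conv m (tau G.obj fun f => G.map f) A _ _ c)) =
      (hs.sumCuts fun t => sgn k ((p + gs.deg) * t.left.deg) • X.compTo N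
        (tau (fun e => G.obj (P.obj d' e)) (fun h => G.map (P.right d' h)) t.mid e' t.left)
        (P.braceVal A gs e t.mid t.right)) +
      gs.sumCuts fun s => sgn k (p * s.left.deg) • hs.sumCuts fun t =>
        sgn k ((p + s.right.deg) * t.left.deg) • X.compTo N
          (hP.tauVal G s.left t.left) (P.braceVal A s.right e t.mid t.right) := by
    rw [sumInt_conv _ A (tau_isLin G) hA' gs hs (by omega)]
    simp only [hP.braceVal_tau, map_add, LinearMap.add_apply, smul_add, sumCuts_add]
    congr 1
    rw [sumCuts_first gs fun u a a' => sgn k (p * a.deg) • hs.sumCuts fun t =>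
      sgn k ((p + a'.deg) * t.left.deg) • X.compTo N
        (P.rightTau G (1 + a.deg + t.left.deg) a t.left)
        (P.braceVal A a' e t.mid t.right)]
    · rw [show sgn k (p * (nil : Chain D d' d').deg) = 1 by rw [deg_nil, mul_zero, sgn_zero],
        one_smul]
      refine sumCuts_congr _ fun t _ => congrArg _ ?_
      exact X.compTo_castTo_left _ (by simp) _ _
    · intro v y n f l r
      refine (congrArg _ (sumCuts_zero _ fun t _ => ?_)).trans (smul_zero _)
      simp only [rightTau, map_zero, LinearMap.zero_apply, smul_zero]
  -- In the right action `rightTau` forces the right D-piece to be empty. The degree-one cochain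
  -- then passes all of `gs`, which produces the sign of `gs.deg` and turns the prefactor `sgn k p`
  -- into that of `p + gs.deg`.
  have e₇ : (P.sumInt gs hs fun c =>
      X.castTo N (conv m A (tau F.obj fun f => F.map f) _ _ c)) =
      sgn k gs.deg • (hs.sumCuts fun t => sgn k (1 * t.left.deg) • X.compTo N
        (P.braceVal A gs t.mid e' t.left)
        (tau (fun e => F.obj (P.obj d e)) (fun h => F.map (P.right d h)) e t.mid t.right)) +
      gs.sumCuts fun s => sgn k (1 * s.left.deg) • hs.sumCuts fun t =>
        sgn k ((1 + s.right.deg) * t.left.deg) • X.compTo N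
          (P.braceVal A s.left t.mid e' t.left) (hP.tauVal F s.right t.right) := by
    rw [sumInt_conv A _ hA' (tau_isLin F) gs hs (by omega)]
    simp only [hP.braceVal_tau, map_add, smul_add, sumCuts_add]
    congr 1
    rw [sumCuts_last gs fun u a a' => sgn k (1 * a.deg) • hs.sumCuts fun t =>
      sgn k ((1 + a'.deg) * t.left.deg) • X.compTo N
        (P.braceVal A a t.mid e' t.left)
        (P.rightTau F (1 + a'.deg + t.right.deg) a' t.right)]
    · rw [one_mul]
      refine congrArg _ (sumCuts_congr _ fun t _ => ?_)
      exact congrArg _ (X.compTo_castTo_right _ (by simp) _ _)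
    · intro v y n f l r
      refine (congrArg _ (sumCuts_zero _ fun t _ => ?_)).trans (smul_zero _)
      simp only [rightTau, map_zero, smul_zero]
  refine e₁.trans (Eq.trans ?_ e₂.symm)
  rw [e₃, e₆, e₇, sumBar₂, sgn_add]
  module

end

theorem braceVal_add {F G : Y.Obj → X.Obj} (P : Pairing D E Y) (A B : PreCochain Y X F G p)
    (gs : Chain D d d') : P.braceVal (A + B) gs = P.braceVal A gs + P.braceVal B gs := by
  funext e e' hs
  refine Eq.trans ?_ (P.sumInt_add gs hs _ _)
  exact P.sumInt_congr gs hs fun c _ => map_add _ _ _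

theorem braceVal_smul {F G : Y.Obj → X.Obj} (P : Pairing D E Y) (a : k)
    (A : PreCochain Y X F G p) (gs : Chain D d d') :
    P.braceVal (a • A) gs = a • P.braceVal A gs := by
  funext e e' hs
  refine Eq.trans ?_ (P.smul_sumInt gs hs a _).symm
  exact P.sumInt_congr gs hs fun c _ => map_smul _ _ _

/-- The action on objects of the dg functor `IsTwisted.brace`. -/
def IsTwisted.braceObj (hP : P.IsTwisted) (F : (Coh Y X).Obj) : (Coh D (Coh E X)).Obj :=
  (hP.postcomp F).curry

/-- The dg functor `Coh(Y, X) ⟶ Coh(D, Coh(E, X))` determined by a twisted pairing of `D` and `E`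
with values in `Y`. -/
def IsTwisted.brace (hP : P.IsTwisted) (X : DGCat k) :
    DGFunctor (Coh Y X) (Coh D (Coh E X)) where
  obj := hP.braceObj
  toMap :=
    { map :=
        { toFun := fun A => ⟨hP.braceCochain A.2, hP.braceCochain_isReduced A.2⟩
          map_add' := fun A B => Coh.ext fun gs => Coh.ext fun {e e'} hs =>
            congrFun (congrFun (congrFun (P.braceVal_add A.1 B.1 gs) e) e') hs
          map_smul' := fun a A => Coh.ext fun gs => Coh.ext fun {e e'} hs =>
            congrFun (congrFun (congrFun (P.braceVal_smul a A.1 gs) e) e') hs }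
      map_id := fun F => Subtype.ext (hP.braceCochain_one F)
      map_comp := fun h A B => Subtype.ext (hP.braceCochain_conv h A.2 B.2)
      map_d := fun h A => Subtype.ext (hP.braceCochain_diff h A.2) }

end Pairing
end Twisted

/-! ### Existence and uniqueness of the associator; existence of the twisted composition. -/

namespace Twisted

variable {k : Type u} [Field k]

open PreCochain

/-- Evaluation is the pairing obtained by uncurrying the identity of `Coh C D`. -/
theorem evalPairing_isTwisted (C D : DGCat k) : (evalPairing C D).IsTwisted :=
  Pairing.uncurry_isTwisted (DGFunctor.id (Coh C D))

theorem PreCochain.diff_congr {C D : DGCat k} {F G : C.Obj → D.Obj} {p : ℤ} (m : ℤ)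
    {φ φ' : ∀ {x y : C.Obj} {n : ℤ}, C.Hom x y n → D.Hom (G x) (G y) n}
    {ψ ψ' : ∀ {x y : C.Obj} {n : ℤ}, C.Hom x y n → D.Hom (F x) (F y) n}
    {A A' : PreCochain C D F G p}
    (hφ : ∀ {x y : C.Obj} {n : ℤ} (f : C.Hom x y n), φ f = φ' f)
    (hψ : ∀ {x y : C.Obj} {n : ℤ} (f : C.Hom x y n), ψ f = ψ' f) (hA : A = A') :
    diff φ ψ m A = diff φ' ψ' m A' := by
  have h₁ : tau G φ = tau G φ' := by
    funext x y c
    match c with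
    | .nil => rfl
    | .cons f .nil => rw [tau_cons_nil, tau_cons_nil, hφ]
    | .cons f (.cons g c) => rfl
  have h₂ : tau F ψ = tau F ψ' := by
    funext x y c
    match c with
    | .nil => rfl
    | .cons f .nil => rw [tau_cons_nil, tau_cons_nil, hψ]
    | .cons f (.cons g c) => rfl
  rw [diff, diff, h₁, h₂, hA]

namespace TT

open Chain

variable {C D E X : DGCat k}

/-- The one-sided associator in curried form. -/
def assocCurried (C D E : DGCat k) : DGFunctor (TT C D) (Coh E (TT C (TT D E))) :=
  -- With Y = `TT C (TT D E)`: the curried universal pairing goes from C to `Coh (TT D E) Y`, the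
  -- brace goes on to `Coh D (Coh E Y)`, and the composite is uncurried in D.
  (lift _ (Pairing.uncurry_isTwisted ((univ_isTwisted C (TT D E)).curry.comp
    ((univ_isTwisted D E).brace (TT C (TT D E)))))).functor

/-- The one-sided associator. -/
def assoc (C D E : DGCat k) :
    DGMap (TT (TT C D) E) (TT C (TT D E)) fun x => TT.obj x.1.1 (TT.obj x.1.2 x.2) :=
  lift _ (Pairing.uncurry_isTwisted (assocCurried C D E))

/-- The values on generators hold by computation: `lift` returns the value of the pairing, the
universal pairing returns the generators themselves, and the brace is by definition the signed sum
over `interleave`. -/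
theorem assoc_isAssociator (C D E : DGCat k) : IsAssociator (assoc C D E) where
  right _ _ {_ _ _} _ := rfl
  eps_right _ {_ _ _} _ {_ _} _ := rfl
  eps_eps {_ _ _} _ {_ _} _ {_ _} _ := rfl

/-- The twisted composition. -/
def twistedComp (A B C : DGCat k) :
    DGMap (TT (Coh B C) (Coh A B)) (Coh A C) fun x => DGFunctor.comp x.2 x.1 :=
  lift _ (Pairing.uncurry_isTwisted ((evalPairing_isTwisted A B).brace C))

theorem twistedComp_isTwistedComposition (A B C : DGCat k) :
    IsTwistedComposition (twistedComp A B C) where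
  right _ {_ _ _} _ {_ _} _ := rfl
  eps {_ _ _} _ {_ _} _ {_ _} _ := rfl

/-- A dg functor out of an iterated twisted tensor product is determined by its values on
`id ⊗ h`, `ε(id ⊗ g; h_1, …, h_N)` and `ε(ε(f; g_1, …, g_M); h_1, …, h_N)`. -/
theorem map_ext_left {o : (TT (TT C D) E).Obj → X.Obj} {F G : DGMap (TT (TT C D) E) X o}
    (h₁ : ∀ (c : C.Obj) (d : D.Obj) {e e' : E.Obj} {n : ℤ} (h : E.Hom e e' n),
      F.map (right (C := TT C D) (obj c d) h) = G.map (right (C := TT C D) (obj c d) h))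
    (h₂ : ∀ (c : C.Obj) {d d' : D.Obj} {n : ℤ} (g : D.Hom d d' n) {e e' : E.Obj}
      (hs : Chain E e e'), F.map (eps (C := TT C D) (right c g) hs) =
        G.map (eps (C := TT C D) (right c g) hs))
    (h₃ : ∀ {c c' : C.Obj} {p : ℤ} (f : C.Hom c c' p) {d d' : D.Obj} (gs : Chain D d d')
      {e e' : E.Obj} (hs : Chain E e e'), F.map (eps (C := TT C D) (eps f gs) hs) =
        G.map (eps (C := TT C D) (eps f gs) hs)) : F = G := by
  refine map_ext (fun x => h₁ x.1 x.2) ?_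
  have hU := univ_isTwisted (TT C D) E
  -- Agreement of F and G on `ε(f; -)` is a property of f, proved by induction on a formal
  -- expression for f. The relations express `ε` of a sum, multiple, identity, composite or
  -- differential through `ε` of the constituents, and `push` transports them along F and G.
  have key : ∀ {x y : (TT C D).Obj} {n : ℤ} (s : TTTerm C D x y n),
      push F.functor ((univ (TT C D) E).eps (TTHom.mk s : (TT C D).Hom x y n)) =
        push G.functor ((univ (TT C D) E).eps (TTHom.mk s : (TT C D).Hom x y n)) := by
    intro x y n s
    have hlin : ∀ (H : DGMap (TT (TT C D) E) X o) {x y : (TT C D).Obj} {n : ℤ} (a b : k)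
        (f g : (TT C D).Hom x y n),
        push H.functor ((univ (TT C D) E).eps (a • f + b • g)) =
          a • push H.functor ((univ (TT C D) E).eps f) +
          b • push H.functor ((univ (TT C D) E).eps g) := by
      intro H x y n a b f g
      rw [hU.eps_linear]
      funext e e' hs
      refine (map_add (H.functor.map (x := (x, e)) (y := (y, e')) (n := n + hs.deg))
        (a • eps (C := TT C D) f hs) (b • eps (C := TT C D) g hs)).trans ?_
      exact congrArg₂ (· + ·)
        (map_smul (H.functor.map (x := (x, e)) (y := (y, e')) (n := n + hs.deg)) a
          (eps (C := TT C D) f hs))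
        (map_smul (H.functor.map (x := (x, e)) (y := (y, e')) (n := n + hs.deg)) b
          (eps (C := TT C D) g hs))
    have hzero : ∀ (H : DGMap (TT (TT C D) E) X o) (x y : (TT C D).Obj) (n : ℤ),
        push H.functor ((univ (TT C D) E).eps (0 : (TT C D).Hom x y n)) = 0 := fun H x y n => by
      simpa using hlin H 0 0 (0 : (TT C D).Hom x y n) 0
    have hadd : ∀ (H : DGMap (TT (TT C D) E) X o) {x y : (TT C D).Obj} {n : ℤ}
        (f g : (TT C D).Hom x y n), push H.functor ((univ (TT C D) E).eps (f + g)) =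
          push H.functor ((univ (TT C D) E).eps f) +
            push H.functor ((univ (TT C D) E).eps g) := fun H x y n f g => by
      simpa using hlin H 1 1 f g
    have hsmul : ∀ (H : DGMap (TT (TT C D) E) X o) {x y : (TT C D).Obj} {n : ℤ} (a : k)
        (f : (TT C D).Hom x y n), push H.functor ((univ (TT C D) E).eps (a • f)) =
          a • push H.functor ((univ (TT C D) E).eps f) := fun H x y n a f => by
      simpa using hlin H a 0 f 0
    -- The formula for `ε(df; -)` also contains composites with `id ⊗ h`, so the agreement h₁ is
    -- needed here too.
    have hd : ∀ {x y : (TT C D).Obj} {n m : ℤ} (h : n + 1 = m) (f : (TT C D).Hom x y n),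
        push F.functor ((univ (TT C D) E).eps f) = push G.functor ((univ (TT C D) E).eps f) →
        push F.functor ((univ (TT C D) E).eps ((TT C D).d h f)) =
          push G.functor ((univ (TT C D) E).eps ((TT C D).d h f)) := by
      intro x y n m h f hf
      have e₀ : ∀ H : DGMap (TT (TT C D) E) X o,
          push H.functor ((univ (TT C D) E).eps ((TT C D).d h f)) =
            diff (F := fun e => o (x, e)) (G := fun e => o (y, e))
              (fun g => H.map (right (C := TT C D) y g)) (fun g => H.map (right (C := TT C D) x g))
              m (push H.functor ((univ (TT C D) E).eps f)) := fun H =>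
        (congrArg (push H.functor) (hU.eps_d h f)).trans (push_diff H.functor _ _ _)
      exact (e₀ F).trans ((diff_congr m (fun g => h₁ y.1 y.2 g) (fun g => h₁ x.1 x.2 g) hf).trans
        (e₀ G).symm)
    induction s with
    | right c g => exact funext fun e => funext fun e' => funext fun hs => h₂ c g hs
    | eps f gs => exact funext fun e => funext fun e' => funext fun hs => h₃ f gs hs
    | @zero x y n => exact (hzero F x y n).trans (hzero G x y n).symm
    | @add x y n s t hs ht =>
      exact (hadd F (TTHom.mk s) (TTHom.mk t)).trans ((congrArg₂ (· + ·) hs ht).trans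
        (hadd G (TTHom.mk s) (TTHom.mk t)).symm)
    | @smul x y n a s hs =>
      exact (hsmul F a (TTHom.mk s)).trans ((congrArg (a • ·) hs).trans
        (hsmul G a (TTHom.mk s)).symm)
    | id x =>
      have h0 : ∀ H : DGMap (TT (TT C D) E) X o, push H.functor ((univ (TT C D) E).eps
          ((TT C D).id x)) = one fun e => o (x, e) := fun H =>
        (congrArg (push H.functor) (hU.eps_id x)).trans (push_one H.functor)
      exact (h0 F).trans (h0 G).symm
    | @comp x y z p q n h s t hs ht =>
      have h0 : ∀ (H : DGMap (TT (TT C D) E) X o) (f : (TT C D).Hom y z p)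
          (g : (TT C D).Hom x y q), push H.functor ((univ (TT C D) E).eps ((TT C D).comp h f g)) =
            conv n (push H.functor ((univ (TT C D) E).eps f))
              (push H.functor ((univ (TT C D) E).eps g)) := fun H f g =>
        (congrArg (push H.functor) (hU.eps_comp h f g)).trans (push_conv H.functor _ _)
      exact (h0 F (TTHom.mk s) (TTHom.mk t)).trans ((congrArg₂ (conv n) hs ht).trans
        (h0 G (TTHom.mk s) (TTHom.mk t)).symm)
    | @d x y n m h s hs => exact hd h (TTHom.mk s) hs
  intro x y p f e e' hs
  induction f using Quotient.inductionOn with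
  | h s => exact congrFun (congrFun (congrFun (key s) e) e') hs

theorem existsUnique_isAssociator (C D E : DGCat k) :
    ∃! α : DGMap (TT (TT C D) E) (TT C (TT D E)) fun x => obj x.1.1 (obj x.1.2 x.2),
      IsAssociator α :=
  ⟨assoc C D E, assoc_isAssociator C D E, fun _ hα => map_ext_left
    (fun c d _ _ _ h => (hα.right c d h).trans ((assoc_isAssociator C D E).right c d h).symm)
    (fun c _ _ _ g _ _ hs =>
      (hα.eps_right c g hs).trans ((assoc_isAssociator C D E).eps_right c g hs).symm)
    fun f _ _ gs _ _ hs =>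
      (hα.eps_eps f gs hs).trans ((assoc_isAssociator C D E).eps_eps f gs hs).symm⟩

end TT
end Twisted

/-! ### Interleavings of three chains. -/

namespace Twisted

variable {k : Type u} [Field k]

open PreCochain

namespace Chain

variable {C D : DGCat k} {M : Type u} [AddCommGroup M] [Module k M]

theorem isLin_zero {x z : C.Obj} : IsLin fun _ : Chain C x z => (0 : M) :=
  ⟨fun _ _ _ _ _ _ => by simp⟩

theorem IsLin.congr {x z : C.Obj} {φ ψ : Chain C x z → M} (hφ : IsLin φ) (h : ∀ c, φ c = ψ c) :
    IsLin ψ := (funext h : φ = ψ) ▸ hφ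

end Chain

namespace Pairing

open Chain

variable {D E X Y : DGCat k} {M : Type u} [AddCommGroup M] [Module k M] {P : Pairing D E Y}
  {d d' : D.Obj} {e e' : E.Obj}

theorem IsTwisted.isLin_letter_right (hP : P.IsTwisted) (gs : Chain D d d') (N : ℤ) :
    IsLin fun hs : Chain E e e' => Y.castTo N (P.letter gs hs) := by
  match gs with
  | .nil =>
    refine (tau_isLin (hP.rightFunctor d) e e' N).congr fun hs => ?_
    exact (Y.castTo_castTo _ (by simp) _).symm
  | .cons g .nil =>
    refine ((hP.eps_reduced g).isLin e e' N).congr fun hs => ?_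
    rw [letter_single]
    exact (Y.castTo_castTo _ (by simp; ring) _).symm
  | .cons g (.cons g' gs) =>
    refine isLin_zero.congr fun hs => ?_
    rw [letter_cons_cons, map_zero]

theorem IsTwisted.isLin_letter_left (hP : P.IsTwisted) (hs : Chain E e e') (N : ℤ) :
    IsLin fun gs : Chain D d d' => Y.castTo N (P.letter gs hs) := by
  have h₀ : ∀ {y w : D.Obj} {n m : ℤ} (f : D.Hom w d' n) (g : D.Hom y w m)
      (r : Chain D d y), Y.castTo N (P.letter (cons f (cons g r)) hs) = 0 := fun f g r =>
    (congrArg _ (letter_cons_cons ..)).trans (map_zero _)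
  have h₁ : ∀ {n : ℤ} (f : D.Hom d d' n), Y.castTo N (P.letter (cons f nil) hs) =
      Y.castTo N (P.eps f e e' hs) := fun f =>
    (congrArg _ (letter_single ..)).trans (Y.castTo_castTo _ (by simp; ring) _)
  refine ⟨fun {y w n} l a b f g r => ?_⟩
  have h₂ : ∀ {x y z : Y.Hom (P.obj d e) (P.obj d' e') N}, x = 0 → y = 0 → z = 0 →
      x = a • y + b • z := by
    rintro x y z rfl rfl rfl
    simp
  cases l with
  | nil =>
    cases r with
    | nil =>
      refine (h₁ _).trans (Eq.trans ?_ (congrArg₂ (a • · + b • ·) (h₁ f) (h₁ g)).symm)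
      have h := (Y.castTo N).congr_arg (congrFun (congrFun (congrFun (hP.eps_linear a b f g) e) e')
        hs)
      rw [h]
      exact (map_add (Y.castTo N) (a • P.eps f e e' hs) (b • P.eps g e e' hs)).trans
        (congrArg₂ (· + ·) (map_smul (Y.castTo N) a (P.eps f e e' hs))
          (map_smul (Y.castTo N) b (P.eps g e e' hs)))
    | cons g' r => exact h₂ (h₀ ..) (h₀ ..) (h₀ ..)
  | cons g' l => cases l <;> exact h₂ (h₀ ..) (h₀ ..) (h₀ ..)

/-- Multilinearity only concerns chains with at least one entry, and on these `nilPart` is zero. -/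
theorem isLin_nilPart_right (P : Pairing D E Y) (gs : Chain D d d')
    (φ : Chain Y (P.obj d e) (P.obj d' e') → M) :
    IsLin fun hs => P.nilPart gs hs φ := by
  refine ⟨fun {y w n} l a b f g r => ?_⟩
  cases gs <;> cases l <;> simp [nilPart]

theorem isLin_nilPart_left (P : Pairing D E Y) (hs : Chain E e e')
    (φ : Chain Y (P.obj d e) (P.obj d' e') → M) :
    IsLin fun gs => P.nilPart gs hs φ := by
  refine ⟨fun {y w n} l a b f g r => ?_⟩
  cases l <;> simp [nilPart]

theorem nilPart_eq_zero (P : Pairing D E Y) (gs : Chain D d d') (hs : Chain E e e')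
    {φ : Chain Y (P.obj d e) (P.obj d' e') → M}
    (h : ∀ hd : d = d', ∀ he : e = e', φ (hd ▸ he ▸ nil) = 0) : P.nilPart gs hs φ = 0 := by
  cases gs with
  | nil =>
    cases hs with
    | nil => exact h rfl rfl
    | cons h hs => rfl
  | cons g gs => rfl

/-- A sum over interleavings as a linear function of the last applied morphism. -/
def sumIntHead (P : Pairing D E Y) (gs : Chain D d d') (hs : Chain E e e') {y : Y.Obj} {n : ℤ}
    {φ : Chain Y (P.obj d e) y → M} (hφ : IsLin φ) : Y.Hom (P.obj d' e') y n →ₗ[k] M where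
  toFun f := P.sumInt gs hs fun c => φ (cons f c)
  map_add' f g := by
    rw [← sumInt_add]
    exact P.sumInt_congr _ _ fun c _ => map_add (hφ.headMap c) f g
  map_smul' a f := by
    rw [RingHom.id_apply, smul_sumInt]
    exact P.sumInt_congr _ _ fun c _ => map_smul (hφ.headMap c) a f

/-- The dg functor `Coh(Y, X) ⊗ D ⟶ Coh(E, X)` determined by a twisted pairing of `D` and `E` with
values in `Y`. -/
def IsTwisted.braceMap (hP : P.IsTwisted) (X : DGCat k) :
    DGMap (TT (Coh Y X) D) (Coh E X) fun x => (hP.braceObj x.1).obj x.2 :=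
  TT.lift _ (uncurry_isTwisted (hP.brace X))

/-- The twisted pairing of `Coh(Y, X) ⊗ D` and `E` with values in `X` determined by a twisted
pairing of `D` and `E` with values in `Y`. -/
def IsTwisted.bracePairing (hP : P.IsTwisted) (X : DGCat k) : Pairing (TT (Coh Y X) D) E X :=
  uncurry (hP.braceMap X).functor

theorem IsTwisted.bracePairing_isTwisted (hP : P.IsTwisted) (X : DGCat k) :
    (hP.bracePairing X).IsTwisted := uncurry_isTwisted _

theorem IsTwisted.castTo_bracePairing_eps (hP : P.IsTwisted) {F F' : (Coh Y X).Obj} {p : ℤ}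
    (Θ : (Coh Y X).Hom F F' p) (gs : Chain D d d') (hs : Chain E e e') {n : ℤ}
    (h : p + gs.deg = n) (N : ℤ) :
    X.castTo N ((hP.bracePairing X).eps ((TT (Coh Y X) D).castTo n (TT.eps Θ gs)) e e' hs) =
      P.sumInt gs hs fun l => X.castTo N (Coh.val Θ _ _ l) := by
  subst h
  rw [(TT (Coh Y X) D).castTo_self]
  exact castTo_braceVal (Coh.val Θ) gs hs N

/-- On the objects and morphisms `id_F ⊗ -`, the brace pairing is P followed by F, so the two
letters agree for each possible shape of the chains. -/
theorem IsTwisted.letter_bracePairing_rightChain (hP : P.IsTwisted) (F : (Coh Y X).Obj)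
    (gs : Chain D d d') (hs : Chain E e e') (N : ℤ) :
    X.castTo N ((hP.bracePairing X).letter ((TT.univ (Coh Y X) D).rightChain F gs) hs) =
      X.castTo N (Coh.fmap F (P.letter gs hs)) := by
  have hF : ∀ {y y' : Y.Obj} {n m : ℤ} (_ : n = m) (f : Y.Hom y y' n),
      X.castTo N (Coh.fmap F (Y.castTo m f)) = X.castTo N (Coh.fmap F f) := by
    intro y y' n m h f
    subst h
    rw [Y.castTo_self]
  match gs with
  | .nil =>
    match hs with
    | .nil => exact congrArg (X.castTo N) ((map_zero _).trans
        ((congrArg (Coh.fmap F) (map_zero _)).trans (map_zero _)).symm)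
    | .cons h .nil =>
      exact ((congrArg (X.castTo N) (letter_nil_cons_nil ..)).trans
        (X.castTo_castTo _ (by simp) _)).trans
        ((congrArg (fun f => X.castTo N (Coh.fmap F f)) (P.letter_nil_cons_nil h)).trans
          (hF (by simp) _)).symm
    | .cons h (.cons h' hs) => exact congrArg (X.castTo N) ((letter_nil_cons_cons ..).trans
        ((congrArg (Coh.fmap F) (P.letter_nil_cons_cons h h' hs)).trans (map_zero _)).symm)
  | .cons g .nil =>
    exact ((congrArg (X.castTo N) (letter_single ..)).trans
      (X.castTo_castTo _ (by simp; ring) _)).trans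
        ((congrArg (fun f => X.castTo N (Coh.fmap F f)) (P.letter_single g hs)).trans
          (hF (by simp; ring) _)).symm
  | .cons g (.cons g' gs) =>
    have h₀ : X.castTo N (Coh.fmap F (P.letter (.cons g (.cons g' gs)) hs)) = 0 := by
      rw [letter_cons_cons, map_zero, map_zero]
    exact ((congrArg (X.castTo N) (letter_cons_cons ..)).trans (map_zero _)).trans h₀.symm

/-- A letter of Q without K-entry is supported on single morphisms of Y, so among all interleavings
only the letter of P contributes. -/
theorem sumInt_letter_nil (P : Pairing D E Y) {K : DGCat k} {Q : Pairing K Y X}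
    (hQ : Q.IsTwisted) (u : K.Obj) (gs : Chain D d d') (hs : Chain E e e') (N : ℤ) :
    (P.sumInt gs hs fun l => X.castTo N (Q.letter (.nil : Chain K u u) l)) =
      X.castTo N (Q.right u (P.letter gs hs)) := by
  rw [P.sumInt_of_cons_cons_eq_zero gs hs (hQ.isLin_letter_right (.nil : Chain K u u) N)
      fun f g c => by rw [letter_nil_cons_cons, map_zero],
    P.nilPart_eq_zero gs hs, zero_add, letter_nil_cons_nil, X.castTo_castTo _ (by simp)]
  rintro rfl rfl
  exact (congrArg (X.castTo N) (letter_nil_nil ..)).trans (map_zero _)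

/-- The two interleavings of three chains have the same corestriction to single morphisms of X.
Without Θ it is the image under F of the letter of P, with one Θ it is the brace of Θ with `gs`
evaluated on `hs`, and with two or more both sides vanish. -/
theorem IsTwisted.sumInt_letter (hP : P.IsTwisted) {F F' : (Coh Y X).Obj}
    (Θs : Chain (Coh Y X) F F') (gs : Chain D d d') (hs : Chain E e e') (N : ℤ) :
    (P.sumInt gs hs fun l => X.castTo N ((evalPairing Y X).letter Θs l)) =
      (TT.univ (Coh Y X) D).sumInt Θs gs fun w =>
        X.castTo N ((hP.bracePairing X).letter w hs) := by
  have hQ := evalPairing_isTwisted Y X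
  have hR : ∀ {F F' : (Coh Y X).Obj} (Θs : Chain (Coh Y X) F F') (gs : Chain D d d'),
      ((TT.univ (Coh Y X) D).sumInt Θs gs fun w =>
        X.castTo N ((hP.bracePairing X).letter w hs)) =
      ((TT.univ (Coh Y X) D).nilPart Θs gs fun w =>
        X.castTo N ((hP.bracePairing X).letter w hs)) +
      X.castTo N ((hP.bracePairing X).letter
        (.cons ((TT.univ (Coh Y X) D).letter Θs gs) .nil) hs) := fun Θs gs =>
    sumInt_of_cons_cons_eq_zero (P := TT.univ (Coh Y X) D) Θs gs
      ((hP.bracePairing_isTwisted X).isLin_letter_left hs N)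
      fun f g c => (congrArg (X.castTo N) (letter_cons_cons ..)).trans (map_zero _)
  match Θs with
  | .nil =>
    exact (P.sumInt_letter_nil hQ F gs hs N).trans
      ((hP.letter_bracePairing_rightChain F gs hs N).symm.trans
        ((TT.univ (Coh Y X) D).sumInt_nil (d := F) gs fun w =>
          X.castTo N ((hP.bracePairing X).letter w hs)).symm)
  | .cons Θ .nil =>
    refine Eq.trans ?_ ((hR (.cons Θ .nil) gs).trans (zero_add _)).symm
    refine Eq.trans ?_ (((congrArg (X.castTo N) (letter_single ..)).trans
      (X.castTo_castTo _ (by simp; ring) _)).trans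
      (hP.castTo_bracePairing_eps Θ gs hs (by simp; ring) N)).symm
    refine P.sumInt_congr gs hs fun l _ => ?_
    exact (congrArg (X.castTo N) (letter_single ..)).trans (X.castTo_castTo _ (by simp; ring) _)
  | .cons Θ (.cons Θ' Θs) =>
    refine Eq.trans ?_ ((hR (.cons Θ (.cons Θ' Θs)) gs).trans (zero_add _)).symm
    have hz : X.castTo N ((hP.bracePairing X).letter
        (.cons (0 : (TT (Coh Y X) D).Hom (TT.obj F d) (TT.obj F' d') (1 + ((Chain.cons Θ (.cons Θ' Θs)).deg + gs.deg)))
          .nil) hs) = 0 :=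
      ((hP.bracePairing_isTwisted X).isLin_letter_left hs N).head_zero .nil
    refine Eq.trans ?_ hz.symm
    refine (P.sumInt_congr gs hs fun l _ => ?_).trans (P.sumInt_zero gs hs)
    exact (congrArg (X.castTo N) (letter_cons_cons ..)).trans (map_zero _)

section

variable {K Z : DGCat k} {u u' : K.Obj}

/-- Splits off the leftmost entry of the outer interleaving. The part of b that it absorbs is itself
a sum over interleavings of pieces a, b of `gs`, `hs`, so the entry becomes the corestriction of the
composite coalgebra map. -/
theorem sumInt_nested_right (P : Pairing D E Y) {Q : Pairing K Y X} (hQ : Q.IsTwisted)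
    (fs : Chain K u u') (gs : Chain D d d') (hs : Chain E e e')
    {φ : Chain X (Q.obj u (P.obj d e)) (Q.obj u' (P.obj d' e')) → M} (hφ : IsLin φ) :
    (P.sumInt gs hs fun b => Q.sumInt fs b φ) =
      (P.nilPart gs hs fun b => Q.nilPart fs b φ) +
      fs.sumCuts fun s => sumCuts₂ gs hs fun _ _ a b a' b' =>
        sgn k (s.right.deg * (a.deg + b.deg)) • P.sumInt a' b' fun r =>
          Q.sumInt s.right r fun c => φ (.cons (P.sumInt a b fun l =>
            X.castTo (1 + (s.left.deg + (a.deg + b.deg))) (Q.letter s.left l)) c) := by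
  rw [P.sumInt_congr gs hs fun b _ => Q.sumInt_eq fs b hφ, sumInt_add,
    P.sumInt_of_cons_eq_zero gs hs (Q.isLin_nilPart_right fs φ) fun f c => by cases fs <;> rfl]
  congr 1
  refine (P.sumInt_sumCuts_comm gs hs fs fun b s => b.sumCuts fun t =>
    sgn k (s.right.deg * t.left.deg) • Q.sumInt s.right t.right fun c =>
      φ (.cons (Q.letter s.left t.left) c)).trans ?_
  refine sumCuts_congr _ fun s _ => ?_
  have hl : ∀ {v : Y.Obj} (r : Chain X (Q.obj u (P.obj d e)) (Q.obj s.mid v)),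
      IsLin fun l : Chain Y v (P.obj d' e') => φ (cons (Q.letter s.left l) r) := fun r =>
    hφ.cons_family (fun n => 1 + (s.left.deg + n)) (hQ.isLin_letter_right s.left) r
  rw [P.sumInt_sumCuts gs hs (fun y l r => sgn k (s.right.deg * l.deg) •
    Q.sumInt s.right r fun c => φ (.cons (Q.letter s.left l) c))
    (fun y r => (Q.isLin_sumInt _ _ fun c => hl c).smul_deg fun n => sgn k (s.right.deg * n))
    (fun y l => (hQ.isLin_sumInt_right s.right (hφ.tail _)).map
      (sgn k (s.right.deg * l.deg) • LinearMap.id))]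
  refine sumCuts₂_congr _ _ fun v w a b a' b' _ _ => ?_
  -- The sum over the remainder is linear in the head entry; applying this linear map to a sum of
  -- letters moves the sum over the interleavings of a, b inside the head.
  let L : X.Hom (Q.obj s.mid (P.obj v w)) (Q.obj u' (P.obj d' e'))
      (1 + (s.left.deg + (a.deg + b.deg))) →ₗ[k] M :=
    { toFun := fun f => P.sumInt a' b' fun r => Q.sumInt s.right r fun c => φ (.cons f c)
      map_add' := fun f g => by
        rw [← sumInt_add]
        exact P.sumInt_congr _ _ fun r _ => map_add (Q.sumIntHead s.right r hφ) f g
      map_smul' := fun t f => by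
        rw [RingHom.id_apply, smul_sumInt]
        exact P.sumInt_congr _ _ fun r _ => map_smul (Q.sumIntHead s.right r hφ) t f }
  refine Eq.trans ?_ (congrArg (sgn k (s.right.deg * (a.deg + b.deg)) • ·)
    (P.map_sumInt a b L _)).symm
  refine Eq.trans ?_ (P.smul_sumInt ..).symm
  refine P.sumInt_congr a b fun l hl' => ?_
  rw [show ∀ f, L f = P.sumInt a' b' fun r => Q.sumInt s.right r fun c => φ (.cons f c) from
    fun _ => rfl, ← smul_sumInt,
    show sgn k (s.right.deg * l.deg) = sgn k (s.right.deg * (a.deg + b.deg)) by rw [hl']]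
  refine congrArg _ (P.sumInt_congr _ _ fun r _ => Q.sumInt_congr _ _ fun c _ => ?_)
  exact (cons_castTo (by rw [hl']) _ _ φ).symm

/-- The counterpart of `sumInt_nested_right` for the other bracketing, where the chain in the first
argument of the outer pairing is the interleaved one. -/
theorem sumInt_nested_left (U : Pairing K D Z) {R : Pairing Z E X}
    (hR : R.IsTwisted) (fs : Chain K u u') (gs : Chain D d d') (hs : Chain E e e')
    {φ : Chain X (R.obj (U.obj u d) e) (R.obj (U.obj u' d') e') → M} (hφ : IsLin φ) :
    (U.sumInt fs gs fun w => R.sumInt w hs φ) =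
      (U.nilPart fs gs fun w => R.nilPart w hs φ) +
      hs.sumCuts fun t => sumCuts₂ fs gs fun _ _ a b a' b' =>
        sgn k ((a'.deg + b'.deg) * t.left.deg) • U.sumInt a' b' fun w =>
          R.sumInt w t.right fun c => φ (.cons (U.sumInt a b fun l =>
            X.castTo (1 + (a.deg + (b.deg + t.left.deg))) (R.letter l t.left)) c) := by
  rw [U.sumInt_congr fs gs fun w _ => R.sumInt_eq w hs hφ, sumInt_add,
    U.sumInt_of_cons_eq_zero fs gs (R.isLin_nilPart_left hs φ) fun f c => rfl]
  congr 1
  have h₀ : ∀ w : Chain Z (U.obj u d) (U.obj u' d'), (sumCuts₂ w hs fun _ _ a b a' b' =>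
      R.sumInt a' b' fun c => φ (.cons (R.letter a b) c)) =
      hs.sumCuts fun t => w.sumCuts fun s => sgn k (s.right.deg * t.left.deg) •
        R.sumInt s.right t.right fun c => φ (.cons (R.letter s.left t.left) c) := fun w =>
    sumCuts_comm ..
  simp only [h₀]
  rw [sumInt_sumCuts_comm]
  refine sumCuts_congr _ fun t _ => ?_
  have hl : ∀ {v : Z.Obj} (r : Chain X (R.obj (U.obj u d) e) (R.obj v t.mid)),
      IsLin fun l : Chain Z v (U.obj u' d') => φ (cons (R.letter l t.left) r) := fun r =>
    hφ.cons_family (fun n => 1 + (n + t.left.deg)) (hR.isLin_letter_left t.left) r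
  rw [U.sumInt_sumCuts fs gs (fun y l r => sgn k (r.deg * t.left.deg) •
    R.sumInt r t.right fun c => φ (.cons (R.letter l t.left) c))
    (fun y r => (R.isLin_sumInt _ _ fun c => hl c).map (sgn k (r.deg * t.left.deg) • LinearMap.id))
    (fun y l => (hR.isLin_sumInt_left t.right (hφ.tail _)).smul_deg
      fun n => sgn k (n * t.left.deg))]
  refine sumCuts₂_congr _ _ fun v w a b a' b' _ _ => ?_
  let L : X.Hom (R.obj (U.obj v w) t.mid) (R.obj (U.obj u' d') e')
      (1 + (a.deg + (b.deg + t.left.deg))) →ₗ[k] M :=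
    { toFun := fun f => U.sumInt a' b' fun r => R.sumInt r t.right fun c => φ (.cons f c)
      map_add' := fun f g => by
        rw [← sumInt_add]
        exact U.sumInt_congr _ _ fun r _ => map_add (R.sumIntHead r t.right hφ) f g
      map_smul' := fun x f => by
        rw [RingHom.id_apply, smul_sumInt]
        exact U.sumInt_congr _ _ fun r _ => map_smul (R.sumIntHead r t.right hφ) x f }
  refine Eq.trans ?_ (congrArg (sgn k ((a'.deg + b'.deg) * t.left.deg) • ·)
    (U.map_sumInt a b L _)).symm
  refine Eq.trans ?_ (U.smul_sumInt ..).symm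
  refine U.sumInt_congr a b fun l hl' => ?_
  rw [show ∀ f, L f = U.sumInt a' b' fun r => R.sumInt r t.right fun c => φ (.cons f c) from
    fun _ => rfl, smul_sumInt]
  refine U.sumInt_congr _ _ fun r hr => ?_
  rw [hr]
  refine congrArg _ (R.sumInt_congr _ _ fun c _ => ?_)
  exact (cons_castTo (by rw [hl', add_assoc]) _ _ φ).symm

end

/-- Associativity of sums over interleavings. -/
theorem IsTwisted.sumInt_sumInt (hP : P.IsTwisted) {F F' : (Coh Y X).Obj}
    (Θs : Chain (Coh Y X) F F') (gs : Chain D d d') (hs : Chain E e e')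
    (φ : Chain X (Coh.fobj F (P.obj d e)) (Coh.fobj F' (P.obj d' e')) → M) (hφ : IsLin φ) :
    (P.sumInt gs hs fun b => (evalPairing Y X).sumInt Θs b φ) =
      (TT.univ (Coh Y X) D).sumInt Θs gs fun w => (hP.bracePairing X).sumInt w hs φ := by
  have hQ := evalPairing_isTwisted Y X
  have hR := hP.bracePairing_isTwisted X
  -- Both sides satisfy the same recursion in the leftmost entry, so induction on the total length
  -- of the three chains reduces their equality to that of the corestrictions.
  obtain ⟨N, hN⟩ : ∃ N, Θs.length + gs.length + hs.length ≤ N := ⟨_, le_rfl⟩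
  induction N using Nat.strong_induction_on generalizing F F' d d' e e' with
  | _ N ih => ?_
  refine (P.sumInt_nested_right hQ Θs gs hs hφ).trans
    (Eq.trans ?_ ((TT.univ (Coh Y X) D).sumInt_nested_left hR Θs gs hs hφ).symm)
  refine congrArg₂ (· + ·) ?_ ?_
  · cases Θs <;> cases gs <;> cases hs <;> rfl
  simp only [sumCuts₂]
  refine Eq.trans ?_ (sumCuts_comm ..)
  refine sumCuts_congr _ fun s hs' => ?_
  refine Eq.trans ?_ (sumCuts_comm ..)
  refine sumCuts_congr _ fun s₁ hs₁ => sumCuts_congr _ fun t ht => ?_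
  -- The two bracketings give the same Koszul sign: each right piece moves past the left pieces of
  -- all later factors.
  rw [sgn_smul_sgn_smul, sgn_smul_sgn_smul,
    show s₁.right.deg * t.left.deg + s.right.deg * (s₁.left.deg + t.left.deg) =
      s.right.deg * s₁.left.deg + (s.right.deg + s₁.right.deg) * t.left.deg by ring]
  refine congrArg _ ?_
  have hT := hP.sumInt_letter s.left s₁.left t.left
    (1 + (s.left.deg + (s₁.left.deg + t.left.deg)))
  rw [← hs', ← hs₁, ← ht, length_append, length_append, length_append] at hN
  -- If some left piece is nonempty, the right pieces have smaller total length. If all are empty,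
  -- the head entry is zero on both sides, so the induction hypothesis is not needed.
  by_cases h0 : 0 < s.left.length + s₁.left.length + t.left.length
  · refine (ih (N - 1) (by omega) s.right s₁.right t.right _ (hφ.tail _) (by omega)).trans ?_
    exact congrArg (fun T => (TT.univ (Coh Y X) D).sumInt s.right s₁.right fun w =>
      (hP.bracePairing X).sumInt w t.right fun c => φ (.cons T c)) hT
  · have hz : (P.sumInt s₁.left t.left fun l =>
        X.castTo (1 + (s.left.deg + (s₁.left.deg + t.left.deg)))
          ((evalPairing Y X).letter s.left l)) = 0 := by
      obtain ⟨u, a, a'⟩ := s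
      obtain ⟨v, b, b'⟩ := s₁
      obtain ⟨w, c, c'⟩ := t
      cases a with
      | cons f a => simp at h0
      | nil =>
        cases b with
        | cons f b => simp at h0
        | nil =>
          cases c with
          | cons f c => simp at h0
          | nil =>
            exact (P.sumInt_nil ..).trans
              ((congrArg (X.castTo _) (letter_nil_nil ..)).trans (map_zero _))
    have h₁ : ∀ {x : X.Obj} {n : ℤ} {T : X.Hom x (Coh.fobj F' (P.obj d' e')) n} (c), T = 0 →
        φ (.cons T c) = 0 := by
      rintro x n _ c rfl
      exact hφ.head_zero c
    refine Eq.trans (b := 0) ?_ (Eq.symm ?_)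
    · exact (P.sumInt_congr _ _ fun r _ => ((evalPairing Y X).sumInt_congr _ _ fun c _ =>
        h₁ c hz).trans (sumInt_zero ..)).trans (sumInt_zero ..)
    · refine (congrArg (fun T => (TT.univ (Coh Y X) D).sumInt s.right s₁.right fun w =>
        (hP.bracePairing X).sumInt w t.right fun c => φ (.cons T c)) (hT.symm.trans hz)).trans ?_
      refine ((TT.univ (Coh Y X) D).sumInt_congr _ _ (ψ := fun _ => 0) fun w _ => ?_).trans
        (sumInt_zero ..)
      refine ((hP.bracePairing X).sumInt_congr _ _ (ψ := fun _ => 0) fun c _ => ?_).trans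
        (sumInt_zero ..)
      exact hφ.head_zero c

end Pairing
end Twisted

/-! ### The associativity square. -/

namespace Twisted

variable {k : Type u} [Field k]

open PreCochain

theorem Chain.map_id {C : DGCat k} {x y : C.Obj} (c : Chain C x y) :
    (c.map (DGFunctor.id C).obj fun f => (DGFunctor.id C).map f) = c := by
  induction c with
  | nil => rfl
  | cons f c ih => exact congrArg (Chain.cons f) ih

namespace Pairing

open Chain

variable {D E X Z : DGCat k} {M : Type u} [AddCommGroup M] [Module k M]

/-- The pairing obtained from J is evaluation pulled back along J, so both recursions produce the
same chains; the signs agree because J preserves degrees. -/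
theorem interleave_uncurry (J : DGFunctor Z (Coh E X)) {z z' : Z.Obj} {e e' : E.Obj}
    (w : Chain Z z z') (hs : Chain E e e') :
    (uncurry J).interleave w hs =
      (evalPairing E X).interleave (w.map J.obj fun f => J.map f) hs := by
  induction w generalizing e' with
  | nil => rfl
  | cons f w ih =>
    have h₁ := deg_map J.obj (fun f => J.map f) (Chain.cons f w)
    have h₂ := deg_map J.obj (fun f => J.map f) w
    simp only [Chain.map] at h₁
    simp only [interleave, ih, Chain.map, h₁, h₂]
    rfl

theorem sumInt_uncurry (J : DGFunctor Z (Coh E X)) {z z' : Z.Obj} {e e' : E.Obj}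
    (w : Chain Z z z') (hs : Chain E e e')
    (φ : Chain X (Coh.fobj (J.obj z) e) (Coh.fobj (J.obj z') e') → M) :
    (uncurry J).sumInt w hs φ =
      (evalPairing E X).sumInt (w.map J.obj fun f => J.map f) hs φ :=
  congrArg (fun l : List (ℤ × Chain X (Coh.fobj (J.obj z) e) (Coh.fobj (J.obj z') e')) =>
    (l.map fun t : ℤ × Chain X (Coh.fobj (J.obj z) e) (Coh.fobj (J.obj z') e') =>
      sgn k t.1 • φ t.2).sum) (interleave_uncurry J w hs)

end Pairing

namespace TT

open Chain

theorem evalChain_twistedComp_eps {A B C : DGCat k} {G G' : (Coh B C).Obj} {p n : ℤ}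
    (Θ : (Coh B C).Hom G G' p) {F F' : (Coh A B).Obj} (Ψs : Chain (Coh A B) F F')
    (h : p + Ψs.deg = n) {x y : A.Obj} (c : Chain A x y) :
    Coh.evalChain c ((twistedComp A B C).map
      ((TT (Coh B C) (Coh A B)).castTo n (eps Θ Ψs))) =
    (evalPairing A B).sumInt Ψs c fun b => C.castTo (n + c.deg) (Coh.evalChain b Θ) := by
  subst h
  rw [(TT (Coh B C) (Coh A B)).castTo_self]
  rfl

theorem evalChain_map_twistedComp_eps {A B C V : DGCat k} {x' y' : (TT (Coh C V) (Coh B C)).Obj}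
    {n : ℤ} (f : (TT (Coh C V) (Coh B C)).Hom x' y' n) {F F' : (Coh A B).Obj}
    (Ψs : Chain (Coh A B) F F') {x y : A.Obj} (c : Chain A x y) :
    Coh.evalChain c ((twistedComp A B V).functor.map
      ((map (twistedComp B C V).functor (DGFunctor.id (Coh A B))).map
        (eps (C := TT (Coh C V) (Coh B C)) f Ψs))) =
    (evalPairing A B).sumInt Ψs c fun b => V.castTo (n + Ψs.deg + c.deg)
      (Coh.evalChain b ((twistedComp B C V).map f)) :=
  (evalChain_twistedComp_eps ((twistedComp B C V).map f)
    (Ψs.map (DGFunctor.id (Coh A B)).obj fun f => (DGFunctor.id (Coh A B)).map f)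
    (by rw [deg_map]) c).trans
    (congrArg (fun Ψs' : Chain (Coh A B) F F' => (evalPairing A B).sumInt Ψs' c fun b =>
      V.castTo (n + Ψs.deg + c.deg) (Coh.evalChain b ((twistedComp B C V).map f)))
        (Chain.map_id Ψs))

/-- The chain w is first sent to `Coh A C` by the twisted composition; `sumInt_uncurry` rewrites
interleavings of its image as interleavings of w for the uncurried pairing. The free degree n lets
the image of `ε(Θ; w)` be recast to a degree independent of w. -/
theorem evalChain_map_id_twistedComp_eps {A B C V : DGCat k} {H H' : (Coh C V).Obj} {p n : ℤ}
    (Θ : (Coh C V).Hom H H' p) {x' y' : (TT (Coh B C) (Coh A B)).Obj}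
    (w : Chain (TT (Coh B C) (Coh A B)) x' y') (h : p + w.deg = n) {x y : A.Obj}
    (c : Chain A x y) :
    Coh.evalChain c ((twistedComp A C V).functor.map
      ((map (DGFunctor.id (Coh C V)) (twistedComp A B C).functor).map
        ((TT (Coh C V) (TT (Coh B C) (Coh A B))).castTo n (eps Θ w)))) =
    (Pairing.uncurry (twistedComp A B C).functor).sumInt w c fun b =>
      V.castTo (n + c.deg) (Coh.evalChain b Θ) := by
  subst h
  rw [DGCat.castTo_self]
  exact (evalChain_twistedComp_eps Θ (w.map (twistedComp A B C).functor.obj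
    fun f => (twistedComp A B C).functor.map f) (by rw [deg_map]) c).trans
    (Pairing.sumInt_uncurry (twistedComp A B C).functor w c fun b =>
      V.castTo (p + w.deg + c.deg) (Coh.evalChain b Θ)).symm

theorem twistedComp_assoc (A B C V : DGCat k)
    (α : DGMap (TT (TT (Coh C V) (Coh B C)) (Coh A B)) (TT (Coh C V) (TT (Coh B C) (Coh A B)))
      fun x => obj x.1.1 (obj x.1.2 x.2)) (hα : IsAssociator α) :
    (map (twistedComp B C V).functor (DGFunctor.id (Coh A B))).comp (twistedComp A B V).functor =
      (α.functor.comp (map (DGFunctor.id (Coh C V)) (twistedComp A B C).functor)).comp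
        (twistedComp A C V).functor := by
  -- Composition of dg functors is associative by definition, so both composites have the same
  -- action on objects and can be compared as dg functors over this fixed action.
  let o : (TT (TT (Coh C V) (Coh B C)) (Coh A B)).Obj → (Coh A V).Obj := fun x =>
    DGFunctor.comp x.2 (DGFunctor.comp x.1.2 x.1.1)
  refine congrArg (fun F : DGMap _ _ o => (⟨o, F⟩ : DGFunctor _ _)) (map_ext_left
    (F := ((map (twistedComp B C V).functor (DGFunctor.id (Coh A B))).comp
      (twistedComp A B V).functor).toMap)
    (G := ((α.functor.comp (map (DGFunctor.id (Coh C V)) (twistedComp A B C).functor)).comp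
        (twistedComp A C V).functor).toMap) ?_ ?_ ?_)
  · intro H G F F' n Ψ
    have e := congrArg (fun f => (twistedComp A C V).functor.map
      ((map (DGFunctor.id (Coh C V)) (twistedComp A B C).functor).map f)) (hα.right H G Ψ)
    exact Eq.trans rfl e.symm
  -- On `ε(id ⊗ Ξ; Ψs)` both sides apply H to the brace of Ξ with the Ψ; it only remains to take the
  -- linear map H through the sum.
  · intro H G G' n Ξ F F' Ψs
    have e := congrArg (fun f => (twistedComp A C V).functor.map
      ((map (DGFunctor.id (Coh C V)) (twistedComp A B C).functor).map f)) (hα.eps_right H Ξ Ψs)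
    refine Eq.trans ?_ e.symm
    refine Coh.ext fun {x y} c => ?_
    refine (evalChain_map_twistedComp_eps (right H Ξ) Ψs c).trans ?_
    have h₁ := (evalPairing A B).map_sumInt Ψs c (Coh.fmap H (x := Coh.fobj G (Coh.fobj F x))
        (y := Coh.fobj G' (Coh.fobj F' y)))
      fun b => C.castTo (n + Ψs.deg + c.deg) (Coh.evalChain b Ξ)
    have h₂ := (evalPairing A B).sumInt_congr Ψs c fun b _ =>
      DGFunctor.map_castTo H (n + Ψs.deg + c.deg) (Coh.evalChain b Ξ)
    exact (h₁.trans h₂).symm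
  · intro H H' p Θ G G' Ξs F F' Ψs
    have e := congrArg (fun f => (twistedComp A C V).functor.map
      ((map (DGFunctor.id (Coh C V)) (twistedComp A B C).functor).map f)) (hα.eps_eps Θ Ξs Ψs)
    refine Eq.trans ?_ e.symm
    refine Coh.ext fun {x y} c => ?_
    refine (evalChain_map_twistedComp_eps (eps Θ Ξs) Ψs c).trans ?_
    have h₁ : ((evalPairing A B).sumInt Ψs c fun b => V.castTo (p + Ξs.deg + Ψs.deg + c.deg)
        (Coh.evalChain b ((twistedComp B C V).map (eps Θ Ξs)))) =
        (evalPairing A B).sumInt Ψs c fun b => (evalPairing B C).sumInt Ξs b fun b' =>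
          V.castTo (p + Ξs.deg + Ψs.deg + c.deg) (Coh.evalChain b' Θ) :=
      (evalPairing A B).sumInt_congr Ψs c fun b _ =>
        Pairing.castTo_braceVal (P := evalPairing B C) (Coh.val Θ) Ξs b _
    -- Associativity of interleavings for the evaluation pairing of `Coh A B` with A. Its brace
    -- pairing is by definition the uncurried twisted composition, which is the pairing occurring in
    -- h₄.
    have h₂ := (evalPairing_isTwisted A B).sumInt_sumInt Ξs Ψs c
      (fun b => V.castTo (p + Ξs.deg + Ψs.deg + c.deg) (Coh.evalChain b Θ)) (Θ.2.isLin _ _ _)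
    have h₃ := (univ (Coh B C) (Coh A B)).map_sumInt Ξs Ψs
      (Coh.evalChain c ∘ₗ (twistedComp A C V).functor.map ∘ₗ
        (map (DGFunctor.id (Coh C V)) (twistedComp A B C).functor).map)
      fun w => (TT (Coh C V) (TT (Coh B C) (Coh A B))).castTo (p + Ξs.deg + Ψs.deg) (eps Θ w)
    have h₄ := (univ (Coh B C) (Coh A B)).sumInt_congr Ξs Ψs fun w hw =>
      evalChain_map_id_twistedComp_eps (n := p + Ξs.deg + Ψs.deg) Θ w (by rw [hw, add_assoc]) c
    exact ((h₁.trans h₂).trans h₄.symm).trans h₃.symm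

end TT
end Twisted

theorem theorem1p4 (k : Type u) [Field k] :
    -- existence and uniqueness of the one-sided associator
    (∀ C D E : Twisted.DGCat k,
      ∃! α : Twisted.DGMap (Twisted.TT (Twisted.TT C D) E) (Twisted.TT C (Twisted.TT D E))
          fun x => Twisted.TT.obj x.1.1 (Twisted.TT.obj x.1.2 x.2),
        Twisted.IsAssociator α) ∧
    -- existence of the twisted composition
    ∃ m : ∀ A B C : Twisted.DGCat k,
        Twisted.DGMap (Twisted.TT (Twisted.Coh B C) (Twisted.Coh A B)) (Twisted.Coh A C)
          fun x => Twisted.DGFunctor.comp x.2 x.1,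
      (∀ A B C : Twisted.DGCat k, Twisted.IsTwistedComposition (m A B C)) ∧
      -- the associativity square, where `F.comp G` is first `F` and then `G`
      ∀ (A B C D : Twisted.DGCat k)
        (α : Twisted.DGMap
          (Twisted.TT (Twisted.TT (Twisted.Coh C D) (Twisted.Coh B C)) (Twisted.Coh A B))
          (Twisted.TT (Twisted.Coh C D) (Twisted.TT (Twisted.Coh B C) (Twisted.Coh A B)))
          fun x => Twisted.TT.obj x.1.1 (Twisted.TT.obj x.1.2 x.2)),
        Twisted.IsAssociator α →
        (Twisted.TT.map (m B C D).functor (Twisted.DGFunctor.id (Twisted.Coh A B))).comp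
            (m A B D).functor =
          (α.functor.comp
            (Twisted.TT.map (Twisted.DGFunctor.id (Twisted.Coh C D)) (m A B C).functor)).comp
            (m A C D).functor := by
  exact ⟨Twisted.TT.existsUnique_isAssociator, Twisted.TT.twistedComp,
    Twisted.TT.twistedComp_isTwistedComposition, Twisted.TT.twistedComp_assoc⟩
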